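/- **Setting.** Let $m\ge 1$, $\rho_0,\dots,\rho_m\in\mathbb C\setminus\mathbb Z_{\ge 0}$, let $S\subset\mathbb R$ be open, and let $z_0,\dots,z_m:S\to\mathbb C$ be $C^1$ with $z_0(t)=0$ and $z_0(t),\dots,z_m(t)$ pairwise distinct for all $t\in S$. Write $\mathbb T$ for the unit circle; for each $j$ either $z_j(t)\notin\mathbb T$ for all $t\in S$, or $z_j(t)\in\mathbb T$ for all $t\in S$ and $\operatorname{Re}\rho_j>0$. Put $W(z)=\prod_j(z-z_j)$ and $2V/W=\sum_j\rho_j/(z-z_j)$. Dots are $d/dt$, primes are $d/dz$. Let $D\subset S\times\mathbb C$ be open, contain no $(t,z_j(t))$, and contain $(t,\zeta)$ for all $t\in S$, $\zeta\in\mathbb T\setminus\{z_0(t),\dots,z_m(t)\}$. Let the weight $w(z;t)$ be continuous on $D$, complex differentiable in $z$ and differentiable in $t$ there, with $$Ww'=2Vw,\qquad \dot w=-\Big(\sum_j\frac{\rho_j\dot z_j}{z-z_j}\Big)w .$$ Fix $n\ge 0$. For $t\in S$ let $\phi_k,\bar\phi_k$ ($0\le k\le n+1$) be polynomials of degree $k$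 with the same leading coefficient $\kappa_k$ and $\int_{\mathbb T}\frac{d\zeta}{2\pi i\zeta}w(\zeta)\phi_i(\zeta)\bar\phi_j(\bar\zeta)=\delta_{ij}$ ($\bar\phi_j$ is independent of $\phi_j$, not its conjugate). Suppose that each $\kappa_k$ is continuous in $t$ and that $\phi_{n+1}(0)\neq0$, $\bar\phi_{n+1}(0)\ne 0$ on $S$. Put $\phi_k^*(z)=z^k\bar\phi_k(1/z)$, $r_n=\phi_n(0)/\kappa_n$, and $$F(z)=\int_{\mathbb T}\frac{d\zeta}{2\pi i\zeta}\frac{\zeta+z}{\zeta-z}w(\zeta),\qquad \epsilon_k=\psi_k+F\phi_k,\qquad \epsilon_k^*=\psi_k^*-F\phi_k^*,$$ where $\psi_0=\psi_0^*=1/\kappa_0$ and, for $k\ge1$, $$\psi_k(z)=\int_{\mathbb T}\tfrac{d\zeta}{2\pi i\zeta}\tfrac{\zeta+z}{\zeta-z}w(\zeta)[\phi_k(\zeta)-\phi_k(z)],\qquad \psi^*_k(z)=-\int_{\mathbb T}\tfrac{d\zeta}{2\pi i\zeta}\tfrac{\zeta+z}{\zeta-z}w(\zeta)[z^k\bar\phi_k(\bar\zeta)-\phi^*_k(z)].$$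 The coefficient functions are the polynomials $\Theta_n,\Theta_n^*,\Omega_n,\Omega_n^*$ such that for $z\notin\mathbb T$ $$2\tfrac{\phi_{n+1}(0)}{\kappa_n}z^n\Theta_n=W(\epsilon_n\phi_n'-\phi_n\epsilon_n')+2V\phi_n\epsilon_n,$$ $$2\tfrac{\bar\phi_{n+1}(0)}{\kappa_n}z^{n+1}\Theta_n^*=W(\phi_n^*\epsilon_n^{*\prime}-\epsilon_n^*\phi_n^{*\prime})-2V\phi_n^*\epsilon_n^*,$$ $$2\tfrac{\phi_{n+1}(0)}{\kappa_n}z^n\Omega_n=W(\epsilon_{n+1}\phi_n'-\phi_{n+1}\epsilon_n')+V(\phi_n\epsilon_{n+1}+\epsilon_n\phi_{n+1}),$$ $$2\tfrac{\bar\phi_{n+1}(0)}{\kappa_n}z^{n+1}\Omega^*_n=W(\phi^*_{n+1}\epsilon_n^{*\prime}-\epsilon^*_{n+1}\phi_n^{*\prime})-V(\phi^*_n\epsilon^*_{n+1}+\epsilon^*_n\phi^*_{n+1}).$$ Let $$Y_n=\begin{pmatrix}\phi_n&\epsilon_n/w\\ \phi_n^*&-\epsilon_n^*/w\end{pmatrix},\qquad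 B_\infty=\begin{pmatrix}\dot\kappa_n/\kappa_n&0\\ \dfrac{\kappa_n\dot{\bar\phi}_n(0)+\dot\kappa_n\bar\phi_n(0)}{\kappa_n^2}&-\dot\kappa_n/\kappa_n\end{pmatrix},$$ $$A_n=\frac1W\begin{pmatrix}-\big[\Omega_n+V-\frac{\kappa_{n+1}}{\kappa_n}z\Theta_n\big]&\frac{\phi_{n+1}(0)}{\kappa_n}\Theta_n\\ -\frac{\bar\phi_{n+1}(0)}{\kappa_n}z\Theta_n^*&\Omega_n^*-V-\frac{\kappa_{n+1}}{\kappa_n}\Theta_n^*\end{pmatrix},$$ let $A_{nj}$ be $\frac{\rho_j}{2V(z_j)}$ times the value of the matrix $WA_n$ at $z_j$, and $A_{n\infty}=-\sum_jA_{nj}$. The *deformation system* at $(t,z)$ for functions $f,f^*,e,e^*$ of $t$ (all sums over $1\le j\le m$) is $$\dot f=\Big\{-\tfrac{\dot\kappa_n}{\kappa_n}-\sum\rho_j\tfrac{\dot z_j}{z_j}+\tfrac12\sum\rho_j\tfrac{\dot z_j}{z_j}z_j^{-n}\epsilon_n(z_j)\phi_n^*(z_j)\tfrac{z}{z-z_j}\Big\}f-\Big\{\tfrac12\sum\rho_j\tfrac{\dot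 z_j}{z_j}z_j^{1-n}\epsilon_n(z_j)\phi_n(z_j)\tfrac1{z-z_j}\Big\}f^*,$$ $$\dot f^*=\Big\{-\tfrac{\dot\kappa_n}{\kappa_n}+\tfrac12\sum\rho_j\tfrac{\dot z_j}{z_j}z_j^{1-n}\epsilon^*_n(z_j)\phi_n(z_j)\tfrac{1}{z-z_j}\Big\}f^*-\Big\{\tfrac12\sum\rho_j\tfrac{\dot z_j}{z_j}z_j^{-n}\epsilon^*_n(z_j)\phi^*_n(z_j)\tfrac z{z-z_j}\Big\}f,$$ $$\dot e=\Big\{-\tfrac{\dot\kappa_n}{\kappa_n}-\tfrac12\sum\rho_j\tfrac{\dot z_j}{z_j}z_j^{-n}\epsilon^*_n(z_j)\phi_n(z_j)\tfrac{z}{z-z_j}\Big\}e+\Big\{\tfrac12\sum\rho_j\tfrac{\dot z_j}{z_j}z_j^{1-n}\epsilon_n(z_j)\phi_n(z_j)\tfrac1{z-z_j}\Big\}e^*,$$ $$\dot e^*=\Big\{-\tfrac{\dot\kappa_n}{\kappa_n}-\tfrac12\sum\rho_j\tfrac{\dot z_j}{z_j}z_j^{1-n}\epsilon_n(z_j)\phi^*_n(z_j)\tfrac{1}{z-z_j}\Big\}e^*+\Big\{\tfrac12\sum\rho_j\tfrac{\dot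 z_j}{z_j}z_j^{-n}\epsilon^*_n(z_j)\phi^*_n(z_j)\tfrac z{z-z_j}\Big\}e.$$ **Theorem.** For every $t\in S$: $\kappa_n$ and $\bar\phi_n(0)$ are differentiable at $t$, the polynomials $\Theta_n,\Theta_n^*,\Omega_n,\Omega_n^*$ exist, and the following hold. 1. $A_n(z)=\sum_j\dfrac{A_{nj}}{z-z_j}$ for $z\ne z_0,\dots,z_m$, and $A_{n0}=\dfrac{\rho_0}{2V(0)}\begin{pmatrix}nW'(0)-2V(0)&[2V(0)-nW'(0)]r_n\\0&0\end{pmatrix}$. 2. For $(t,z)\in D$ with $z\notin\mathbb T$ and $w(z;t)\ne0$: $Y_n'=A_nY_n$; for arbitrary functions $f,f^*,e,e^*$ of time, the deformation system is equivalent to $\dot Y=B_nY$ for $Y=\begin{pmatrix}f&e/w\\f^*&-e^*/w\end{pmatrix}$, where $$B_n=B_\infty-\sum_j\frac{\dot z_j}{z-z_j}A_{nj};$$ and $\phi_n,\phi_n^*,\epsilon_n,\epsilon_n^*$ satisfy the deformation system, so that $\dot Y_n=B_nY_n$. 3. The Schlesinger equations hold: for all $j$, $$\dot A_{nj}=[B_\infty,A_{nj}]+\sum_{k\ne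 j}\frac{\dot z_j-\dot z_k}{z_j-z_k}[A_{nk},A_{nj}],\qquad \dot A_{n\infty}=[B_\infty,A_{n\infty}].$$ 4. In components: put $G_j=\Omega_n(z_j)-\frac{\kappa_{n+1}}{\kappa_n}z_j\Theta_n(z_j)$ and $G_j^*=\Omega_n^*(z_j)-\frac{\kappa_{n+1}}{\kappa_n}\Theta^*_n(z_j)$ for $j\ne0$, and $G_0=G_0^*=V(0)-\frac n2W'(0)$. Then for all $j$ $$\frac{d}{dt}\frac{\rho_j}{2V(z_j)}\Big[\Omega_n(z_j)+V(z_j)-\tfrac{\kappa_{n+1}}{\kappa_n}z_j\Theta_n(z_j)\Big]=\frac{\rho_j}{2V(z_j)}\frac{\phi_{n+1}(0)}{\kappa_n^3}\frac{d}{dt}(\kappa_n\bar\phi_n(0))\,\Theta_n(z_j)$$ $$\qquad-\frac{\rho_j}{2V(z_j)}\frac{\phi_{n+1}(0)\bar\phi_{n+1}(0)}{\kappa_n^2}\sum_{k\ne j}\frac{\rho_k}{2V(z_k)}\frac{\dot z_j-\dot z_k}{z_j-z_k}\big[z_k\Theta_n^*(z_k)\Theta_n(z_j)-z_j\Theta_n(z_k)\Theta_n^*(z_j)\big],$$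 $$\frac{d}{dt}\frac{\rho_j}{2V(z_j)}\frac{\phi_{n+1}(0)}{\kappa_n}\Theta_n(z_j)=\frac{\rho_j}{V(z_j)}\frac{\phi_{n+1}(0)}{\kappa_n}\Big\{\frac{\dot\kappa_n}{\kappa_n}\Theta_n(z_j)+\sum_{k\neq j}\frac{\rho_k}{2V(z_k)}\frac{\dot z_j-\dot z_k}{z_j-z_k}\big[\Theta_n(z_k)G_j-\Theta_n(z_j)G_k\big]\Big\},$$ $$\frac{d}{dt}\frac{\rho_j}{2V(z_j)}\frac{\bar\phi_{n+1}(0)}{\kappa_n}z_j\Theta^*_n(z_j)=\frac{\rho_j}{V(z_j)}\frac{\bar\phi_{n+1}(0)}{\kappa_n}\Big\{-\frac{\dot\kappa_n}{\kappa_n}z_j\Theta^*_n(z_j)+\frac{1}{\kappa_n\bar\phi_{n+1}(0)}\frac{d}{dt}(\kappa_n\bar\phi_n(0))\,G^*_j$$ $$\qquad-\sum_{k\neq j}\frac{\rho_k}{2V(z_k)}\frac{\dot z_j-\dot z_k}{z_j-z_k}\big[z_k\Theta^*_n(z_k)G^*_j-z_j\Theta^*_n(z_j)G^*_k\big]\Big\}.$$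 -/

import Mathlib

noncomputable section

namespace BOPUC

open Polynomial

/-- Entrywise derivative of a matrix valued function of one variable. -/
def HasEntryDerivAt {𝕜 : Type*} [NontriviallyNormedField 𝕜] [NormedAlgebra 𝕜 ℂ]
    (M : 𝕜 → Matrix (Fin 2) (Fin 2) ℂ) (M' : Matrix (Fin 2) (Fin 2) ℂ) (x : 𝕜) : Prop :=
  ∀ i k, HasDerivAt (fun y => M y i k) (M' i k) x

/-- The mean `∫_𝕋 f(ζ) dζ / (2πiζ)` over the unit circle. -/
def circleMean (f : ℂ → ℂ) : ℂ :=
  (2 * (Real.pi : ℂ) * Complex.I)⁻¹ * ∮ ζ in C(0, 1), f ζ / ζ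

/-- The matrix `(f, e/w; f*, -e*/w)`. -/
def pairMatrix (f e fs es w : ℂ) : Matrix (Fin 2) (Fin 2) ℂ :=
  !![f, e / w; fs, -es / w]

/-- The data at one value of the deformation parameter: the finite singular points
`z 0, …, z m`, a weight `w`, and two sequences of polynomials `φ_n`, `φ̄_n`. The exponents `ρ`
are a parameter, since they do not change under the deformation. What is required
of the data is said in `IsBiorthonormal` and `IsDeformation`. -/
structure System (m : ℕ) (ρ : Fin (m + 1) → ℂ) where
  z : Fin (m + 1) → ℂ
  w : ℂ → ℂ
  phi : ℕ → ℂ[X]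
  phiBar : ℕ → ℂ[X]

namespace System

variable {m : ℕ} {ρ : Fin (m + 1) → ℂ} (s : System m ρ)

/-- `W(x) = ∏_j (x - z_j)`. -/
def W : ℂ[X] := ∏ j, (X - C (s.z j))

/-- The polynomial `V` with `2V/W = ∑_j ρ_j / (x - z_j)`. -/
def V : ℂ[X] :=
  C (1 / 2) * ∑ j, C (ρ j) * ∏ k ∈ Finset.univ.erase j, (X - C (s.z k))

/-- The leading coefficient `κ_n` of `φ_n`. -/
def kappa (n : ℕ) : ℂ := (s.phi n).coeff n

/-- `φ_n(0)`. -/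
def phi0 (n : ℕ) : ℂ := (s.phi n).eval 0

/-- `φ̄_n(0)`. -/
def phiBar0 (n : ℕ) : ℂ := (s.phiBar n).eval 0

/-- The reciprocal polynomial `φ*_n(x) = x^n φ̄_n(1/x)`. -/
def phiStar (n : ℕ) : ℂ[X] := (s.phiBar n).reflect n

/-- The polynomials `φ_k`, `φ̄_k`, `k ≤ N`, are the bi-orthonormal system of the weight `w`,
normalised by equal leading coefficients. -/
structure IsBiorthonormal (N : ℕ) : Prop where
  natDegree_phi : ∀ k ≤ N, (s.phi k).natDegree = k
  natDegree_phiBar : ∀ k ≤ N, (s.phiBar k).natDegree = k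
  leading : ∀ k ≤ N, (s.phiBar k).coeff k = (s.phi k).coeff k
  orthonormal : ∀ i ≤ N, ∀ j ≤ N,
    circleMean (fun ζ => s.w ζ * (s.phi i).eval ζ * (s.phiBar j).eval ((starRingEnd ℂ) ζ))
      = if i = j then 1 else 0

/-- The Carathéodory function of the weight. -/
def F (x : ℂ) : ℂ := circleMean (fun ζ => (ζ + x) / (ζ - x) * s.w ζ)

/-- The polynomial of the second kind `ψ_n`. -/
def psi (n : ℕ) (x : ℂ) : ℂ :=
  if n = 0 then 1 / s.kappa 0
  else circleMean (fun ζ => (ζ + x) / (ζ - x) * s.w ζ * ((s.phi n).eval ζ - (s.phi n).eval x))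

/-- The reciprocal polynomial of the second kind `ψ*_n`. -/
def psiStar (n : ℕ) (x : ℂ) : ℂ :=
  if n = 0 then 1 / s.kappa 0
  else -circleMean (fun ζ => (ζ + x) / (ζ - x) * s.w ζ *
    (x ^ n * (s.phiBar n).eval ((starRingEnd ℂ) ζ) - (s.phiStar n).eval x))

/-- The associated function `ε_n = ψ_n + F φ_n`. -/
def eps (n : ℕ) (x : ℂ) : ℂ := s.psi n x + s.F x * (s.phi n).eval x

/-- The reciprocal associated function `ε*_n = ψ*_n - F φ*_n`. -/
def epsStar (n : ℕ) (x : ℂ) : ℂ := s.psiStar n x - s.F x * (s.phiStar n).eval x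

/-- The defining relation of the polynomial `Θ_n`. -/
def IsTheta (n : ℕ) (P : ℂ[X]) : Prop :=
  ∀ x : ℂ, ‖x‖ ≠ 1 →
    2 * (s.phi0 (n + 1) / s.kappa n) * x ^ n * P.eval x
      = s.W.eval x * (-((s.phi n).eval x * deriv (s.eps n) x)
          + s.eps n x * (s.phi n).derivative.eval x)
        + 2 * s.V.eval x * (s.phi n).eval x * s.eps n x

/-- The defining relation of the polynomial `Θ*_n`. -/
def IsThetaStar (n : ℕ) (P : ℂ[X]) : Prop :=
  ∀ x : ℂ, ‖x‖ ≠ 1 →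
    2 * (s.phiBar0 (n + 1) / s.kappa n) * x ^ (n + 1) * P.eval x
      = s.W.eval x * ((s.phiStar n).eval x * deriv (s.epsStar n) x
          - s.epsStar n x * (s.phiStar n).derivative.eval x)
        - 2 * s.V.eval x * (s.phiStar n).eval x * s.epsStar n x

/-- The defining relation of the polynomial `Ω_n`. -/
def IsOmega (n : ℕ) (P : ℂ[X]) : Prop :=
  ∀ x : ℂ, ‖x‖ ≠ 1 →
    2 * (s.phi0 (n + 1) / s.kappa n) * x ^ n * P.eval x
      = s.W.eval x * (s.eps (n + 1) x * (s.phi n).derivative.eval x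
          - (s.phi (n + 1)).eval x * deriv (s.eps n) x)
        + s.V.eval x * ((s.phi n).eval x * s.eps (n + 1) x
          + s.eps n x * (s.phi (n + 1)).eval x)

/-- The defining relation of the polynomial `Ω*_n`. -/
def IsOmegaStar (n : ℕ) (P : ℂ[X]) : Prop :=
  ∀ x : ℂ, ‖x‖ ≠ 1 →
    2 * (s.phiBar0 (n + 1) / s.kappa n) * x ^ (n + 1) * P.eval x
      = s.W.eval x * (-(s.epsStar (n + 1) x * (s.phiStar n).derivative.eval x)
          + (s.phiStar (n + 1)).eval x * deriv (s.epsStar n) x)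
        - s.V.eval x * ((s.phiStar n).eval x * s.epsStar (n + 1) x
          + s.epsStar n x * (s.phiStar (n + 1)).eval x)

/-- The coefficient polynomial `Θ_n` (uniquely determined by `IsTheta` if `φ_{n+1}(0) ≠ 0`). -/
def Theta (n : ℕ) : ℂ[X] := Classical.epsilon (s.IsTheta n)

/-- The coefficient polynomial `Θ*_n`. -/
def ThetaStar (n : ℕ) : ℂ[X] := Classical.epsilon (s.IsThetaStar n)

/-- The coefficient polynomial `Ω_n`. -/
def Omega (n : ℕ) : ℂ[X] := Classical.epsilon (s.IsOmega n)

/-- The coefficient polynomial `Ω*_n`. -/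
def OmegaStar (n : ℕ) : ℂ[X] := Classical.epsilon (s.IsOmegaStar n)

/-- The matrix `W(x) A_n(x)`, with polynomial entries. -/
def numerator (n : ℕ) (x : ℂ) : Matrix (Fin 2) (Fin 2) ℂ :=
  !![-((s.Omega n).eval x + s.V.eval x
        - s.kappa (n + 1) / s.kappa n * x * (s.Theta n).eval x),
      s.phi0 (n + 1) / s.kappa n * (s.Theta n).eval x;
    -(s.phiBar0 (n + 1) / s.kappa n * x * (s.ThetaStar n).eval x),
      (s.OmegaStar n).eval x - s.V.eval x
        - s.kappa (n + 1) / s.kappa n * (s.ThetaStar n).eval x]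

/-- The spectral matrix `A_n(x)`. -/
def A (n : ℕ) (x : ℂ) : Matrix (Fin 2) (Fin 2) ℂ := (s.W.eval x)⁻¹ • s.numerator n x

/-- The residue matrix `A_{nj}` at `z_j`. -/
def residue (n : ℕ) (j : Fin (m + 1)) : Matrix (Fin 2) (Fin 2) ℂ :=
  (ρ j / (2 * s.V.eval (s.z j))) • s.numerator n (s.z j)

/-- The residue matrix `A_{n∞}` at infinity. -/
def residueInf (n : ℕ) : Matrix (Fin 2) (Fin 2) ℂ := -∑ j, s.residue n j

/-- The matrix `Y_n = (φ_n, ε_n/w; φ*_n, -ε*_n/w)`. -/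
def Y (n : ℕ) (x : ℂ) : Matrix (Fin 2) (Fin 2) ℂ :=
  pairMatrix ((s.phi n).eval x) (s.eps n x) ((s.phiStar n).eval x) (s.epsStar n x) (s.w x)

/-- `Ω_n(z_j) - (κ_{n+1}/κ_n) z_j Θ_n(z_j)`, to be replaced by `V(0) - (n/2) W'(0)` at the
singular point `z_0 = 0`. -/
def omegaBracket (n : ℕ) (j : Fin (m + 1)) : ℂ :=
  if j = 0 then s.V.eval 0 - (n : ℂ) / 2 * s.W.derivative.eval 0
  else (s.Omega n).eval (s.z j)
    - s.kappa (n + 1) / s.kappa n * s.z j * (s.Theta n).eval (s.z j)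

/-- `Ω*_n(z_j) - (κ_{n+1}/κ_n) Θ*_n(z_j)`, to be replaced by `V(0) - (n/2) W'(0)` at the
singular point `z_0 = 0`. -/
def omegaStarBracket (n : ℕ) (j : Fin (m + 1)) : ℂ :=
  if j = 0 then s.V.eval 0 - (n : ℂ) / 2 * s.W.derivative.eval 0
  else (s.OmegaStar n).eval (s.z j)
    - s.kappa (n + 1) / s.kappa n * (s.ThetaStar n).eval (s.z j)

end System

section Deformation

variable {m : ℕ} {ρ : Fin (m + 1) → ℂ} (s : ℝ → System m ρ)

/-- `ż_j`. -/
def dotz (j : Fin (m + 1)) (t : ℝ) : ℂ := deriv (fun τ => (s τ).z j) t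

/-- `κ̇_n`. -/
def dotkappa (n : ℕ) (t : ℝ) : ℂ := deriv (fun τ => (s τ).kappa n) t

/-- The time derivative of `φ̄_n(0)`. -/
def dotphiBar0 (n : ℕ) (t : ℝ) : ℂ := deriv (fun τ => (s τ).phiBar0 n) t

/-- A deformation, for `t` in the open set `S`, of a regular semi-classical weight with `m + 1`
finite singular points, one of them fixed at the origin. `D` is the open set of pairs `(t, x)` at
which the weight is considered (the cut plane, for each `t`); it contains the
unit circle apart from the singular points on it. A singular point is either
off the unit circle, or moves on it and has an exponent of positive real part. -/
structure IsDeformation (S : Set ℝ) (D : Set (ℝ × ℂ)) : Prop where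
  isOpen_times : IsOpen S
  isOpen_domain : IsOpen D
  one_le : 1 ≤ m
  exponents : ∀ j, ∀ k : ℕ, ρ j ≠ (k : ℂ)
  smooth : ∀ j, ContDiffOn ℝ 1 (fun t => (s t).z j) S
  origin : ∀ t ∈ S, (s t).z 0 = 0
  distinct : ∀ t ∈ S, Function.Injective (s t).z
  circle : ∀ j, (∀ t ∈ S, ‖(s t).z j‖ ≠ 1) ∨ ((∀ t ∈ S, ‖(s t).z j‖ = 1) ∧ 0 < (ρ j).re)
  domain_sub : ∀ t x, (t, x) ∈ D → t ∈ S ∧ ∀ j, x ≠ (s t).z j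
  circle_sub : ∀ t ∈ S, ∀ ζ : ℂ, ‖ζ‖ = 1 → (∀ j, ζ ≠ (s t).z j) → (t, ζ) ∈ D
  continuous_weight : ContinuousOn (fun p : ℝ × ℂ => (s p.1).w p.2) D
  differentiable_weight : ∀ t x, (t, x) ∈ D → DifferentiableAt ℂ (s t).w x
  log_derivative : ∀ t x, (t, x) ∈ D →
    (s t).W.eval x * deriv (s t).w x = 2 * (s t).V.eval x * (s t).w x
  time_derivative : ∀ t x, (t, x) ∈ D →
    HasDerivAt (fun τ => (s τ).w x)
      (-(∑ j, ρ j * dotz s j t / (x - (s t).z j)) * (s t).w x) t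

/-- The matrix `B_∞`. -/
def Binf (n : ℕ) (t : ℝ) : Matrix (Fin 2) (Fin 2) ℂ :=
  !![dotkappa s n t / (s t).kappa n, 0;
    ((s t).kappa n * dotphiBar0 s n t + dotkappa s n t * (s t).phiBar0 n) / (s t).kappa n ^ 2,
      -(dotkappa s n t / (s t).kappa n)]

/-- The matrix `B_n(x) = B_∞ - ∑_j ż_j A_{nj} / (x - z_j)`. -/
def B (n : ℕ) (t : ℝ) (x : ℂ) : Matrix (Fin 2) (Fin 2) ℂ :=
  Binf s n t - ∑ j, (dotz s j t / (x - (s t).z j)) • (s t).residue n j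

/-- The linear system of deformation derivatives at `(t, x)`, for functions `f`, `f*`, `e`, `e*`
of time (in the places of `φ_n`, `φ*_n`, `ε_n`, `ε*_n`). The sums run over the singular points
other than `z_0 = 0`, for which `ż_0 = 0`. -/
def DeformationSystem (n : ℕ) (t : ℝ) (x : ℂ) (f fs e es : ℝ → ℂ) : Prop :=
  let z : Fin m → ℂ := fun j => (s t).z j.succ
  let b : Fin m → ℂ := fun j => ρ j.succ * (dotz s j.succ t / z j)
  let k : ℂ := dotkappa s n t / (s t).kappa n
  let p : Fin m → ℂ := fun j => ((s t).phi n).eval (z j)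
  let ps : Fin m → ℂ := fun j => ((s t).phiStar n).eval (z j)
  let ep : Fin m → ℂ := fun j => (s t).eps n (z j)
  let eps : Fin m → ℂ := fun j => (s t).epsStar n (z j)
  HasDerivAt f
    ((-k - ∑ j, b j
        + 1 / 2 * ∑ j, b j * z j ^ (-(n : ℤ)) * ep j * ps j * (x / (x - z j))) * f t
      - (1 / 2 * ∑ j, b j * z j ^ (1 - (n : ℤ)) * ep j * p j * (1 / (x - z j))) * fs t) t ∧
  HasDerivAt fs
    ((-k + 1 / 2 * ∑ j, b j * z j ^ (1 - (n : ℤ)) * eps j * p j * (1 / (x - z j))) * fs t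
      - (1 / 2 * ∑ j, b j * z j ^ (-(n : ℤ)) * eps j * ps j * (x / (x - z j))) * f t) t ∧
  HasDerivAt e
    ((-k - 1 / 2 * ∑ j, b j * z j ^ (-(n : ℤ)) * eps j * p j * (x / (x - z j))) * e t
      + (1 / 2 * ∑ j, b j * z j ^ (1 - (n : ℤ)) * ep j * p j * (1 / (x - z j))) * es t) t ∧
  HasDerivAt es
    ((-k - 1 / 2 * ∑ j, b j * z j ^ (1 - (n : ℤ)) * ep j * ps j * (1 / (x - z j))) * es t
      + (1 / 2 * ∑ j, b j * z j ^ (-(n : ℤ)) * eps j * ps j * (x / (x - z j))) * e t) t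

/-- The matrix equation `Ẏ = B_n Y` at `(t, x)`, for `Y = (f, e/w; f*, -e*/w)`. -/
def MatrixDeformationEquation (n : ℕ) (t : ℝ) (x : ℂ) (f fs e es : ℝ → ℂ) : Prop :=
  HasEntryDerivAt (fun τ => pairMatrix (f τ) (e τ) (fs τ) (es τ) ((s τ).w x))
    (B s n t x * pairMatrix (f t) (e t) (fs t) (es t) ((s t).w x)) t

end Deformation

end BOPUC

end

noncomputable section

open Polynomial Filter Set MeasureTheory
open scoped Topology Interval

namespace BOPUC

theorem norm_le_exp_mul_norm {K c : ℝ → ℂ} {I : Set ℝ} (hI : I.OrdConnected) {M : ℝ}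
    (hK : ∀ x ∈ I, HasDerivAt K (c x * K x) x) (hc : ∀ x ∈ I, ‖c x‖ ≤ M) {x y : ℝ}
    (hx : x ∈ I) (hy : y ∈ I) : ‖K x‖ ≤ ‖K y‖ * Real.exp (M * |x - y|) := by
  rcases le_total y x with h | h
  · have hsub : Icc y x ⊆ I := hI.out hy hx
    have := norm_le_gronwallBound_of_norm_deriv_right_le (f := K) (f' := fun u => c u * K u)
      (δ := ‖K y‖) (K := M) (ε := 0) (a := y) (b := x)
      (fun u hu => (hK u (hsub hu)).continuousAt.continuousWithinAt)
      (fun u hu => (hK u (hsub (Ico_subset_Icc_self hu))).hasDerivWithinAt) le_rfl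
      (fun u hu => by
        rw [norm_mul, add_zero]
        exact mul_le_mul_of_nonneg_right (hc u (hsub (Ico_subset_Icc_self hu))) (norm_nonneg _))
      x (right_mem_Icc.2 h)
    rwa [gronwallBound_ε0, ← abs_of_nonneg (sub_nonneg.2 h)] at this
  · have hsub : Icc x y ⊆ I := hI.out hx hy
    have key : ∀ u ∈ Icc (-y) (-x), HasDerivAt (fun u => K (-u)) (-(c (-u) * K (-u))) u := by
      intro u hu
      have := (hK (-u) (hsub ⟨by linarith [hu.2], by linarith [hu.1]⟩)).scomp u (hasDerivAt_neg u)
      exact this.congr_deriv (by simp)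
    have := norm_le_gronwallBound_of_norm_deriv_right_le (f := fun u => K (-u))
      (f' := fun u => -(c (-u) * K (-u)))
      (δ := ‖K y‖) (K := M) (ε := 0) (a := -y) (b := -x)
      (fun u hu => (key u hu).continuousAt.continuousWithinAt)
      (fun u hu => (key u (Ico_subset_Icc_self hu)).hasDerivWithinAt) (by simp)
      (fun u hu => by
        rw [norm_neg, norm_mul, add_zero]
        exact mul_le_mul_of_nonneg_right
          (hc _ (hsub ⟨by linarith [hu.2], by linarith [hu.1]⟩)) (norm_nonneg _))
      (-x) (right_mem_Icc.2 (by linarith))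
    rw [gronwallBound_ε0, neg_neg] at this
    rwa [abs_of_nonpos (sub_nonpos.2 h), show -(x - y) = -x - -y by ring]

theorem hasDerivAt_log_norm {f : ℝ → ℂ} {f' : ℂ} {x : ℝ} (hf : HasDerivAt f f' x)
    (h : f x ≠ 0) : HasDerivAt (fun u => Real.log ‖f u‖) (f' / f x).re x := by
  have h1 := (hf.norm_sq.log (by simpa using h)).div_const 2
  have h2 : (fun u => Real.log ‖f u‖) = fun u => Real.log (‖f u‖ ^ 2) / 2 := by
    ext u; rw [Real.log_pow]; push_cast; ring
  rw [h2]
  refine h1.congr_deriv ?_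
  have h3 : ‖f x‖ ^ 2 ≠ 0 := by simpa using h
  rw [Complex.inner, Complex.div_re, Complex.normSq_eq_norm_sq]
  field_simp
  simp [Complex.mul_re]

theorem re_div_one_sub {u : ℂ} (hu : ‖u‖ = 1) (h : u ≠ 1) : (1 / (1 - u)).re = 1 / 2 := by
  have h1 : u.re * u.re + u.im * u.im = 1 := by
    rw [← Complex.normSq_apply, Complex.normSq_eq_norm_sq, hu]; norm_num
  have h2 : Complex.normSq (1 - u) ≠ 0 := by
    rw [Ne, Complex.normSq_eq_zero, sub_eq_zero]; exact fun e => h e.symm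
  rw [Complex.div_re]
  simp only [Complex.one_re, Complex.one_im, one_mul, zero_mul, zero_div, add_zero, Complex.sub_re]
  rw [div_eq_div_iff h2 two_ne_zero]
  simp [Complex.normSq_apply]
  nlinarith

/-- For `ζ`, `z` on the unit circle, `ζ / (ζ - z)` has real part `1 / 2`. -/
theorem re_div_sub_of_norm_eq_one {ζ z : ℂ} (hζ : ‖ζ‖ = 1) (hz : ‖z‖ = 1) (h : ζ ≠ z) :
    (ζ / (ζ - z)).re = 1 / 2 := by
  have hζ0 : ζ ≠ 0 := by rintro rfl; simp at hζ
  have : ζ / (ζ - z) = 1 / (1 - z / ζ) := by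
    have : ζ - z ≠ 0 := sub_ne_zero.2 h
    field_simp
  rw [this, re_div_one_sub (by simp [hζ, hz])]
  intro e; rw [div_eq_one_iff_eq hζ0] at e; exact h e.symm

namespace System

variable {m : ℕ} {ρ : Fin (m + 1) → ℂ} {s : System m ρ}

/-- The conditions on the singular points and on the weight at one value of the deformation
parameter, as far as they concern the unit circle. -/
structure IsRegular (s : System m ρ) : Prop where
  injective : Function.Injective s.z
  origin : s.z 0 = 0
  exponent_ne_zero : ∀ j, ρ j ≠ 0
  re_pos : ∀ j, ‖s.z j‖ = 1 → 0 < (ρ j).re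
  hasDerivAt_weight : ∀ ζ, ‖ζ‖ = 1 → (∀ j, ζ ≠ s.z j) →
    HasDerivAt s.w ((∑ j, ρ j / (ζ - s.z j)) * s.w ζ) ζ

variable (s) in
/-- The indices of the singular points on the unit circle. -/
def onCircle : Finset (Fin (m + 1)) := Finset.univ.filter fun j => ‖s.z j‖ = 1

theorem mem_onCircle {j : Fin (m + 1)} : j ∈ s.onCircle ↔ ‖s.z j‖ = 1 := by simp [onCircle]

theorem eventually_circleMap_ne (s : System m ρ) (θ : ℝ) :
    ∀ᶠ u in 𝓝[≠] θ, ∀ j, circleMap 0 1 u ≠ s.z j := by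
  rw [Filter.eventually_all]
  intro j
  exact (hasDerivAt_circleMap 0 1 θ).eventually_ne (by simp)

theorem countable_singular (s : System m ρ) :
    {θ : ℝ | ∃ j, circleMap 0 1 θ = s.z j}.Countable := by
  have h := (Set.finite_range s.z).countable.preimage_circleMap 0 (R := 1) one_ne_zero
  refine h.mono ?_
  rintro θ ⟨j, hj⟩
  exact ⟨j, hj.symm⟩

/-- The weight divided by the modulus-type factors of the singular points on the circle has a
bounded logarithmic derivative. -/
theorem IsRegular.exists_logDeriv (hs : s.IsRegular) :
    ∃ (M : ℝ) (c : ℝ → ℂ), (∀ θ, (∀ j, circleMap 0 1 θ ≠ s.z j) → ‖c θ‖ ≤ M) ∧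
      ∀ θ, (∀ j, circleMap 0 1 θ ≠ s.z j) →
        HasDerivAt (fun θ => s.w (circleMap 0 1 θ) *
          Complex.exp (-∑ j ∈ s.onCircle, ρ j * (Real.log ‖circleMap 0 1 θ - s.z j‖ : ℝ)))
          (c θ * (s.w (circleMap 0 1 θ) *
          Complex.exp (-∑ j ∈ s.onCircle, ρ j * (Real.log ‖circleMap 0 1 θ - s.z j‖ : ℝ)))) θ := by
  have hoff : ∀ j, ∃ M : ℝ, j ∉ s.onCircle → ∀ θ : ℝ,
      ‖ρ j * (Complex.I * circleMap 0 1 θ / (circleMap 0 1 θ - s.z j))‖ ≤ M := by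
    intro j
    by_cases hj : j ∈ s.onCircle
    · exact ⟨0, fun h => absurd hj h⟩
    · have hc : ContinuousOn (fun ζ : ℂ => ρ j * (Complex.I * ζ / (ζ - s.z j)))
          (Metric.sphere 0 1) := by
        refine ContinuousOn.mul continuousOn_const (ContinuousOn.div (by fun_prop) (by fun_prop) ?_)
        intro ζ hζ h
        rw [sub_eq_zero] at h
        apply hj; rw [mem_onCircle, ← h]; simpa using hζ
      obtain ⟨M, hM⟩ := (isCompact_sphere (0 : ℂ) 1).exists_bound_of_continuousOn hc
      exact ⟨M, fun _ θ => hM _ (by simp)⟩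
  choose Mj hMj using hoff
  refine ⟨∑ j, max (‖ρ j‖) (Mj j), fun θ => ∑ j, (ρ j * (Complex.I * circleMap 0 1 θ /
    (circleMap 0 1 θ - s.z j)) - if j ∈ s.onCircle then
      ρ j * ((Complex.I * circleMap 0 1 θ / (circleMap 0 1 θ - s.z j)).re : ℝ) else 0), ?_, ?_⟩
  · intro θ hθ
    refine (norm_sum_le _ _).trans (Finset.sum_le_sum fun j _ => ?_)
    split_ifs with hj
    · refine le_trans ?_ (le_max_left _ _)
      rw [← mul_sub, norm_mul]
      refine mul_le_of_le_one_right (norm_nonneg _) ?_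
      set u := circleMap 0 1 θ / (circleMap 0 1 θ - s.z j) with hu
      have h1 : u.re = 1 / 2 :=
        re_div_sub_of_norm_eq_one (by simp) (mem_onCircle.1 hj) (hθ j)
      have h2 : Complex.I * circleMap 0 1 θ / (circleMap 0 1 θ - s.z j)
        - ((Complex.I * circleMap 0 1 θ / (circleMap 0 1 θ - s.z j)).re : ℝ)
          = Complex.I * (1 / 2) := by
        rw [mul_div_assoc, ← hu]
        apply Complex.ext <;> simp [h1]
      rw [h2]; norm_num
    · rw [sub_zero]
      exact (hMj j hj θ).trans (le_max_right _ _)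
  · intro θ hθ
    have h1 : HasDerivAt (fun θ => s.w (circleMap 0 1 θ))
        ((circleMap 0 1 θ * Complex.I) * ((∑ j, ρ j / (circleMap 0 1 θ - s.z j))
          * s.w (circleMap 0 1 θ))) θ := by
      have := (hs.hasDerivAt_weight (circleMap 0 1 θ) (by simp) hθ).scomp θ
        (hasDerivAt_circleMap 0 1 θ)
      simpa [smul_eq_mul, Function.comp_def] using this
    have h2 : HasDerivAt (fun θ => -∑ j ∈ s.onCircle, ρ j *
        (Real.log ‖circleMap 0 1 θ - s.z j‖ : ℝ))
        (-∑ j ∈ s.onCircle, ρ j *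
          ((Complex.I * circleMap 0 1 θ / (circleMap 0 1 θ - s.z j)).re : ℝ)) θ := by
      refine HasDerivAt.neg (HasDerivAt.fun_sum fun j _ => HasDerivAt.const_mul _ ?_)
      refine HasDerivAt.ofReal_comp ?_
      have := hasDerivAt_log_norm ((hasDerivAt_circleMap 0 1 θ).sub_const (s.z j))
        (sub_ne_zero.2 (hθ j))
      rwa [mul_comm (circleMap 0 1 θ)] at this
    refine (h1.mul h2.cexp).congr_deriv ?_
    beta_reduce
    rw [Finset.sum_sub_distrib, ← Finset.sum_filter, Finset.filter_mem_eq_inter,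
      Finset.univ_inter]
    have h3 : ∑ j, ρ j * (Complex.I * circleMap 0 1 θ / (circleMap 0 1 θ - s.z j))
        = circleMap 0 1 θ * Complex.I * ∑ j, ρ j / (circleMap 0 1 θ - s.z j) := by
      rw [Finset.mul_sum]
      exact Finset.sum_congr rfl fun j _ => by ring
    rw [h3]; ring

theorem IsRegular.exists_norm_weight_le (hs : s.IsRegular) :
    ∃ C, 0 ≤ C ∧ ∀ ζ, ‖ζ‖ = 1 → (∀ j, ζ ≠ s.z j) →
      ‖s.w ζ‖ ≤ C * ∏ j ∈ s.onCircle, ‖ζ - s.z j‖ ^ (ρ j).re := by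
  obtain ⟨M, c, hc, hK⟩ := hs.exists_logDeriv
  set K : ℝ → ℂ := fun θ => s.w (circleMap 0 1 θ) *
    Complex.exp (-∑ j ∈ s.onCircle, ρ j * (Real.log ‖circleMap 0 1 θ - s.z j‖ : ℝ)) with hKdef
  have hloc : ∀ θ : ℝ, ∃ B, ∀ᶠ u in 𝓝 θ, (∀ j, circleMap 0 1 u ≠ s.z j) → ‖K u‖ ≤ B := by
    intro θ
    have h := s.eventually_circleMap_ne θ
    rw [eventually_nhdsWithin_iff, Metric.eventually_nhds_iff] at h
    obtain ⟨δ, hδ, h⟩ := h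
    have hns : ∀ u, |u - θ| < δ → u ≠ θ → ∀ j, circleMap 0 1 u ≠ s.z j := fun u hu hne =>
      h (by rwa [Real.dist_eq]) hne
    have hR : ∀ u ∈ Ioo θ (θ + δ), ∀ j, circleMap 0 1 u ≠ s.z j := fun u hu =>
      hns u (by rw [abs_lt]; constructor <;> linarith [hu.1, hu.2]) (ne_of_gt hu.1)
    have hL : ∀ u ∈ Ioo (θ - δ) θ, ∀ j, circleMap 0 1 u ≠ s.z j := fun u hu =>
      hns u (by rw [abs_lt]; constructor <;> linarith [hu.1, hu.2]) (ne_of_lt hu.2)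
    have hMn : 0 ≤ M := (norm_nonneg _).trans
      (hc (θ + δ / 2) (hR _ ⟨by linarith, by linarith⟩))
    refine ⟨max (‖K (θ + δ / 2)‖ * Real.exp (M * δ))
      (max (‖K (θ - δ / 2)‖ * Real.exp (M * δ)) ‖K θ‖), ?_⟩
    rw [Metric.eventually_nhds_iff]
    refine ⟨δ, hδ, fun u hu _ => ?_⟩
    rw [Real.dist_eq, abs_lt] at hu
    rcases lt_trichotomy u θ with hlt | rfl | hgt
    · refine le_max_of_le_right (le_max_of_le_left ?_)
      refine (norm_le_exp_mul_norm (I := Ioo (θ - δ) θ) ordConnected_Ioo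
        (fun x hx => hK x (hL x hx)) (fun x hx => hc x (hL x hx)) ⟨by linarith, hlt⟩
        (y := θ - δ / 2) ⟨by linarith, by linarith⟩).trans ?_
      gcongr
      rw [abs_le]; constructor <;> linarith
    · exact le_max_of_le_right (le_max_right _ _)
    · refine le_max_of_le_left ?_
      refine (norm_le_exp_mul_norm (I := Ioo θ (θ + δ)) ordConnected_Ioo
        (fun x hx => hK x (hR x hx)) (fun x hx => hc x (hR x hx)) ⟨hgt, by linarith⟩
        (y := θ + δ / 2) ⟨by linarith, by linarith⟩).trans ?_
      gcongr
      rw [abs_le]; constructor <;> linarith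
  have hglob : ∃ B, ∀ u ∈ Icc (0 : ℝ) (2 * Real.pi),
      (∀ j, circleMap 0 1 u ≠ s.z j) → ‖K u‖ ≤ B := by
    refine (isCompact_Icc (a := (0 : ℝ)) (b := 2 * Real.pi)).induction_on
      (p := fun t => ∃ B, ∀ u ∈ t, (∀ j, circleMap 0 1 u ≠ s.z j) → ‖K u‖ ≤ B) ?_ ?_ ?_ ?_
    · exact ⟨0, by simp⟩
    · rintro a b hab ⟨B, hB⟩; exact ⟨B, fun u hu => hB u (hab hu)⟩
    · rintro a b ⟨A, hA⟩ ⟨B, hB⟩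
      refine ⟨max A B, ?_⟩
      rintro u (hu | hu) hn
      · exact (hA u hu hn).trans (le_max_left _ _)
      · exact (hB u hu hn).trans (le_max_right _ _)
    · intro θ _
      obtain ⟨B, hB⟩ := hloc θ
      exact ⟨_, mem_nhdsWithin_of_mem_nhds hB, B, fun u hu => hu⟩
  obtain ⟨B, hB⟩ := hglob
  refine ⟨max B 0, le_max_right _ _, fun ζ hζ hn => ?_⟩
  have hmem : ζ ∈ circleMap 0 1 '' Ioc 0 (2 * Real.pi) := by
    rw [image_circleMap_Ioc]; simpa using hζ
  obtain ⟨u, hu, rfl⟩ := hmem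
  have h1 := hB u (Ioc_subset_Icc_self hu) hn
  have h2 : s.w (circleMap 0 1 u) = K u *
      Complex.exp (∑ j ∈ s.onCircle, ρ j * (Real.log ‖circleMap 0 1 u - s.z j‖ : ℝ)) := by
    rw [hKdef]; simp only
    rw [mul_assoc, ← Complex.exp_add, neg_add_cancel, Complex.exp_zero, mul_one]
  have h3 : ‖Complex.exp (∑ j ∈ s.onCircle, ρ j * (Real.log ‖circleMap 0 1 u - s.z j‖ : ℝ))‖
      = ∏ j ∈ s.onCircle, ‖circleMap 0 1 u - s.z j‖ ^ (ρ j).re := by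
    rw [Complex.norm_exp, Complex.re_sum, Real.exp_sum]
    refine Finset.prod_congr rfl fun j _ => ?_
    rw [Complex.re_mul_ofReal, Real.rpow_def_of_pos (norm_pos_iff.2 (sub_ne_zero.2 (hn j))),
      mul_comm]
  rw [h2, norm_mul, h3]
  exact mul_le_mul_of_nonneg_right (h1.trans (le_max_left _ _))
    (Finset.prod_nonneg fun j _ => Real.rpow_nonneg (norm_nonneg _) _)

end System

end BOPUC

end

noncomputable section

open Polynomial Filter Set MeasureTheory
open scoped Topology Interval

namespace BOPUC

theorem intervalIntegrable_abs_rpow {r : ℝ} (hr : -1 < r) (a b : ℝ) :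
    IntervalIntegrable (fun x : ℝ => |x| ^ r) volume a b := by
  have h := (intervalIntegral.intervalIntegrable_cpow' (a := a) (b := b) (r := (r : ℂ))
    (by simpa using hr)).norm
  refine h.congr ?_
  intro x _
  simp [Complex.norm_cpow_real]

theorem le_norm_circleMap_sub {θ θ₀ : ℝ} (h : |θ - θ₀| ≤ Real.pi) :
    2 / Real.pi * |θ - θ₀| ≤ ‖circleMap 0 1 θ - circleMap 0 1 θ₀‖ := by
  have h1 : circleMap 0 1 θ - circleMap 0 1 θ₀
      = circleMap 0 1 θ₀ * (Complex.exp (Complex.I * ((θ - θ₀ : ℝ) : ℂ)) - 1) := by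
    simp only [circleMap, zero_add, Complex.ofReal_one, one_mul]
    rw [mul_sub, ← Complex.exp_add, mul_one]
    congr 2
    push_cast; ring
  rw [h1, norm_mul, Complex.norm_exp_I_mul_ofReal_sub_one]
  have h2 := Real.mul_abs_le_abs_sin (x := (θ - θ₀) / 2)
    (by rw [abs_div, abs_two]; linarith)
  rw [abs_div, abs_two] at h2
  simp only [norm_circleMap_zero, abs_one, one_mul, norm_mul, Real.norm_eq_abs, abs_two]
  linarith

theorem intervalIntegrable_norm_circleMap_sub_rpow {z : ℂ} (hz : ‖z‖ = 1) {r : ℝ}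
    (hr : -1 < r) :
    IntervalIntegrable (fun θ : ℝ => ‖circleMap 0 1 θ - z‖ ^ r) volume 0 (2 * Real.pi) := by
  rcases le_or_gt 0 r with h0 | h0
  · refine Continuous.intervalIntegrable ?_ _ _
    exact (((continuous_circleMap 0 1).sub continuous_const).norm).rpow_const fun _ => Or.inr h0
  obtain ⟨θ₀, -, rfl⟩ : z ∈ circleMap 0 1 '' Ioc 0 (2 * Real.pi) := by
    rw [image_circleMap_Ioc]; simpa using hz
  have hper : Function.Periodic (fun θ : ℝ => ‖circleMap 0 1 θ - circleMap 0 1 θ₀‖ ^ r)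
      (2 * Real.pi) := by
    intro θ
    simp only [(periodic_circleMap 0 1) θ]
  refine hper.intervalIntegrable (t := θ₀ - Real.pi) (by positivity) ?_ 0 (2 * Real.pi)
  have hI : IntervalIntegrable (fun θ : ℝ => (2 / Real.pi) ^ r * |θ - θ₀| ^ r) volume
      (θ₀ - Real.pi) (θ₀ - Real.pi + 2 * Real.pi) := by
    refine IntervalIntegrable.const_mul ?_ _
    have := (intervalIntegrable_abs_rpow hr (-Real.pi) Real.pi).comp_sub_right θ₀
    convert this using 1 <;> ring
  refine hI.mono_fun' ?_ ?_
  · refine (Measurable.aestronglyMeasurable ?_)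
    exact (((continuous_circleMap 0 1).sub continuous_const).norm.measurable).pow_const r
  · have hne : ∀ᵐ θ : ℝ ∂(volume.restrict (Ι (θ₀ - Real.pi) (θ₀ - Real.pi + 2 * Real.pi))),
        θ ≠ θ₀ := by
      refine ae_restrict_of_ae ?_
      simp [ae_iff]
    filter_upwards [hne, ae_restrict_mem measurableSet_uIoc] with θ hθ hm
    rw [uIoc_of_le (by linarith [Real.pi_pos])] at hm
    have habs : |θ - θ₀| ≤ Real.pi := by rw [abs_le]; constructor <;> linarith [hm.1, hm.2]
    have hpos : 0 < |θ - θ₀| := abs_pos.2 (sub_ne_zero.2 hθ)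
    rw [Real.norm_of_nonneg (Real.rpow_nonneg (norm_nonneg _) _),
      ← Real.mul_rpow (by positivity) hpos.le]
    exact Real.rpow_le_rpow_of_nonpos (by positivity) (le_norm_circleMap_sub habs) h0.le

namespace System

variable {m : ℕ} {ρ : Fin (m + 1) → ℂ} {s : System m ρ}

open Classical in
variable (s) in
/-- The weight, set to zero at the singular points. -/
def wHat (ζ : ℂ) : ℂ := if ∃ j, ζ = s.z j then 0 else s.w ζ

theorem wHat_of_ne {ζ : ℂ} (h : ∀ j, ζ ≠ s.z j) : s.wHat ζ = s.w ζ := by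
  rw [wHat, if_neg]; simpa using h

theorem wHat_z (j : Fin (m + 1)) : s.wHat (s.z j) = 0 := by
  rw [wHat, if_pos ⟨j, rfl⟩]

variable (s) in
theorem ae_circleMap_ne : ∀ᵐ θ : ℝ, ∀ j, circleMap 0 1 θ ≠ s.z j := by
  have := s.countable_singular.ae_notMem (volume : Measure ℝ)
  filter_upwards [this] with θ h
  simpa using h

theorem IsRegular.exists_norm_wHat_le (hs : s.IsRegular) {j : Fin (m + 1)} (hj : j ∈ s.onCircle) :
    ∃ C, 0 ≤ C ∧ ∀ ζ, ‖ζ‖ = 1 → ‖s.wHat ζ‖ ≤ C * ‖ζ - s.z j‖ ^ (ρ j).re := by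
  obtain ⟨C, hC0, hC⟩ := hs.exists_norm_weight_le
  refine ⟨C * ∏ k ∈ s.onCircle.erase j, 2 ^ (ρ k).re, mul_nonneg hC0
    (Finset.prod_nonneg fun k _ => by positivity), fun ζ hζ => ?_⟩
  by_cases hn : ∀ j, ζ ≠ s.z j
  · rw [wHat_of_ne hn]
    refine (hC ζ hζ hn).trans ?_
    rw [← Finset.mul_prod_erase _ _ hj, mul_comm (‖ζ - s.z j‖ ^ (ρ j).re), ← mul_assoc]
    gcongr with k hk
    · have hk' := mem_onCircle.1 (Finset.mem_of_mem_erase hk)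
      exact (hs.re_pos k hk').le
    · have hk' := mem_onCircle.1 (Finset.mem_of_mem_erase hk)
      refine (norm_sub_le _ _).trans ?_
      rw [hζ, hk']; norm_num
  · push Not at hn
    obtain ⟨k, rfl⟩ := hn
    rw [wHat_z, norm_zero]
    exact mul_nonneg (mul_nonneg hC0 (Finset.prod_nonneg fun k _ => by positivity))
      (Real.rpow_nonneg (norm_nonneg _) _)

theorem IsRegular.continuous_wHat (hs : s.IsRegular) :
    Continuous fun θ : ℝ => s.wHat (circleMap 0 1 θ) := by
  rw [continuous_iff_continuousAt]
  intro θ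
  by_cases hn : ∀ j, circleMap 0 1 θ ≠ s.z j
  · have h1 : ContinuousAt (fun θ : ℝ => s.w (circleMap 0 1 θ)) θ :=
      ContinuousAt.comp (g := s.w) (hs.hasDerivAt_weight _ (by simp) hn).continuousAt
        (continuous_circleMap 0 1).continuousAt
    refine h1.congr ?_
    have : ∀ᶠ u in 𝓝 θ, ∀ j, circleMap 0 1 u ≠ s.z j := by
      rw [Filter.eventually_all]
      exact fun j => (continuous_circleMap 0 1).continuousAt.eventually_ne (hn j)
    filter_upwards [this] with u hu
    rw [wHat_of_ne hu]
  · push Not at hn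
    obtain ⟨j, hj⟩ := hn
    have hmem : j ∈ s.onCircle := by rw [mem_onCircle, ← hj]; simp
    obtain ⟨C, -, hC⟩ := hs.exists_norm_wHat_le hmem
    have ha := hs.re_pos j (mem_onCircle.1 hmem)
    rw [ContinuousAt, hj, wHat_z]
    refine squeeze_zero_norm (fun u => hC _ (by simp)) ?_
    have hcont : Continuous fun u : ℝ => C * ‖circleMap 0 1 u - s.z j‖ ^ (ρ j).re :=
      continuous_const.mul ((((continuous_circleMap 0 1).sub continuous_const).norm).rpow_const
        fun _ => Or.inr ha.le)
    have := hcont.tendsto θ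
    rwa [hj, sub_self, norm_zero, Real.zero_rpow ha.ne', mul_zero] at this

theorem IsRegular.intervalIntegrable_wHat_div (hs : s.IsRegular) (j : Fin (m + 1)) :
    IntervalIntegrable (fun θ : ℝ => s.wHat (circleMap 0 1 θ) / (circleMap 0 1 θ - s.z j))
      volume 0 (2 * Real.pi) := by
  have hmeas : AEStronglyMeasurable
      (fun θ : ℝ => s.wHat (circleMap 0 1 θ) / (circleMap 0 1 θ - s.z j))
      (volume.restrict (Ι 0 (2 * Real.pi))) :=
    ((hs.continuous_wHat.measurable).div
      ((measurable_circleMap 0 1).sub_const _)).aestronglyMeasurable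
  by_cases hj : j ∈ s.onCircle
  · obtain ⟨C, hC0, hC⟩ := hs.exists_norm_wHat_le hj
    have ha := hs.re_pos j (mem_onCircle.1 hj)
    refine ((intervalIntegrable_norm_circleMap_sub_rpow (mem_onCircle.1 hj)
      (r := (ρ j).re - 1) (by linarith)).const_mul C).mono_fun' hmeas ?_
    refine Filter.Eventually.of_forall fun θ => ?_
    by_cases h0 : circleMap 0 1 θ = s.z j
    · simp only [h0, wHat_z, zero_div, norm_zero]
      exact mul_nonneg hC0 (Real.rpow_nonneg (norm_nonneg _) _)
    · have hpos : 0 < ‖circleMap 0 1 θ - s.z j‖ := norm_pos_iff.2 (sub_ne_zero.2 h0)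
      simp only [norm_div]
      rw [Real.rpow_sub_one hpos.ne', ← mul_div_assoc]
      exact div_le_div_of_nonneg_right (hC _ (by simp)) hpos.le
  · refine Continuous.intervalIntegrable ?_ _ _
    refine hs.continuous_wHat.div ((continuous_circleMap 0 1).sub continuous_const) fun θ h => ?_
    rw [sub_eq_zero] at h
    exact hj (by rw [mem_onCircle, ← h]; simp)

variable (s) in
theorem circleIntegrable_wHat_iff (g : ℂ → ℂ) :
    CircleIntegrable (fun ζ => s.wHat ζ * g ζ) 0 1 ↔
      CircleIntegrable (fun ζ => s.w ζ * g ζ) 0 1 := by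
  rw [CircleIntegrable, CircleIntegrable]
  refine intervalIntegrable_congr_ae (ae_restrict_of_ae ?_)
  filter_upwards [s.ae_circleMap_ne] with θ h
  rw [wHat_of_ne h]

theorem IsRegular.circleIntegrable_weight (hs : s.IsRegular) : CircleIntegrable s.w 0 1 := by
  have := (s.circleIntegrable_wHat_iff fun _ => 1).1
    (by simpa [CircleIntegrable] using hs.continuous_wHat.intervalIntegrable _ _)
  simpa using this

theorem IsRegular.circleIntegrable_weight_div (hs : s.IsRegular) (j : Fin (m + 1)) :
    CircleIntegrable (fun ζ => s.w ζ / (ζ - s.z j)) 0 1 := by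
  have := (s.circleIntegrable_wHat_iff fun ζ => (ζ - s.z j)⁻¹).1
    (by simpa [CircleIntegrable, div_eq_mul_inv] using hs.intervalIntegrable_wHat_div j)
  simpa [div_eq_mul_inv] using this

theorem IsRegular.intervalIntegrable_deriv_weight_mul (hs : s.IsRegular) {k k' : ℝ → ℂ}
    (hk : Continuous k) (hk' : Continuous k') :
    IntervalIntegrable (fun θ => s.w (circleMap 0 1 θ) * k' θ +
      ∑ j, ρ j * (circleMap 0 1 θ * Complex.I * k θ) *
        (s.w (circleMap 0 1 θ) / (circleMap 0 1 θ - s.z j))) volume 0 (2 * Real.pi) := by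
  refine IntervalIntegrable.add ?_ ?_
  · exact IntervalIntegrable.mul_continuousOn hs.circleIntegrable_weight hk'.continuousOn
  · rw [← Finset.sum_fn]
    refine IntervalIntegrable.sum _ fun j _ => ?_
    exact IntervalIntegrable.continuousOn_mul (hs.circleIntegrable_weight_div j)
      (continuous_const.mul (((continuous_circleMap 0 1).mul continuous_const).mul
        hk)).continuousOn

theorem IsRegular.integral_deriv_weight_mul (hs : s.IsRegular) {k k' : ℝ → ℂ}
    (hk : ∀ θ, HasDerivAt k (k' θ) θ) (hk' : Continuous k') (hper : k (2 * Real.pi) = k 0) :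
    ∫ θ in (0 : ℝ)..2 * Real.pi, (s.w (circleMap 0 1 θ) * k' θ +
      ∑ j, ρ j * (circleMap 0 1 θ * Complex.I * k θ) *
        (s.w (circleMap 0 1 θ) / (circleMap 0 1 θ - s.z j))) = 0 := by
  have hkc : Continuous k := continuous_iff_continuousAt.2 fun θ => (hk θ).continuousAt
  have h := integral_eq_of_hasDerivAt_off_countable
    (fun θ => s.wHat (circleMap 0 1 θ) * k θ)
    (fun θ => s.w (circleMap 0 1 θ) * k' θ +
      ∑ j, ρ j * (circleMap 0 1 θ * Complex.I * k θ) *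
        (s.w (circleMap 0 1 θ) / (circleMap 0 1 θ - s.z j)))
    (a := 0) (b := 2 * Real.pi) s.countable_singular
    (hs.continuous_wHat.mul hkc).continuousOn ?_ ?_
  · rw [h, hper]
    have : circleMap 0 1 (2 * Real.pi) = circleMap 0 1 0 := by
      simpa using periodic_circleMap 0 1 0
    rw [this, sub_self]
  · rintro θ ⟨-, hθ⟩
    have hn : ∀ j, circleMap 0 1 θ ≠ s.z j := by simpa using hθ
    have h1 : HasDerivAt (fun θ => s.w (circleMap 0 1 θ))
        ((circleMap 0 1 θ * Complex.I) * ((∑ j, ρ j / (circleMap 0 1 θ - s.z j))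
          * s.w (circleMap 0 1 θ))) θ := by
      have := (hs.hasDerivAt_weight (circleMap 0 1 θ) (by simp) hn).scomp θ
        (hasDerivAt_circleMap 0 1 θ)
      simpa [smul_eq_mul, Function.comp_def] using this
    have h2 : (fun θ => s.wHat (circleMap 0 1 θ)) =ᶠ[𝓝 θ] fun θ => s.w (circleMap 0 1 θ) := by
      have : ∀ᶠ u in 𝓝 θ, ∀ j, circleMap 0 1 u ≠ s.z j := by
        rw [Filter.eventually_all]
        exact fun j => (continuous_circleMap 0 1).continuousAt.eventually_ne (hn j)
      filter_upwards [this] with u hu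
      rw [wHat_of_ne hu]
    refine ((h1.congr_of_eventuallyEq h2).mul (hk θ)).congr_deriv ?_
    rw [wHat_of_ne hn, add_comm, Finset.sum_mul, Finset.mul_sum, Finset.sum_mul]
    congr 1
    refine Finset.sum_congr rfl fun j _ => ?_
    ring
  · exact hs.intervalIntegrable_deriv_weight_mul hkc hk'

variable (s) in
/-- The linear functional `g ↦ ∮ w(ζ) g(ζ) dζ / (2πi)`. -/
def Lam (g : ℂ → ℂ) : ℂ := (2 * (Real.pi : ℂ) * Complex.I)⁻¹ * ∮ ζ in C(0, 1), s.w ζ * g ζ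

theorem IsRegular.circleIntegrable_mul (hs : s.IsRegular) {g : ℂ → ℂ}
    (hg : ContinuousOn g (Metric.sphere 0 1)) : CircleIntegrable (fun ζ => s.w ζ * g ζ) 0 1 :=
  hs.circleIntegrable_weight.mul_continuousOn (by simpa using hg)

theorem IsRegular.circleIntegrable_mul_div (hs : s.IsRegular) {g : ℂ → ℂ}
    (hg : ContinuousOn g (Metric.sphere 0 1)) (j : Fin (m + 1)) :
    CircleIntegrable (fun ζ => s.w ζ * (g ζ / (ζ - s.z j))) 0 1 := by
  have := (hs.circleIntegrable_weight_div j).mul_continuousOn (g := g) (by simpa using hg)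
  refine IntervalIntegrable.congr (fun θ _ => ?_) this
  simp only [Pi.mul_apply]; ring

/-- Integration by parts on the unit circle. -/
theorem IsRegular.Lam_deriv (hs : s.IsRegular) {g : ℂ → ℂ}
    (hg : AnalyticOnNhd ℂ g (Metric.sphere 0 1)) :
    s.Lam (deriv g) = -∑ j, ρ j * s.Lam (fun ζ => g ζ / (ζ - s.z j)) := by
  have hmem : ∀ θ, circleMap 0 1 θ ∈ Metric.sphere (0 : ℂ) 1 := fun θ => by simp
  have hcd : Continuous fun θ => deriv g (circleMap 0 1 θ) :=
    hg.deriv.continuousOn.comp_continuous (continuous_circleMap 0 1) hmem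
  have h := hs.integral_deriv_weight_mul (k := fun θ => g (circleMap 0 1 θ))
    (k' := fun θ => (circleMap 0 1 θ * Complex.I) * deriv g (circleMap 0 1 θ))
    (fun θ => by
      have := ((hg _ (hmem θ)).differentiableAt.hasDerivAt).scomp θ (hasDerivAt_circleMap 0 1 θ)
      simpa [smul_eq_mul, Function.comp_def] using this)
    (((continuous_circleMap 0 1).mul continuous_const).mul hcd)
    (by rw [show circleMap 0 1 (2 * Real.pi) = circleMap 0 1 0 by
      simpa using periodic_circleMap 0 1 0])
  rw [eq_neg_iff_add_eq_zero]
  simp only [Lam]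
  have e1 : ∀ f : ℂ → ℂ, (∮ ζ in C(0, 1), f ζ)
      = ∫ θ in (0 : ℝ)..2 * Real.pi, circleMap 0 1 θ * Complex.I * f (circleMap 0 1 θ) := by
    intro f; simp [circleIntegral]
  have e2 : ∀ j, ρ j * ((2 * (Real.pi : ℂ) * Complex.I)⁻¹ *
      ∮ ζ in C(0, 1), s.w ζ * (g ζ / (ζ - s.z j))) = (2 * (Real.pi : ℂ) * Complex.I)⁻¹ *
      ∮ ζ in C(0, 1), ρ j * (s.w ζ * (g ζ / (ζ - s.z j))) := by
    intro j; rw [circleIntegral.integral_const_mul]; ring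
  rw [Finset.sum_congr rfl fun j _ => e2 j, ← Finset.mul_sum, ← mul_add,
    ← circleIntegral.integral_fun_sum (fun j _ => ?_), ← circleIntegral.integral_add, e1]
  · rw [mul_eq_zero]; right
    refine Eq.trans ?_ h
    refine intervalIntegral.integral_congr fun θ _ => ?_
    rw [mul_add, Finset.mul_sum]
    congr 1
    · ring
    · exact Finset.sum_congr rfl fun j _ => by ring
  · exact hs.circleIntegrable_mul hg.deriv.continuousOn
  · refine CircleIntegrable.fun_sum _ fun j _ => ?_
    exact (hs.circleIntegrable_mul_div hg.continuousOn j).const_smul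
  · exact (hs.circleIntegrable_mul_div hg.continuousOn j).const_smul

end System

end BOPUC

end

noncomputable section

open Polynomial Filter Set MeasureTheory
open scoped Topology Interval

namespace BOPUC

namespace System

variable {m : ℕ} {ρ : Fin (m + 1) → ℂ} {s : System m ρ}

variable (s) in
theorem eval_W (x : ℂ) : s.W.eval x = ∏ j, (x - s.z j) := by
  simp [W, eval_prod]

variable (s) in
theorem eval_W_z (j : Fin (m + 1)) : s.W.eval (s.z j) = 0 := by
  rw [eval_W]; exact Finset.prod_eq_zero (Finset.mem_univ j) (sub_self _)

variable (s) in
theorem two_mul_eval_V (x : ℂ) :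
    2 * s.V.eval x = ∑ j, ρ j * ∏ k ∈ Finset.univ.erase j, (x - s.z k) := by
  simp [V, eval_finsetSum, eval_prod]

theorem two_mul_eval_V_eq {x : ℂ} (hx : ∀ j, x ≠ s.z j) :
    2 * s.V.eval x = s.W.eval x * ∑ j, ρ j / (x - s.z j) := by
  rw [two_mul_eval_V, eval_W, Finset.mul_sum]
  refine Finset.sum_congr rfl fun j _ => ?_
  rw [← Finset.mul_prod_erase _ _ (Finset.mem_univ j)]
  have : x - s.z j ≠ 0 := sub_ne_zero.2 (hx j)
  field_simp

theorem eval_W_ne_zero {x : ℂ} (hx : ∀ j, x ≠ s.z j) : s.W.eval x ≠ 0 := by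
  rw [eval_W]; exact Finset.prod_ne_zero_iff.2 fun j _ => sub_ne_zero.2 (hx j)

end System

section Deformation

variable {m : ℕ} {ρ : Fin (m + 1) → ℂ} {s : ℝ → System m ρ} {S : Set ℝ} {D : Set (ℝ × ℂ)}

namespace IsDeformation

theorem hasDerivAt_weight (hs : IsDeformation s S D) {t : ℝ} {x : ℂ} (h : (t, x) ∈ D) :
    HasDerivAt (s t).w ((∑ j, ρ j / (x - (s t).z j)) * (s t).w x) x := by
  have h1 := (hs.differentiable_weight t x h).hasDerivAt
  have hx := (hs.domain_sub t x h).2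
  have h2 := hs.log_derivative t x h
  rw [System.two_mul_eval_V_eq hx, mul_assoc] at h2
  rwa [mul_left_cancel₀ (System.eval_W_ne_zero hx) h2] at h1

theorem isRegular (hs : IsDeformation s S D) {t : ℝ} (ht : t ∈ S) : (s t).IsRegular where
  injective := hs.distinct t ht
  origin := hs.origin t ht
  exponent_ne_zero j := by simpa using hs.exponents j 0
  re_pos j hj := by
    rcases hs.circle j with h | h
    · exact absurd hj (h t ht)
    · exact h.2
  hasDerivAt_weight ζ h1 h2 := hs.hasDerivAt_weight (hs.circle_sub t ht ζ h1 h2)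

theorem hasDerivAt_z (hs : IsDeformation s S D) {t : ℝ} (ht : t ∈ S) (j : Fin (m + 1)) :
    HasDerivAt (fun τ => (s τ).z j) (dotz s j t) t :=
  (((hs.smooth j).differentiableOn one_ne_zero).differentiableAt
    (hs.isOpen_times.mem_nhds ht)).hasDerivAt

theorem continuousOn_dotz (hs : IsDeformation s S D) (j : Fin (m + 1)) :
    ContinuousOn (dotz s j) S :=
  (hs.smooth j).continuousOn_deriv_of_isOpen hs.isOpen_times le_rfl

theorem dotz_zero (hs : IsDeformation s S D) {t : ℝ} (ht : t ∈ S) : dotz s 0 t = 0 := by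
  have : (fun τ => (s τ).z 0) =ᶠ[𝓝 t] fun _ => 0 := by
    filter_upwards [hs.isOpen_times.mem_nhds ht] with τ hτ using hs.origin τ hτ
  rw [dotz, this.deriv_eq, deriv_const]

theorem hasDerivAt_weight_comp (hs : IsDeformation s S D) {t : ℝ} {γ : ℝ → ℂ} {γ' : ℂ}
    (hγ : HasDerivAt γ γ' t) (h : (t, γ t) ∈ D) :
    HasDerivAt (fun τ => (s τ).w (γ τ))
      ((∑ j, ρ j * ((γ' - dotz s j t) / (γ t - (s t).z j))) * (s t).w (γ t)) t := by
  have hDn : ∀ᶠ p in 𝓝 (t, γ t), p ∈ D := hs.isOpen_domain.mem_nhds h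
  have hz : ∀ j, ContinuousAt (fun p : ℝ × ℂ => (s p.1).z j) (t, γ t) := fun j =>
    ContinuousAt.comp (f := Prod.fst) (g := fun τ => (s τ).z j) (x := (t, γ t))
      (hs.hasDerivAt_z (hs.domain_sub _ _ h).1 j).continuousAt continuousAt_fst
  have hdz : ∀ j, ContinuousAt (fun p : ℝ × ℂ => dotz s j p.1) (t, γ t) := fun j =>
    ContinuousAt.comp (f := Prod.fst) (g := fun τ => dotz s j τ) (x := (t, γ t))
      ((hs.continuousOn_dotz j).continuousAt
        (hs.isOpen_times.mem_nhds (hs.domain_sub _ _ h).1)) continuousAt_fst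
  have hw : ContinuousAt (fun p : ℝ × ℂ => (s p.1).w p.2) (t, γ t) :=
    hs.continuous_weight.continuousAt hDn
  have hne : ∀ j, (t, γ t).2 - (s (t, γ t).1).z j ≠ 0 := fun j =>
    sub_ne_zero.2 ((hs.domain_sub _ _ h).2 j)
  have hstr := hasStrictFDerivAt_uncurry_coprod (𝕜 := ℝ) (u := (t, γ t))
    (f := fun τ x => (s τ).w x)
    (f₁ := fun τ x => ContinuousLinearMap.toSpanSingleton ℝ
      (-(∑ j, ρ j * dotz s j τ / (x - (s τ).z j)) * (s τ).w x))
    (f₂ := fun τ x => (ContinuousLinearMap.toSpanSingleton ℂ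
      ((∑ j, ρ j / (x - (s τ).z j)) * (s τ).w x)).restrictScalars ℝ) ?_ ?_ ?_ ?_
  · have hcomp := hstr.hasFDerivAt.comp_hasDerivAt (f := fun τ => (τ, γ τ)) t
      ((hasDerivAt_id t).prodMk hγ)
    refine (show HasDerivAt (fun τ => (s τ).w (γ τ)) _ t from hcomp).congr_deriv ?_
    simp only [ContinuousLinearMap.coprod_apply, Function.HasUncurry.uncurry, id,
      ContinuousLinearMap.toSpanSingleton_apply, ContinuousLinearMap.coe_restrictScalars',
      one_smul, smul_eq_mul]
    rw [← mul_assoc, ← add_mul, ← Finset.sum_neg_distrib, Finset.mul_sum,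
      ← Finset.sum_add_distrib]
    congr 1
    refine Finset.sum_congr rfl fun j _ => ?_
    ring
  · filter_upwards [hDn] with v hv
    exact (hs.time_derivative v.1 v.2 hv).hasFDerivAt
  · filter_upwards [hDn] with v hv
    exact (hs.hasDerivAt_weight (t := v.1) (x := v.2) hv).hasFDerivAt.restrictScalars ℝ
  · refine (ContinuousLinearMap.toSpanSingletonCLE (𝕜 := ℝ) (E := ℂ)).continuous.continuousAt.comp
      (f := fun p : ℝ × ℂ => -(∑ j, ρ j * dotz s j p.1 / (p.2 - (s p.1).z j)) * (s p.1).w p.2) ?_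
    refine ContinuousAt.mul (ContinuousAt.neg ?_) hw
    refine tendsto_finsetSum _ fun j _ => ?_
    exact ContinuousAt.div (continuousAt_const.mul (hdz j)) (continuousAt_snd.sub (hz j)) (hne j)
  · refine (ContinuousLinearMap.restrictScalarsL ℂ ℂ ℂ ℝ ℝ).continuous.continuousAt.comp
      (f := fun p : ℝ × ℂ => ContinuousLinearMap.toSpanSingleton ℂ
        ((∑ j, ρ j / (p.2 - (s p.1).z j)) * (s p.1).w p.2)) ?_
    refine (ContinuousLinearMap.toSpanSingletonCLE (𝕜 := ℂ) (E := ℂ)).continuous.continuousAt.comp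
      (f := fun p : ℝ × ℂ => (∑ j, ρ j / (p.2 - (s p.1).z j)) * (s p.1).w p.2) ?_
    refine ContinuousAt.mul ?_ hw
    refine tendsto_finsetSum _ fun j _ => ?_
    exact ContinuousAt.div continuousAt_const (continuousAt_snd.sub (hz j)) (hne j)

theorem norm_z_eq_one (hs : IsDeformation s S D) {t τ : ℝ} (ht : t ∈ S) (hτ : τ ∈ S)
    {j : Fin (m + 1)} (hj : j ∈ (s t).onCircle) : ‖(s τ).z j‖ = 1 := by
  rcases hs.circle j with h | h
  · exact absurd (System.mem_onCircle.1 hj) (h t ht)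
  · exact h.1 τ hτ

/-- The phases of the singular points on the unit circle, relative to their positions at
the time `t`. -/
theorem exists_phase (hs : IsDeformation s S D) {t : ℝ} (ht : t ∈ S) :
    ∃ c c' : Fin (m + 1) → ℝ → ℝ, ∀ j ∈ (s t).onCircle, c j t = 0 ∧
      (∀ᶠ τ in 𝓝 t, HasDerivAt (c j) (c' j τ) τ ∧
        (s τ).z j = (s t).z j * Complex.exp (c j τ * Complex.I) ∧
        dotz s j τ = Complex.I * c' j τ * (s τ).z j) := by
  refine ⟨fun j τ => (Complex.log ((s τ).z j / (s t).z j)).im,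
    fun j τ => ((dotz s j τ / (s t).z j) / ((s τ).z j / (s t).z j)).im, fun j hj => ?_⟩
  have h1 : ‖(s t).z j‖ = 1 := System.mem_onCircle.1 hj
  have h0 : (s t).z j ≠ 0 := by rw [← norm_ne_zero_iff, h1]; exact one_ne_zero
  refine ⟨by simp [h0], ?_⟩
  have hcont : ContinuousAt (fun τ => (s τ).z j / (s t).z j) t :=
    ((hs.hasDerivAt_z ht j).continuousAt).div_const _
  have hslit : ∀ᶠ τ in 𝓝 t, (s τ).z j / (s t).z j ∈ Complex.slitPlane := by
    refine hcont.eventually_mem (Complex.isOpen_slitPlane.mem_nhds ?_)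
    rw [div_self h0]; exact Complex.one_mem_slitPlane
  have hS : ∀ᶠ τ in 𝓝 t, τ ∈ S := hs.isOpen_times.mem_nhds ht
  have hexp : ∀ᶠ τ in 𝓝 t, (s τ).z j = (s t).z j *
      Complex.exp ((Complex.log ((s τ).z j / (s t).z j)).im * Complex.I) := by
    filter_upwards [hS] with τ hτ
    have h2 : ‖(s τ).z j‖ = 1 := hs.norm_z_eq_one ht hτ hj
    have h3 : (s τ).z j / (s t).z j ≠ 0 :=
      div_ne_zero (by rw [← norm_ne_zero_iff, h2]; exact one_ne_zero) h0
    have h4 : ((Complex.log ((s τ).z j / (s t).z j)).im : ℂ) * Complex.I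
        = Complex.log ((s τ).z j / (s t).z j) := by
      apply Complex.ext
      · simp [Complex.log_re, h1, h2]
      · simp
    rw [h4, Complex.exp_log h3]; field_simp
  have hder : ∀ᶠ τ in 𝓝 t, HasDerivAt (fun τ => (Complex.log ((s τ).z j / (s t).z j)).im)
      ((dotz s j τ / (s t).z j) / ((s τ).z j / (s t).z j)).im τ := by
    filter_upwards [hS, hslit] with τ hτ hsl
    exact Complex.imCLM.hasFDerivAt.comp_hasDerivAt τ
      (((hs.hasDerivAt_z hτ j).div_const ((s t).z j)).clog_real hsl)
  filter_upwards [hS, hder, hexp, hexp.eventually_nhds] with τ hτ hd he hen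
  refine ⟨hd, he, ?_⟩
  have h5 := (((hd.ofReal_comp).mul_const Complex.I).cexp).const_mul ((s t).z j)
  have h6 := (hs.hasDerivAt_z hτ j).unique (h5.congr_of_eventuallyEq hen)
  refine h6.trans ?_
  linear_combination (-(Complex.I *
    (((dotz s j τ / (s t).z j) / ((s τ).z j / (s t).z j)).im : ℝ))) * he

end IsDeformation

end Deformation

end BOPUC

end

noncomputable section

open Polynomial Filter Set MeasureTheory
open scoped Topology Interval

namespace BOPUC

theorem exists_norm_sub_le_mul_norm_sub {f : ℂ → ℝ} (hf : ContDiff ℝ 1 f) :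
    ∃ L, 0 ≤ L ∧ ∀ u v : ℂ, ‖u‖ ≤ 1 → ‖v‖ ≤ 1 → |f u - f v| ≤ L * ‖u - v‖ := by
  obtain ⟨L, hL⟩ := (isCompact_closedBall (0 : ℂ) 1).exists_bound_of_continuousOn
    (hf.continuous_fderiv one_ne_zero).continuousOn
  refine ⟨L, (norm_nonneg _).trans (hL 0 (by simp)), fun u v hu hv => ?_⟩
  exact (convex_closedBall (0 : ℂ) 1).norm_image_sub_le_of_norm_fderiv_le (𝕜 := ℝ)
    (fun x _ => (hf.differentiable one_ne_zero) x) hL (by simpa using hv) (by simpa using hu)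

namespace System

variable {m : ℕ} {ρ : Fin (m + 1) → ℂ} {s : System m ρ}

theorem IsRegular.exists_bump (hs : s.IsRegular) :
    ∃ (b b' : Fin (m + 1) → ℝ → ℝ) (L : ℝ), 0 ≤ L ∧ ∀ j, (∀ θ, HasDerivAt (b j) (b' j θ) θ) ∧
      Continuous (b' j) ∧
      (∀ θ θ', |b j θ - b j θ'| ≤ L * ‖circleMap 0 1 θ - circleMap 0 1 θ'‖) ∧
      (j ∈ s.onCircle → ∀ k ∈ s.onCircle, ∀ θ, circleMap 0 1 θ = s.z k →
        b j θ = if j = k then 1 else 0) := by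
  have key : ∀ j, ∃ (b b' : ℝ → ℝ) (L : ℝ), 0 ≤ L ∧ (∀ θ, HasDerivAt b (b' θ) θ) ∧
      Continuous b' ∧
      (∀ θ θ', |b θ - b θ'| ≤ L * ‖circleMap 0 1 θ - circleMap 0 1 θ'‖) ∧
      (j ∈ s.onCircle → ∀ k ∈ s.onCircle, ∀ θ, circleMap 0 1 θ = s.z k →
        b θ = if j = k then 1 else 0) := by
    intro j
    set f : ℂ → ℝ := fun u => ∏ k ∈ s.onCircle.erase j, ‖u - s.z k‖ ^ 2 / ‖s.z j - s.z k‖ ^ 2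
      with hf
    have hfc : ContDiff ℝ 1 f :=
      contDiff_prod fun k _ => ((contDiff_id.sub contDiff_const).norm_sq ℝ).div_const _
    obtain ⟨L, hL0, hL⟩ := exists_norm_sub_le_mul_norm_sub hfc
    have hc : ContDiff ℝ 1 fun θ => f (circleMap 0 1 θ) := hfc.comp (contDiff_circleMap 0 1)
    refine ⟨fun θ => f (circleMap 0 1 θ), deriv fun θ => f (circleMap 0 1 θ), L, hL0,
      fun θ => ((hc.differentiable one_ne_zero) θ).hasDerivAt, hc.continuous_deriv le_rfl,
      fun θ θ' => hL _ _ (by simp) (by simp), fun hj k hk θ hθ => ?_⟩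
    split_ifs with hjk
    · subst hjk
      simp only [hf, hθ]
      refine Finset.prod_eq_one fun i hi => ?_
      refine div_self (pow_ne_zero _ (norm_ne_zero_iff.2 (sub_ne_zero.2 ?_)))
      exact fun e => (Finset.ne_of_mem_erase hi) (hs.injective e).symm
    · simp only [hf, hθ]
      refine Finset.prod_eq_zero (i := k) (Finset.mem_erase.2 ⟨fun e => hjk e.symm, hk⟩) ?_
      simp
  choose b b' L hL0 h1 h2 h3 h4 using key
  refine ⟨b, b', ∑ j, L j, Finset.sum_nonneg fun j _ => hL0 j, fun j =>
    ⟨h1 j, h2 j, fun θ θ' => (h3 j θ θ').trans ?_, h4 j⟩⟩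
  exact mul_le_mul_of_nonneg_right
    (Finset.single_le_sum (f := L) (fun k _ => hL0 k) (Finset.mem_univ j)) (norm_nonneg _)

end System

theorem norm_exp_mul_I_sub_le (x y : ℝ) :
    ‖Complex.exp (x * Complex.I) - Complex.exp (y * Complex.I)‖ ≤ |x - y| := by
  have := (lipschitzWith_circleMap 0 1).dist_le_mul x y
  simpa [circleMap, dist_eq_norm] using this

section Deformation

variable {m : ℕ} {ρ : Fin (m + 1) → ℂ} {s : ℝ → System m ρ} {S : Set ℝ} {D : Set (ℝ × ℂ)}

/-- A motion of the unit circle which carries the singular points on it along, with rotation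
angle `η`, for times in the `δ`-neighbourhood of `t`. -/
structure IsCircleFlow (s : ℝ → System m ρ) (S : Set ℝ) (t δ M : ℝ) (η v ηθ vθ : ℝ → ℝ → ℝ) :
    Prop where
  pos : 0 < δ
  mem : ∀ τ ∈ Metric.ball t δ, τ ∈ S
  hasDerivAt_time : ∀ τ ∈ Metric.ball t δ, ∀ θ, HasDerivAt (fun τ => η τ θ) (v τ θ) τ
  hasDerivAt_angle : ∀ τ ∈ Metric.ball t δ, ∀ θ, HasDerivAt (η τ) (ηθ τ θ) θ
  continuous_angle : ∀ τ ∈ Metric.ball t δ, Continuous (ηθ τ)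
  hasDerivAt_mixed : ∀ τ ∈ Metric.ball t δ, ∀ θ, HasDerivAt (fun τ => ηθ τ θ) (vθ τ θ) τ
  hasDerivAt_velocity : ∀ θ, HasDerivAt (v t) (vθ t θ) θ
  continuous_velocity : Continuous (vθ t)
  periodic : ∀ τ ∈ Metric.ball t δ, η τ (2 * Real.pi) = η τ 0
  periodic_velocity : v t (2 * Real.pi) = v t 0
  zero : ∀ θ, η t θ = 0
  zero_angle : ∀ θ, ηθ t θ = 0
  avoid : ∀ τ ∈ Metric.ball t δ, ∀ θ, (∀ j, circleMap 0 1 θ ≠ (s t).z j) →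
    ∀ j, circleMap 0 1 (θ + η τ θ) ≠ (s τ).z j
  bound : ∀ τ ∈ Metric.ball t δ, ∀ θ ∈ Icc 0 (2 * Real.pi), (∀ j, circleMap 0 1 θ ≠ (s t).z j) →
    ‖∑ j, ρ j * ((circleMap 0 1 (θ + η τ θ) * Complex.I * v τ θ - dotz s j τ) /
      (circleMap 0 1 (θ + η τ θ) - (s τ).z j))‖ ≤ M
  bound_velocity : ∀ τ ∈ Metric.ball t δ, ∀ θ ∈ Icc 0 (2 * Real.pi), |v τ θ| ≤ M
  bound_angle : ∀ τ ∈ Metric.ball t δ, ∀ θ ∈ Icc 0 (2 * Real.pi), |ηθ τ θ| ≤ M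
  bound_mixed : ∀ τ ∈ Metric.ball t δ, ∀ θ ∈ Icc 0 (2 * Real.pi), |vθ τ θ| ≤ M

theorem abs_sum_mul_le {ι : Type*} (J : Finset ι) {a b : ι → ℝ} {A B : ℝ}
    (ha : ∀ j ∈ J, |a j| ≤ A) (hb : ∀ j ∈ J, |b j| ≤ B) :
    |∑ j ∈ J, a j * b j| ≤ J.card * (A * B) := by
  refine (Finset.abs_sum_le_sum_abs _ _).trans ?_
  rw [← nsmul_eq_mul]
  refine Finset.sum_le_card_nsmul _ _ _ fun j hj => ?_
  rw [abs_mul]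
  exact mul_le_mul (ha j hj) (hb j hj) (abs_nonneg _) ((abs_nonneg _).trans (ha j hj))

theorem IsDeformation.exists_circleFlow (hs : IsDeformation s S D) {t : ℝ} (ht : t ∈ S) :
    ∃ (δ M : ℝ) (η v ηθ vθ : ℝ → ℝ → ℝ), IsCircleFlow s S t δ M η v ηθ vθ := by
  obtain ⟨c, c', hc⟩ := hs.exists_phase ht
  obtain ⟨b, b', L, hL0, hb⟩ := (hs.isRegular ht).exists_bump
  set J := (s t).onCircle with hJ
  -- bounds for the angle functions on one period
  have hB : ∃ B, 0 ≤ B ∧ ∀ j, ∀ θ ∈ Icc (0 : ℝ) (2 * Real.pi), |b j θ| ≤ B ∧ |b' j θ| ≤ B := by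
    have h1 : ∀ j, ∃ B, ∀ θ ∈ Icc (0 : ℝ) (2 * Real.pi), |b j θ| ≤ B ∧ |b' j θ| ≤ B := by
      intro j
      have hbc : Continuous (b j) :=
        continuous_iff_continuousAt.2 fun θ => ((hb j).1 θ).continuousAt
      obtain ⟨B1, hB1⟩ := (isCompact_Icc (a := (0 : ℝ)) (b := 2 * Real.pi)).exists_bound_of_continuousOn
        hbc.continuousOn
      obtain ⟨B2, hB2⟩ := (isCompact_Icc (a := (0 : ℝ)) (b := 2 * Real.pi)).exists_bound_of_continuousOn
        (hb j).2.1.continuousOn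
      exact ⟨max B1 B2, fun θ hθ => ⟨(hB1 θ hθ).trans (le_max_left _ _),
        (hB2 θ hθ).trans (le_max_right _ _)⟩⟩
    choose B hB using h1
    have hB0 : ∀ j, 0 ≤ B j := fun j =>
      (abs_nonneg _).trans (hB j 0 ⟨le_rfl, by positivity⟩).1
    refine ⟨∑ j, B j, Finset.sum_nonneg fun j _ => hB0 j, fun j θ hθ => ?_⟩
    have := Finset.single_le_sum (f := B) (fun k _ => hB0 k) (Finset.mem_univ j)
    exact ⟨((hB j θ hθ).1).trans this, ((hB j θ hθ).2).trans this⟩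
  obtain ⟨B, hB0, hB⟩ := hB
  -- bounds for the velocities of the singular points, near the time `t`
  have hA : ∃ A, 0 ≤ A ∧ ∀ᶠ τ in 𝓝 t, ∀ j, ‖dotz s j τ‖ ≤ A := by
    have h1 : ∀ j, ∀ᶠ τ in 𝓝 t, ‖dotz s j τ‖ ≤ ‖dotz s j t‖ + 1 := fun j =>
      (((hs.continuousOn_dotz j).continuousAt (hs.isOpen_times.mem_nhds ht)).norm.eventually_lt
        continuousAt_const (lt_add_one _)).mono fun τ h => le_of_lt h
    refine ⟨∑ j, (‖dotz s j t‖ + 1), Finset.sum_nonneg fun j _ => by positivity, ?_⟩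
    rw [Filter.eventually_all]
    intro j
    filter_upwards [h1 j] with τ h
    exact h.trans (Finset.single_le_sum (f := fun j => ‖dotz s j t‖ + 1)
      (fun k _ => by positivity) (Finset.mem_univ j))
  obtain ⟨A, hA0, hA⟩ := hA
  have hoff : ∃ r, 0 < r ∧ ∀ᶠ τ in 𝓝 t, ∀ j ∉ J, ∀ ζ : ℂ, ‖ζ‖ = 1 → r ≤ ‖ζ - (s τ).z j‖ := by
    have h1 : ∀ j, ∃ r, 0 < r ∧ (j ∉ J → ∀ᶠ τ in 𝓝 t, ∀ ζ : ℂ, ‖ζ‖ = 1 → r ≤ ‖ζ - (s τ).z j‖) := by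
      intro j
      by_cases hj : j ∈ J
      · exact ⟨1, one_pos, fun h => absurd hj h⟩
      · have hne : 0 < |1 - ‖(s t).z j‖| := abs_pos.2 (sub_ne_zero.2 fun e => hj
          (System.mem_onCircle.2 e.symm))
        refine ⟨|1 - ‖(s t).z j‖| / 2, by positivity, fun _ => ?_⟩
        have hcont : ContinuousAt (fun τ => |1 - ‖(s τ).z j‖|) t :=
          (continuousAt_const.sub (hs.hasDerivAt_z ht j).continuousAt.norm).abs
        filter_upwards [continuousAt_const.eventually_lt hcont (half_lt_self hne)] with τ hτ ζ hζ
        refine (le_of_lt hτ).trans ?_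
        rw [← hζ]
        exact abs_norm_sub_norm_le _ _
    choose r hr0 hr using h1
    have hne : (Finset.univ : Finset (Fin (m + 1))).Nonempty := Finset.univ_nonempty
    refine ⟨Finset.univ.inf' hne r, (Finset.lt_inf'_iff _).2 fun j _ => hr0 j, ?_⟩
    rw [Filter.eventually_all]
    intro j
    rw [eventually_imp_distrib_left]
    intro hj
    filter_upwards [hr j hj] with τ hτ ζ hζ
    exact (Finset.inf'_le _ (Finset.mem_univ j)).trans (hτ ζ hζ)
  obtain ⟨r, hr0, hr⟩ := hoff
  have hcs : ∃ ε, 0 < ε ∧ (J.card * ε * L ≤ 1 / 2) ∧ ε ≤ 1 := by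
    refine ⟨min 1 (1 / (2 * (J.card * L + 1))), by positivity, ?_, min_le_left _ _⟩
    have h1 : (0 : ℝ) < J.card * L + 1 := by positivity
    calc J.card * min 1 (1 / (2 * (J.card * L + 1))) * L
        ≤ J.card * (1 / (2 * (J.card * L + 1))) * L := by gcongr; exact min_le_right _ _
      _ = (J.card * L) / (J.card * L + 1) * (1 / 2) := by field_simp
      _ ≤ 1 * (1 / 2) := by gcongr; rw [div_le_one h1]; linarith
      _ = 1 / 2 := one_mul _
  obtain ⟨ε, hε0, hεL, hε1⟩ := hcs
  have hphase : ∀ᶠ τ in 𝓝 t, ∀ j ∈ J, HasDerivAt (c j) (c' j τ) τ ∧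
        (s τ).z j = (s t).z j * Complex.exp (c j τ * Complex.I) ∧
        dotz s j τ = Complex.I * c' j τ * (s τ).z j ∧ |c j τ| ≤ ε := by
    rw [Filter.eventually_all]
    intro j
    rw [eventually_imp_distrib_left]
    intro hj
    have h1 := (hc j hj).2
    have h2 : ∀ᶠ τ in 𝓝 t, |c j τ| < ε := by
      have := h1.self_of_nhds.1.continuousAt.abs
      refine this.eventually_lt continuousAt_const ?_
      rw [(hc j hj).1, abs_zero]; exact hε0
    filter_upwards [h1, h2] with τ h h'
    exact ⟨h.1, h.2.1, h.2.2, h'.le⟩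
  have hS : ∀ᶠ τ in 𝓝 t, τ ∈ S := hs.isOpen_times.mem_nhds ht
  have hall := ((hS.and hphase).and hr).and hA
  obtain ⟨δ, hδ, hball⟩ := Metric.eventually_nhds_iff_ball.1 hall
  have hc'A : ∀ τ ∈ Metric.ball t δ, ∀ j ∈ J, |c' j τ| ≤ A := by
    intro τ hτ j hj
    obtain ⟨⟨⟨hS, h1⟩, -⟩, h2⟩ := hball τ hτ
    have h3 := h2 j
    rw [(h1 j hj).2.2.1, norm_mul, norm_mul, hs.norm_z_eq_one ht hS hj] at h3
    simpa using h3
  have ht0 : t ∈ Metric.ball t δ := Metric.mem_ball_self hδ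
  -- the rotation angle at a singular point, and the basic lower bound
  have hper : ∀ j, b j (2 * Real.pi) = b j 0 := by
    intro j
    have h1 := (hb j).2.2.1 (2 * Real.pi) 0
    rw [show circleMap 0 1 (2 * Real.pi) = circleMap 0 1 0 by
      simpa using periodic_circleMap 0 1 0, sub_self, norm_zero, mul_zero] at h1
    exact sub_eq_zero.1 (abs_nonpos_iff.1 h1)
  have hsum : ∀ a : Fin (m + 1) → ℝ, ∀ k ∈ J, ∀ θ, circleMap 0 1 θ = (s t).z k →
      ∑ j ∈ J, a j * b j θ = a k := by
    intro a k hk θ hθ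
    rw [Finset.sum_eq_single_of_mem k hk]
    · rw [(hb k).2.2.2 hk k hk θ hθ, if_pos rfl, mul_one]
    · intro j hj hjk
      rw [(hb j).2.2.2 hj k hk θ hθ, if_neg hjk, mul_zero]
  have hdiff : ∀ (a : Fin (m + 1) → ℝ) (A : ℝ), (∀ j ∈ J, |a j| ≤ A) → ∀ k ∈ J, ∀ θ,
      |∑ j ∈ J, a j * b j θ - a k| ≤ J.card * A * L * ‖circleMap 0 1 θ - (s t).z k‖ := by
    intro a A ha k hk θ
    obtain ⟨θk, -, hθk⟩ : (s t).z k ∈ circleMap 0 1 '' Ioc 0 (2 * Real.pi) := by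
      rw [image_circleMap_Ioc]; simpa using System.mem_onCircle.1 hk
    rw [← hsum a k hk θk hθk, ← Finset.sum_sub_distrib]
    simp only [← mul_sub]
    refine (abs_sum_mul_le J ha fun j _ => (hb j).2.2.1 θ θk).trans (le_of_eq ?_)
    rw [hθk]; ring
  have hcirc : ∀ x y : ℝ, circleMap 0 1 (x + y) = circleMap 0 1 x * Complex.exp (y * Complex.I) := by
    intro x y
    simp only [circleMap, zero_add, Complex.ofReal_one, one_mul, ← Complex.exp_add]
    congr 1; push_cast; ring
  have hlow : ∀ τ ∈ Metric.ball t δ, ∀ θ, ∀ k ∈ J, ‖circleMap 0 1 θ - (s t).z k‖ ≤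
      2 * ‖circleMap 0 1 (θ + ∑ j ∈ J, c j τ * b j θ) - (s τ).z k‖ := by
    intro τ hτ θ k hk
    obtain ⟨⟨⟨hS, h1⟩, -⟩, h2⟩ := hball τ hτ
    set x := ∑ j ∈ J, c j τ * b j θ
    have h3 : circleMap 0 1 (θ + x) - (s τ).z k
        = (circleMap 0 1 θ - (s t).z k) * Complex.exp (c k τ * Complex.I) +
          circleMap 0 1 θ * (Complex.exp (x * Complex.I) - Complex.exp (c k τ * Complex.I)) := by
      rw [hcirc, (h1 k hk).2.1]; ring
    have h4 : ‖Complex.exp (x * Complex.I) - Complex.exp (c k τ * Complex.I)‖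
        ≤ 1 / 2 * ‖circleMap 0 1 θ - (s t).z k‖ := by
      refine (norm_exp_mul_I_sub_le _ _).trans
        ((hdiff (fun j => c j τ) ε (fun j hj => (h1 j hj).2.2.2) k hk θ).trans ?_)
      gcongr
    have h5 : ‖(circleMap 0 1 θ - (s t).z k) * Complex.exp (c k τ * Complex.I)‖
        = ‖circleMap 0 1 θ - (s t).z k‖ := by
      rw [norm_mul, Complex.norm_exp_ofReal_mul_I, mul_one]
    have h6 : ‖circleMap 0 1 θ * (Complex.exp (x * Complex.I) - Complex.exp (c k τ * Complex.I))‖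
        ≤ 1 / 2 * ‖circleMap 0 1 θ - (s t).z k‖ := by
      rw [norm_mul]; simpa using h4
    have h7 := norm_sub_le (circleMap 0 1 (θ + x) - (s τ).z k)
      (circleMap 0 1 θ * (Complex.exp (x * Complex.I) - Complex.exp (c k τ * Complex.I)))
    rw [h3, add_sub_cancel_right, h5, ← h3] at h7
    linarith
  set Mon := J.card * (A * B) + 2 * (J.card * A * L) with hMon
  set Moff := (J.card * (A * B) + A) / r with hMoff
  have hMon0 : 0 ≤ Mon := by positivity
  have hMoff0 : 0 ≤ Moff := by positivity
  refine ⟨δ, (∑ j, ‖ρ j‖ * (Mon + Moff)) + J.card * (A * B) + J.card * (1 * B),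
    fun τ θ => ∑ j ∈ J, c j τ * b j θ, fun τ θ => ∑ j ∈ J, c' j τ * b j θ,
    fun τ θ => ∑ j ∈ J, c j τ * b' j θ, fun τ θ => ∑ j ∈ J, c' j τ * b' j θ, ?_⟩
  have hS0 : 0 ≤ ∑ j, ‖ρ j‖ * (Mon + Moff) := Finset.sum_nonneg fun j _ => by positivity
  have hv : ∀ τ ∈ Metric.ball t δ, ∀ θ ∈ Icc 0 (2 * Real.pi),
      |∑ j ∈ J, c' j τ * b j θ| ≤ J.card * (A * B) := fun τ hτ θ hθ =>
    abs_sum_mul_le J (hc'A τ hτ) fun j _ => (hB j θ hθ).1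
  refine
    { pos := hδ
      mem := fun τ hτ => (hball τ hτ).1.1.1
      hasDerivAt_time := fun τ hτ θ => HasDerivAt.fun_sum fun j hj =>
        ((hball τ hτ).1.1.2 j hj).1.mul_const _
      hasDerivAt_angle := fun τ hτ θ => HasDerivAt.fun_sum fun j hj => ((hb j).1 θ).const_mul _
      continuous_angle := fun τ hτ => continuous_finsetSum _ fun j _ =>
        continuous_const.mul (hb j).2.1
      hasDerivAt_mixed := fun τ hτ θ => HasDerivAt.fun_sum fun j hj =>
        ((hball τ hτ).1.1.2 j hj).1.mul_const _
      hasDerivAt_velocity := fun θ => HasDerivAt.fun_sum fun j hj => ((hb j).1 θ).const_mul _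
      continuous_velocity := continuous_finsetSum _ fun j _ => continuous_const.mul (hb j).2.1
      periodic := fun τ hτ => Finset.sum_congr rfl fun j _ => by rw [hper]
      periodic_velocity := Finset.sum_congr rfl fun j _ => by rw [hper]
      zero := fun θ => Finset.sum_eq_zero fun j hj => by rw [(hc j hj).1, zero_mul]
      zero_angle := fun θ => Finset.sum_eq_zero fun j hj => by rw [(hc j hj).1, zero_mul]
      avoid := ?_
      bound := ?_
      bound_velocity := fun τ hτ θ hθ => (hv τ hτ θ hθ).trans ?_
      bound_angle := fun τ hτ θ hθ => (abs_sum_mul_le J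
        (fun j hj => ((hball τ hτ).1.1.2 j hj).2.2.2.trans hε1)
        fun j _ => (hB j θ hθ).2).trans ?_
      bound_mixed := fun τ hτ θ hθ => (abs_sum_mul_le J (hc'A τ hτ)
        fun j _ => (hB j θ hθ).2).trans ?_ }
  · intro τ hτ θ hθ j hj
    by_cases hjJ : j ∈ J
    · have := hlow τ hτ θ j hjJ
      rw [hj, sub_self, norm_zero, mul_zero] at this
      exact hθ j (sub_eq_zero.1 (norm_le_zero_iff.1 this))
    · have := (hball τ hτ).1.2 j hjJ (circleMap 0 1 (θ + ∑ j ∈ J, c j τ * b j θ)) (by simp)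
      rw [hj, sub_self, norm_zero] at this
      linarith
  · intro τ hτ θ hθ hn
    have h0 : ∑ j, ‖ρ j‖ * (Mon + Moff) ≤
        ∑ j, ‖ρ j‖ * (Mon + Moff) + J.card * (A * B) + J.card * (1 * B) := by
      have : 0 ≤ J.card * (A * B) := by positivity
      have : 0 ≤ J.card * (1 * B) := by positivity
      linarith
    refine le_trans ((norm_sum_le _ _).trans (Finset.sum_le_sum fun j _ => ?_)) h0
    rw [norm_mul]
    refine mul_le_mul_of_nonneg_left ?_ (norm_nonneg _)
    obtain ⟨⟨⟨hS, h1⟩, h2⟩, h3⟩ := hball τ hτ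
    rw [norm_div]
    set v := ∑ j ∈ J, c' j τ * b j θ with hvdef
    set γ := circleMap 0 1 (θ + ∑ j ∈ J, c j τ * b j θ) with hγ
    have hγ1 : ‖γ‖ = 1 := by rw [hγ, norm_circleMap_zero, abs_one]
    have hv' := hv τ hτ θ hθ
    by_cases hjJ : j ∈ J
    · have h4 := hlow τ hτ θ j hjJ
      have hpos : 0 < ‖γ - (s τ).z j‖ := by
        have : 0 < ‖circleMap 0 1 θ - (s t).z j‖ := norm_pos_iff.2 (sub_ne_zero.2 (hn j))
        linarith
      have h5 : γ * Complex.I * v - dotz s j τ = (γ - (s τ).z j) * (Complex.I * v) +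
          (s τ).z j * Complex.I * ((v - c' j τ : ℝ) : ℂ) := by
        rw [(h1 j hjJ).2.2.1]; push_cast; ring
      have h6 := hdiff (fun j => c' j τ) A (hc'A τ hτ) j hjJ θ
      refine le_trans ?_ (le_add_of_nonneg_right hMoff0)
      rw [div_le_iff₀ hpos, h5]
      refine (norm_add_le _ _).trans ?_
      simp only [norm_mul, Complex.norm_I, Complex.norm_real, Real.norm_eq_abs, one_mul, mul_one,
        hs.norm_z_eq_one ht hS hjJ]
      have h7 : J.card * A * L * ‖circleMap 0 1 θ - (s t).z j‖
          ≤ J.card * A * L * (2 * ‖γ - (s τ).z j‖) :=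
        mul_le_mul_of_nonneg_left h4 (mul_nonneg (mul_nonneg (Nat.cast_nonneg _) hA0) hL0)
      have h8 : ‖γ - (s τ).z j‖ * |v| ≤ ‖γ - (s τ).z j‖ * (J.card * (A * B)) :=
        mul_le_mul_of_nonneg_left hv' (norm_nonneg _)
      rw [hMon]
      linarith [h6.trans h7]
    · have h4 := h2 j hjJ γ hγ1
      have h5 : ‖γ * Complex.I * v - dotz s j τ‖ ≤ J.card * (A * B) + A := by
        refine (norm_sub_le _ _).trans (add_le_add ?_ (h3 j))
        rw [norm_mul, norm_mul, hγ1, Complex.norm_I, Complex.norm_real, one_mul, one_mul]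
        exact hv'
      refine le_trans ?_ (le_add_of_nonneg_left hMon0)
      exact div_le_div₀ (by positivity) h5 hr0 h4
  all_goals
    have h1 : 0 ≤ J.card * (A * B) := by positivity
    have h2 : 0 ≤ J.card * (1 * B) := by positivity
    linarith

end Deformation

end BOPUC

end

noncomputable section

open Polynomial Filter Set MeasureTheory
open scoped Topology Interval

namespace BOPUC

section Deformation

variable {m : ℕ} {ρ : Fin (m + 1) → ℂ} {s : ℝ → System m ρ} {S : Set ℝ} {D : Set (ℝ × ℂ)}

theorem circleMap_two_pi : circleMap 0 1 (2 * Real.pi) = circleMap 0 1 0 := by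
  simpa using periodic_circleMap 0 1 0

namespace IsCircleFlow

variable {t δ M : ℝ} {η v ηθ vθ : ℝ → ℝ → ℝ}

theorem continuous_eta (h : IsCircleFlow s S t δ M η v ηθ vθ) {τ : ℝ}
    (hτ : τ ∈ Metric.ball t δ) : Continuous (η τ) :=
  continuous_iff_continuousAt.2 fun θ => (h.hasDerivAt_angle τ hτ θ).continuousAt

theorem ball_mem (h : IsCircleFlow s S t δ M η v ηθ vθ) : t ∈ Metric.ball t δ :=
  Metric.mem_ball_self h.pos

theorem hasDerivAt_point (h : IsCircleFlow s S t δ M η v ηθ vθ) {τ : ℝ}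
    (hτ : τ ∈ Metric.ball t δ) (θ : ℝ) :
    HasDerivAt (fun τ => circleMap 0 1 (θ + η τ θ))
      (circleMap 0 1 (θ + η τ θ) * Complex.I * v τ θ) τ := by
  have := (hasDerivAt_circleMap 0 1 (θ + η τ θ)).scomp τ
    ((h.hasDerivAt_time τ hτ θ).const_add θ)
  refine (show HasDerivAt (fun τ => circleMap 0 1 (θ + η τ θ)) _ τ from this).congr_deriv ?_
  rw [Complex.real_smul]; ring

/-- Change of variables by the flow. -/
theorem integral_eq (hs : IsDeformation s S D) (h : IsCircleFlow s S t δ M η v ηθ vθ) {τ : ℝ}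
    (hτ : τ ∈ Metric.ball t δ) {g : ℂ → ℂ} (hg : ContinuousOn g (Metric.sphere 0 1)) :
    ∫ θ in (0 : ℝ)..2 * Real.pi, (s τ).w (circleMap 0 1 θ) *
        (g (circleMap 0 1 θ) * (circleMap 0 1 θ * Complex.I)) =
      ∫ θ in (0 : ℝ)..2 * Real.pi, (s τ).w (circleMap 0 1 (θ + η τ θ)) *
        (g (circleMap 0 1 (θ + η τ θ)) * (circleMap 0 1 (θ + η τ θ) * Complex.I) *
          (1 + ηθ τ θ)) := by
  have hreg := hs.isRegular (h.mem τ hτ)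
  have hgc : Continuous fun θ => g (circleMap 0 1 θ) :=
    hg.comp_continuous (continuous_circleMap 0 1) fun θ => by simp
  set f : ℝ → ℂ := fun θ => (s τ).wHat (circleMap 0 1 θ) *
    (g (circleMap 0 1 θ) * (circleMap 0 1 θ * Complex.I)) with hf
  have hfc : Continuous f :=
    hreg.continuous_wHat.mul (hgc.mul ((continuous_circleMap 0 1).mul continuous_const))
  have hfper : Function.Periodic f (2 * Real.pi) := by
    intro θ; simp only [hf, (periodic_circleMap 0 1) θ]
  have h1 : ∫ θ in (0 : ℝ)..2 * Real.pi, (s τ).w (circleMap 0 1 θ) *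
        (g (circleMap 0 1 θ) * (circleMap 0 1 θ * Complex.I))
      = ∫ θ in (0 : ℝ)..2 * Real.pi, f θ := by
    refine intervalIntegral.integral_congr_ae ?_
    filter_upwards [(s τ).ae_circleMap_ne] with θ hθ _
    rw [hf]; simp only; rw [System.wHat_of_ne hθ]
  have h2 : ∫ θ in (0 : ℝ)..2 * Real.pi, (s τ).w (circleMap 0 1 (θ + η τ θ)) *
        (g (circleMap 0 1 (θ + η τ θ)) * (circleMap 0 1 (θ + η τ θ) * Complex.I) *
          (1 + ηθ τ θ))
      = ∫ θ in (0 : ℝ)..2 * Real.pi, (1 + ηθ τ θ) • f (θ + η τ θ) := by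
    refine intervalIntegral.integral_congr_ae ?_
    filter_upwards [(s t).ae_circleMap_ne] with θ hθ _
    rw [hf]; simp only
    rw [System.wHat_of_ne (h.avoid τ hτ θ hθ), Complex.real_smul]
    push_cast; ring
  rw [h1, h2]
  have h3 := intervalIntegral.integral_deriv_smul_comp (a := 0) (b := 2 * Real.pi)
    (f := fun θ => θ + η τ θ) (f' := fun θ => 1 + ηθ τ θ) (g := f)
    (fun θ _ => (hasDerivAt_id θ).add (h.hasDerivAt_angle τ hτ θ))
    (continuous_const.add (h.continuous_angle τ hτ)).continuousOn hfc
  simp only [Function.comp_def] at h3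
  rw [h3, h.periodic τ hτ, zero_add, add_comm (2 * Real.pi)]
  have := hfper.intervalIntegral_add_eq 0 (η τ 0)
  rw [zero_add] at this
  exact this

theorem norm_weight_le (hs : IsDeformation s S D) (h : IsCircleFlow s S t δ M η v ηθ vθ) {τ : ℝ}
    (hτ : τ ∈ Metric.ball t δ) {θ : ℝ} (hθ : θ ∈ Icc 0 (2 * Real.pi))
    (hn : ∀ j, circleMap 0 1 θ ≠ (s t).z j) :
    ‖(s τ).w (circleMap 0 1 (θ + η τ θ))‖ ≤
      ‖(s t).wHat (circleMap 0 1 θ)‖ * Real.exp (M * δ) := by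
  have hM : 0 ≤ M := (abs_nonneg _).trans (h.bound_velocity t h.ball_mem θ hθ)
  have hord : (Metric.ball t δ).OrdConnected := by
    rw [Real.ball_eq_Ioo]; exact ordConnected_Ioo
  have h1 := norm_le_exp_mul_norm (K := fun τ => (s τ).w (circleMap 0 1 (θ + η τ θ))) hord
    (M := M)
    (fun τ hτ => hs.hasDerivAt_weight_comp (h.hasDerivAt_point hτ θ)
      (hs.circle_sub τ (h.mem τ hτ) _ (by simp) (h.avoid τ hτ θ hn)))
    (fun τ hτ => h.bound τ hτ θ hθ hn) hτ h.ball_mem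
  simp only [h.zero, add_zero] at h1
  rw [System.wHat_of_ne hn]
  refine h1.trans ?_
  gcongr
  rw [← Real.dist_eq]
  exact (Metric.mem_ball.1 hτ).le

end IsCircleFlow

/-- The time derivative of a moment of the weight. -/
theorem IsDeformation.hasDerivAt_Lam (hs : IsDeformation s S D) {t : ℝ} (ht : t ∈ S) {g : ℂ → ℂ}
    (hg : AnalyticOnNhd ℂ g (Metric.sphere 0 1)) :
    HasDerivAt (fun τ => (s τ).Lam g)
      (-∑ j, ρ j * dotz s j t * (s t).Lam fun ζ => g ζ / (ζ - (s t).z j)) t := by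
  obtain ⟨δ, M, η, v, ηθ, vθ, h⟩ := hs.exists_circleFlow ht
  have hreg := hs.isRegular ht
  have hmem : ∀ θ, circleMap 0 1 θ ∈ Metric.sphere (0 : ℂ) 1 := fun θ => by simp
  have hgc : Continuous fun θ => g (circleMap 0 1 θ) :=
    hg.continuousOn.comp_continuous (continuous_circleMap 0 1) hmem
  have hdc : Continuous fun θ => deriv g (circleMap 0 1 θ) :=
    hg.deriv.continuousOn.comp_continuous (continuous_circleMap 0 1) hmem
  obtain ⟨C1, hC1⟩ := (isCompact_sphere (0 : ℂ) 1).exists_bound_of_continuousOn hg.continuousOn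
  obtain ⟨C2, hC2⟩ := (isCompact_sphere (0 : ℂ) 1).exists_bound_of_continuousOn
    hg.deriv.continuousOn
  have hC1' : 0 ≤ C1 := (norm_nonneg _).trans (hC1 _ (hmem 0))
  have hC2' : 0 ≤ C2 := (norm_nonneg _).trans (hC2 _ (hmem 0))
  have hM : 0 ≤ M := (abs_nonneg _).trans
    (h.bound_velocity t h.ball_mem 0 ⟨le_rfl, by positivity⟩)
  set K : ℝ → ℝ → ℂ := fun τ θ => g (circleMap 0 1 (θ + η τ θ)) *
    (circleMap 0 1 (θ + η τ θ) * Complex.I) * (1 + ηθ τ θ) with hK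
  set K' : ℝ → ℝ → ℂ := fun τ θ =>
    (deriv g (circleMap 0 1 (θ + η τ θ)) * (circleMap 0 1 (θ + η τ θ) * Complex.I * v τ θ) *
      (circleMap 0 1 (θ + η τ θ) * Complex.I) + g (circleMap 0 1 (θ + η τ θ)) *
      (circleMap 0 1 (θ + η τ θ) * Complex.I * v τ θ * Complex.I)) * (1 + ηθ τ θ) +
    g (circleMap 0 1 (θ + η τ θ)) * (circleMap 0 1 (θ + η τ θ) * Complex.I) * vθ τ θ with hK'
  set Q : ℝ → ℝ → ℂ := fun τ θ => ∑ j, ρ j * ((circleMap 0 1 (θ + η τ θ) * Complex.I * v τ θ -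
    dotz s j τ) / (circleMap 0 1 (θ + η τ θ) - (s τ).z j)) with hQ
  have hKd : ∀ τ ∈ Metric.ball t δ, ∀ θ, HasDerivAt (fun τ => K τ θ) (K' τ θ) τ := by
    intro τ hτ θ
    have hp := h.hasDerivAt_point hτ θ
    have h1 : HasDerivAt (fun τ => g (circleMap 0 1 (θ + η τ θ)))
        (deriv g (circleMap 0 1 (θ + η τ θ)) * (circleMap 0 1 (θ + η τ θ) * Complex.I * v τ θ)) τ :=
      HasDerivAt.comp (h₂ := g) τ (hg _ (hmem _)).differentiableAt.hasDerivAt hp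
    have h2 : HasDerivAt (fun τ => (1 + ηθ τ θ : ℂ)) (vθ τ θ : ℂ) τ :=
      (h.hasDerivAt_mixed τ hτ θ).ofReal_comp.const_add 1
    exact (h1.mul (hp.mul_const Complex.I)).mul h2
  have hKb : ∀ τ ∈ Metric.ball t δ, ∀ θ ∈ Icc 0 (2 * Real.pi), ‖K τ θ‖ ≤ C1 * (1 + M) := by
    intro τ hτ θ hθ
    have h1 : ‖(1 + ηθ τ θ : ℂ)‖ ≤ 1 + M := (norm_add_le _ _).trans (by
      simpa using h.bound_angle τ hτ θ hθ)
    simp only [hK, norm_mul, norm_circleMap_zero, abs_one, Complex.norm_I, mul_one]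
    exact mul_le_mul (hC1 _ (hmem _)) h1 (norm_nonneg _) hC1'
  have hKb' : ∀ τ ∈ Metric.ball t δ, ∀ θ ∈ Icc 0 (2 * Real.pi),
      ‖K' τ θ‖ ≤ (C2 * M + C1 * M) * (1 + M) + C1 * M := by
    intro τ hτ θ hθ
    have h1 : ‖(1 + ηθ τ θ : ℂ)‖ ≤ 1 + M := (norm_add_le _ _).trans (by
      simpa using h.bound_angle τ hτ θ hθ)
    have h2 := h.bound_velocity τ hτ θ hθ
    have h3 := h.bound_mixed τ hτ θ hθ
    have h4 := hC1 _ (hmem (θ + η τ θ))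
    have h5 := hC2 _ (hmem (θ + η τ θ))
    refine (norm_add_le _ _).trans (add_le_add ?_ ?_)
    · rw [norm_mul]
      refine mul_le_mul ((norm_add_le _ _).trans (add_le_add ?_ ?_)) h1 (norm_nonneg _)
        (by positivity)
      · simp only [norm_mul, norm_circleMap_zero, abs_one, Complex.norm_I, mul_one, one_mul,
          Complex.norm_real, Real.norm_eq_abs]
        exact mul_le_mul h5 h2 (abs_nonneg _) hC2'
      · simp only [norm_mul, norm_circleMap_zero, abs_one, Complex.norm_I, mul_one, one_mul,
          Complex.norm_real, Real.norm_eq_abs]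
        exact mul_le_mul h4 h2 (abs_nonneg _) hC1'
    · simp only [norm_mul, norm_circleMap_zero, abs_one, Complex.norm_I, mul_one,
        Complex.norm_real, Real.norm_eq_abs]
      exact mul_le_mul h4 h3 (abs_nonneg _) hC1'
  have hKc : ∀ τ ∈ Metric.ball t δ, Continuous (K τ) := by
    intro τ hτ
    have h1 : Continuous fun θ => θ + η τ θ := continuous_id.add (h.continuous_eta hτ)
    exact ((hgc.comp h1).mul (((continuous_circleMap 0 1).comp h1).mul continuous_const)).mul
      (continuous_const.add (Complex.continuous_ofReal.comp (h.continuous_angle τ hτ)))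
  -- the derivative of the integrand at the time `t`, as a total derivative and a remainder
  set k : ℝ → ℂ := fun θ => g (circleMap 0 1 θ) * (circleMap 0 1 θ * Complex.I) * v t θ with hk
  set k' : ℝ → ℂ := fun θ =>
    (deriv g (circleMap 0 1 θ) * (circleMap 0 1 θ * Complex.I) *
      (circleMap 0 1 θ * Complex.I) + g (circleMap 0 1 θ) *
      (circleMap 0 1 θ * Complex.I * Complex.I)) * v t θ +
    g (circleMap 0 1 θ) * (circleMap 0 1 θ * Complex.I) * vθ t θ with hk'
  have hvc : Continuous (v t) :=
    continuous_iff_continuousAt.2 fun θ => (h.hasDerivAt_velocity θ).continuousAt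
  have hkd : ∀ θ, HasDerivAt k (k' θ) θ := by
    intro θ
    have h0 := hasDerivAt_circleMap 0 1 θ
    have h1 : HasDerivAt (fun θ => g (circleMap 0 1 θ))
        (deriv g (circleMap 0 1 θ) * (circleMap 0 1 θ * Complex.I)) θ :=
      HasDerivAt.comp (h₂ := g) θ (hg _ (hmem _)).differentiableAt.hasDerivAt h0
    exact (h1.mul (h0.mul_const Complex.I)).mul (h.hasDerivAt_velocity θ).ofReal_comp
  have hkc : Continuous k := continuous_iff_continuousAt.2 fun θ => (hkd θ).continuousAt
  have hkc' : Continuous k' := by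
    have := continuous_circleMap 0 1
    have h1 := Complex.continuous_ofReal.comp hvc
    have h2 := Complex.continuous_ofReal.comp h.continuous_velocity
    exact ((((hdc.mul (this.mul continuous_const)).mul (this.mul continuous_const)).add
      (hgc.mul ((this.mul continuous_const).mul continuous_const))).mul h1).add
      ((hgc.mul (this.mul continuous_const)).mul h2)
  have hkper : k (2 * Real.pi) = k 0 := by
    simp only [hk]; rw [circleMap_two_pi, h.periodic_velocity]
  have hI1 := hreg.intervalIntegrable_deriv_weight_mul hkc hkc'
  have hI2 : IntervalIntegrable (fun θ => ∑ j, -(ρ j * dotz s j t *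
      (circleMap 0 1 θ * Complex.I * (s t).w (circleMap 0 1 θ) * (g (circleMap 0 1 θ) /
        (circleMap 0 1 θ - (s t).z j))))) volume 0 (2 * Real.pi) := by
    rw [← Finset.sum_fn]
    refine IntervalIntegrable.sum _ fun j _ => (IntervalIntegrable.const_mul ?_ _).neg
    have := (circleIntegrable_iff 1).1 (hreg.circleIntegrable_mul_div hg.continuousOn j)
    simpa [mul_assoc] using this
  have hsplit : ∀ θ, (s t).w (circleMap 0 1 (θ + η t θ)) * (Q t θ * K t θ + K' t θ) =
      ((s t).w (circleMap 0 1 θ) * k' θ + ∑ j, ρ j * (circleMap 0 1 θ * Complex.I * k θ) *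
        ((s t).w (circleMap 0 1 θ) / (circleMap 0 1 θ - (s t).z j))) +
      ∑ j, -(ρ j * dotz s j t * (circleMap 0 1 θ * Complex.I * (s t).w (circleMap 0 1 θ) *
        (g (circleMap 0 1 θ) / (circleMap 0 1 θ - (s t).z j)))) := by
    intro θ
    simp only [hQ, hK, hK', hk, hk', h.zero, h.zero_angle, add_zero, Complex.ofReal_zero, mul_one]
    generalize circleMap 0 1 θ = e
    have e1 : ∑ j, ρ j * ((e * Complex.I * v t θ - dotz s j t) / (e - (s t).z j)) =
        e * Complex.I * v t θ * ∑ j, ρ j / (e - (s t).z j)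
          - ∑ j, ρ j * dotz s j t / (e - (s t).z j) := by
      rw [Finset.mul_sum, ← Finset.sum_sub_distrib]
      exact Finset.sum_congr rfl fun j _ => by ring
    have e2 : ∑ j, ρ j * (e * Complex.I * (g e * (e * Complex.I) * v t θ)) *
        ((s t).w e / (e - (s t).z j)) = (e * Complex.I * (g e * (e * Complex.I) * v t θ)) *
          (s t).w e * ∑ j, ρ j / (e - (s t).z j) := by
      rw [Finset.mul_sum]
      exact Finset.sum_congr rfl fun j _ => by ring
    have e3 : ∑ j, -(ρ j * dotz s j t * (e * Complex.I * (s t).w e * (g e / (e - (s t).z j)))) =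
        -(e * Complex.I * (s t).w e * g e * ∑ j, ρ j * dotz s j t / (e - (s t).z j)) := by
      rw [Finset.mul_sum, ← Finset.sum_neg_distrib]
      exact Finset.sum_congr rfl fun j _ => by ring
    rw [e1, e2, e3]; ring
  have hmain := intervalIntegral.hasDerivAt_integral_of_dominated_loc_of_deriv_le
    (μ := volume) (a := 0) (b := 2 * Real.pi) (𝕜 := ℝ) (x₀ := t)
    (F := fun τ θ => (s τ).w (circleMap 0 1 (θ + η τ θ)) * K τ θ)
    (F' := fun τ θ => (s τ).w (circleMap 0 1 (θ + η τ θ)) * (Q τ θ * K τ θ + K' τ θ))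
    (bound := fun θ => ‖(s t).wHat (circleMap 0 1 θ)‖ * (Real.exp (M * δ) *
      (M * (C1 * (1 + M)) + ((C2 * M + C1 * M) * (1 + M) + C1 * M))))
    (Metric.ball_mem_nhds t h.pos) ?_ ?_ ?_ ?_ ?_ ?_
  · have hd := hmain.2.const_mul (2 * (Real.pi : ℂ) * Complex.I)⁻¹
    have hLam : ∀ τ ∈ Metric.ball t δ, (s τ).Lam g = (2 * (Real.pi : ℂ) * Complex.I)⁻¹ *
        ∫ θ in (0 : ℝ)..2 * Real.pi, (s τ).w (circleMap 0 1 (θ + η τ θ)) * K τ θ := by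
      intro τ hτ
      rw [hK, ← h.integral_eq hs hτ hg.continuousOn, System.Lam, circleIntegral]
      congr 1
      refine intervalIntegral.integral_congr fun θ _ => ?_
      simp only [deriv_circleMap, smul_eq_mul]; ring
    refine (hd.congr_of_eventuallyEq ?_).congr_deriv ?_
    · filter_upwards [Metric.ball_mem_nhds t h.pos] with τ hτ using hLam τ hτ
    · rw [intervalIntegral.integral_congr fun θ _ => hsplit θ,
        intervalIntegral.integral_add hI1 hI2,
        hreg.integral_deriv_weight_mul hkd hkc' hkper, zero_add,
        intervalIntegral.integral_finsetSum]
      · rw [Finset.mul_sum, ← Finset.sum_neg_distrib]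
        refine Finset.sum_congr rfl fun j _ => ?_
        rw [intervalIntegral.integral_neg, intervalIntegral.integral_const_mul, System.Lam,
          circleIntegral]
        simp only [deriv_circleMap, smul_eq_mul, mul_assoc]
        ring
      · intro j _
        refine (IntervalIntegrable.const_mul ?_ _).neg
        have := (circleIntegrable_iff 1).1 (hreg.circleIntegrable_mul_div hg.continuousOn j)
        simpa [mul_assoc] using this
  · filter_upwards [Metric.ball_mem_nhds t h.pos] with τ hτ
    have h1 : Continuous fun θ => (s τ).wHat (circleMap 0 1 (θ + η τ θ)) * K τ θ :=
      ((hs.isRegular (h.mem τ hτ)).continuous_wHat.comp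
        (continuous_id.add (h.continuous_eta hτ))).mul (hKc τ hτ)
    refine h1.aestronglyMeasurable.congr (ae_restrict_of_ae ?_)
    filter_upwards [(s t).ae_circleMap_ne] with θ hθ
    rw [System.wHat_of_ne (h.avoid τ hτ θ hθ)]
  · simp only [h.zero, add_zero]
    exact IntervalIntegrable.mul_continuousOn hreg.circleIntegrable_weight
      (hKc t h.ball_mem).continuousOn
  · simp only [hsplit]
    exact (intervalIntegrable_iff.1 (hI1.add hI2)).aestronglyMeasurable
  · filter_upwards [(s t).ae_circleMap_ne] with θ hθ hm τ hτ
    rw [uIoc_of_le (by positivity)] at hm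
    have hθI := Ioc_subset_Icc_self hm
    rw [norm_mul]
    refine (mul_le_mul (h.norm_weight_le hs hτ hθI hθ) ((norm_add_le _ _).trans
      (add_le_add (b := M * (C1 * (1 + M))) ?_ (hKb' τ hτ θ hθI))) (norm_nonneg _)
      (by positivity)).trans (le_of_eq (mul_assoc _ _ _))
    rw [norm_mul]
    exact mul_le_mul (h.bound τ hτ θ hθI hθ) (hKb τ hτ θ hθI) (norm_nonneg _) hM
  · exact ((hreg.continuous_wHat.norm).mul continuous_const).intervalIntegrable _ _
  · filter_upwards [(s t).ae_circleMap_ne] with θ hθ hm τ hτ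
    have h1 := (hs.hasDerivAt_weight_comp (h.hasDerivAt_point hτ θ)
      (hs.circle_sub τ (h.mem τ hτ) _ (by simp) (h.avoid τ hτ θ hθ))).mul (hKd τ hτ θ)
    refine h1.congr_deriv ?_
    simp only [hQ]; ring

end Deformation

end BOPUC

end

noncomputable section

open Polynomial Filter Set MeasureTheory
open scoped Topology Interval

namespace BOPUC

/-- The Cauchy transform over the unit circle. -/
def cauchy (k : ℂ → ℂ) (x : ℂ) : ℂ :=
  (2 * (Real.pi : ℂ) * Complex.I)⁻¹ * ∮ ζ in C(0, 1), k ζ * (ζ - x)⁻¹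

/-- The derivative of the Cauchy transform over the unit circle. -/
def cauchyDeriv (k : ℂ → ℂ) (x : ℂ) : ℂ :=
  (2 * (Real.pi : ℂ) * Complex.I)⁻¹ * ∮ ζ in C(0, 1), k ζ * ((ζ - x) ^ 2)⁻¹

theorem abs_one_sub_norm_le {ζ x : ℂ} (hζ : ‖ζ‖ = 1) : |1 - ‖x‖| ≤ ‖ζ - x‖ := by
  rw [← hζ]; exact abs_norm_sub_norm_le _ _

theorem isOpen_norm_ne_one : IsOpen {x : ℂ | ‖x‖ ≠ 1} :=
  isOpen_ne_fun continuous_norm continuous_const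

theorem sub_ne_zero_of_norm {ζ x : ℂ} (hζ : ‖ζ‖ = 1) (hx : ‖x‖ ≠ 1) : ζ - x ≠ 0 := by
  intro h; rw [sub_eq_zero] at h; exact hx (h ▸ hζ)

theorem hasDerivAt_cauchy {k : ℂ → ℂ} (hk : CircleIntegrable k 0 1) {x : ℂ} (hx : ‖x‖ ≠ 1) :
    HasDerivAt (cauchy k) (cauchyDeriv k x) x := by
  set d := |1 - ‖x‖| with hd
  have hd0 : 0 < d := abs_pos.2 (sub_ne_zero.2 (Ne.symm hx))
  have hdist : ∀ y ∈ Metric.ball x (d / 2), ∀ ζ : ℂ, ‖ζ‖ = 1 → d / 2 ≤ ‖ζ - y‖ := by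
    intro y hy ζ hζ
    have h1 := abs_one_sub_norm_le (x := x) hζ
    have h2 : ‖ζ - x‖ ≤ ‖ζ - y‖ + ‖y - x‖ := by
      simpa using norm_add_le (ζ - y) (y - x)
    rw [Metric.mem_ball, dist_eq_norm] at hy
    linarith
  have hcont : ∀ y ∈ Metric.ball x (d / 2), ∀ n : ℕ,
      Continuous fun θ : ℝ => ((circleMap 0 1 θ - y) ^ n)⁻¹ := by
    intro y hy n
    refine Continuous.inv₀ (((continuous_circleMap 0 1).sub continuous_const).pow n) fun θ h => ?_
    have := hdist y hy (circleMap 0 1 θ) (by simp)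
    rw [eq_zero_of_pow_eq_zero h, norm_zero] at this
    linarith
  have hk' : IntervalIntegrable (fun θ => circleMap 0 1 θ * Complex.I * k (circleMap 0 1 θ))
      volume 0 (2 * Real.pi) := by
    simpa using (circleIntegrable_iff 1).1 hk
  have hx0 : x ∈ Metric.ball x (d / 2) := Metric.mem_ball_self (by positivity)
  have hmain := intervalIntegral.hasDerivAt_integral_of_dominated_loc_of_deriv_le
    (μ := volume) (a := 0) (b := 2 * Real.pi) (𝕜 := ℂ) (x₀ := x)
    (F := fun y θ => circleMap 0 1 θ * Complex.I * k (circleMap 0 1 θ) *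
      (circleMap 0 1 θ - y)⁻¹)
    (F' := fun y θ => circleMap 0 1 θ * Complex.I * k (circleMap 0 1 θ) *
      ((circleMap 0 1 θ - y) ^ 2)⁻¹)
    (bound := fun θ => ‖circleMap 0 1 θ * Complex.I * k (circleMap 0 1 θ)‖ * ((d / 2) ^ 2)⁻¹)
    (Metric.ball_mem_nhds x (half_pos hd0)) ?_ ?_ ?_ ?_ ?_ ?_
  · have := hmain.2.const_mul (2 * (Real.pi : ℂ) * Complex.I)⁻¹
    simp only [cauchyDeriv, circleIntegral, deriv_circleMap, smul_eq_mul, ← mul_assoc]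
    have e : cauchy k = fun y => (2 * (Real.pi : ℂ) * Complex.I)⁻¹ *
        ∫ θ in (0 : ℝ)..2 * Real.pi, circleMap 0 1 θ * Complex.I * k (circleMap 0 1 θ) *
          (circleMap 0 1 θ - y)⁻¹ := by
      ext y
      simp only [cauchy, circleIntegral, deriv_circleMap, smul_eq_mul, ← mul_assoc]
    rw [e]
    simpa only [← mul_assoc] using this
  · filter_upwards [Metric.ball_mem_nhds x (half_pos hd0)] with y hy
    have := hk'.mul_continuousOn (by simpa using (hcont y hy 1).continuousOn)
    exact (intervalIntegrable_iff.1 this).aestronglyMeasurable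
  · exact hk'.mul_continuousOn (by simpa using (hcont x hx0 1).continuousOn)
  · have := hk'.mul_continuousOn (hcont x hx0 2).continuousOn
    exact (intervalIntegrable_iff.1 this).aestronglyMeasurable
  · refine Filter.Eventually.of_forall fun θ _ y hy => ?_
    rw [norm_mul]
    refine mul_le_mul_of_nonneg_left ?_ (norm_nonneg _)
    rw [norm_inv, norm_pow]
    exact inv_anti₀ (by positivity) (pow_le_pow_left₀ (by positivity)
      (hdist y hy _ (by simp)) 2)
  · exact hk'.norm.mul_const _
  · refine Filter.Eventually.of_forall fun θ _ y hy => ?_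
    have hne : circleMap 0 1 θ - y ≠ 0 := by
      intro h
      have := hdist y hy (circleMap 0 1 θ) (by simp)
      rw [h, norm_zero] at this
      linarith
    have := (((hasDerivAt_id y).const_sub (circleMap 0 1 θ)).inv hne).const_mul
      (circleMap 0 1 θ * Complex.I * k (circleMap 0 1 θ))
    refine this.congr_deriv ?_
    simp only [id]; ring

theorem differentiableOn_cauchy {k : ℂ → ℂ} (hk : CircleIntegrable k 0 1) :
    DifferentiableOn ℂ (cauchy k) {x | ‖x‖ ≠ 1} := fun _ hx =>
  (hasDerivAt_cauchy hk hx).differentiableAt.differentiableWithinAt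

theorem norm_circleIntegral_mul_le {k f : ℂ → ℂ} (hk : CircleIntegrable k 0 1) {B : ℝ}
    (hB : ∀ ζ, ‖ζ‖ = 1 → ‖f ζ‖ ≤ B) :
    ‖∮ ζ in C(0, 1), k ζ * f ζ‖ ≤
      (∫ θ in (0 : ℝ)..2 * Real.pi, ‖k (circleMap 0 1 θ)‖) * B := by
  rw [circleIntegral, ← intervalIntegral.integral_mul_const]
  refine intervalIntegral.norm_integral_le_of_norm_le (by positivity)
    (Filter.Eventually.of_forall fun θ _ => ?_) (hk.norm.mul_const B)
  simp only [deriv_circleMap, smul_eq_mul, norm_mul, norm_circleMap_zero, abs_one,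
    Complex.norm_I, one_mul]
  exact mul_le_mul_of_nonneg_left (hB _ (by simp)) (norm_nonneg _)

theorem tendsto_norm_sub_one_inv :
    Tendsto (fun x : ℂ => (‖x‖ - 1)⁻¹) (Bornology.cobounded ℂ) (𝓝 0) :=
  tendsto_inv_atTop_zero.comp (tendsto_atTop_add_const_right _ _ tendsto_norm_cobounded_atTop)

theorem eventually_two_lt_norm : ∀ᶠ x : ℂ in Bornology.cobounded ℂ, 2 < ‖x‖ :=
  tendsto_norm_cobounded_atTop.eventually_gt_atTop 2

theorem tendsto_cauchy {k : ℂ → ℂ} (hk : CircleIntegrable k 0 1) :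
    Tendsto (cauchy k) (Bornology.cobounded ℂ) (𝓝 0) := by
  refine squeeze_zero_norm' (a := fun x => ‖(2 * (Real.pi : ℂ) * Complex.I)⁻¹‖ *
    ((∫ θ in (0 : ℝ)..2 * Real.pi, ‖k (circleMap 0 1 θ)‖) * (‖x‖ - 1)⁻¹)) ?_ ?_
  · filter_upwards [eventually_two_lt_norm] with x hx
    rw [cauchy, norm_mul]
    refine mul_le_mul_of_nonneg_left (norm_circleIntegral_mul_le hk fun ζ hζ => ?_) (norm_nonneg _)
    rw [norm_inv]
    refine inv_anti₀ (by linarith) ?_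
    have := abs_one_sub_norm_le (x := x) hζ
    exact (le_abs_self _).trans (by rwa [abs_sub_comm] at this)
  · have := (tendsto_norm_sub_one_inv.const_mul
      (∫ θ in (0 : ℝ)..2 * Real.pi, ‖k (circleMap 0 1 θ)‖)).const_mul
        ‖(2 * (Real.pi : ℂ) * Complex.I)⁻¹‖
    simpa only [mul_zero] using this

theorem tendsto_cauchyDeriv {k : ℂ → ℂ} (hk : CircleIntegrable k 0 1) :
    Tendsto (cauchyDeriv k) (Bornology.cobounded ℂ) (𝓝 0) := by
  refine squeeze_zero_norm' (a := fun x => ‖(2 * (Real.pi : ℂ) * Complex.I)⁻¹‖ *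
    ((∫ θ in (0 : ℝ)..2 * Real.pi, ‖k (circleMap 0 1 θ)‖) * (‖x‖ - 1)⁻¹)) ?_ ?_
  · filter_upwards [eventually_two_lt_norm] with x hx
    rw [cauchyDeriv, norm_mul]
    refine mul_le_mul_of_nonneg_left (norm_circleIntegral_mul_le hk fun ζ hζ => ?_) (norm_nonneg _)
    rw [norm_inv, norm_pow]
    refine inv_anti₀ (by linarith) ?_
    have h1 := abs_one_sub_norm_le (x := x) hζ
    have h2 : ‖x‖ - 1 ≤ ‖ζ - x‖ := (le_abs_self _).trans (by rwa [abs_sub_comm] at h1)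
    nlinarith
  · have := (tendsto_norm_sub_one_inv.const_mul
      (∫ θ in (0 : ℝ)..2 * Real.pi, ‖k (circleMap 0 1 θ)‖)).const_mul
        ‖(2 * (Real.pi : ℂ) * Complex.I)⁻¹‖
    simpa only [mul_zero] using this

namespace System

variable {m : ℕ} {ρ : Fin (m + 1) → ℂ} {s : System m ρ}

variable (s) in
/-- Integrability over the unit circle with respect to the weight. -/
def LamIntegrable (g : ℂ → ℂ) : Prop := CircleIntegrable (fun ζ => s.w ζ * g ζ) 0 1

theorem Lam_congr {g h : ℂ → ℂ} (H : ∀ ζ, ‖ζ‖ = 1 → (∀ j, ζ ≠ s.z j) → g ζ = h ζ) :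
    s.Lam g = s.Lam h := by
  rw [Lam, Lam, circleIntegral, circleIntegral]
  congr 1
  refine intervalIntegral.integral_congr_ae ?_
  filter_upwards [s.ae_circleMap_ne] with θ hθ _
  rw [H _ (by simp) hθ]

theorem LamIntegrable.congr {g h : ℂ → ℂ} (hg : s.LamIntegrable g)
    (H : ∀ ζ, ‖ζ‖ = 1 → (∀ j, ζ ≠ s.z j) → g ζ = h ζ) : s.LamIntegrable h := by
  refine IntervalIntegrable.congr_ae hg (ae_restrict_of_ae ?_)
  filter_upwards [s.ae_circleMap_ne] with θ hθ
  rw [H _ (by simp) hθ]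

theorem LamIntegrable.add {g h : ℂ → ℂ} (hg : s.LamIntegrable g) (hh : s.LamIntegrable h) :
    s.LamIntegrable fun ζ => g ζ + h ζ := by
  have := CircleIntegrable.add hg hh
  refine IntervalIntegrable.congr (fun θ _ => ?_) this
  simp only [Pi.add_apply]; ring

theorem LamIntegrable.const_mul {g : ℂ → ℂ} (hg : s.LamIntegrable g) (c : ℂ) :
    s.LamIntegrable fun ζ => c * g ζ := by
  have := CircleIntegrable.const_smul (a := c) hg
  refine IntervalIntegrable.congr (fun θ _ => ?_) this
  simp only [Pi.smul_apply, smul_eq_mul]; ring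

theorem LamIntegrable.sum {ι : Type*} {J : Finset ι} {g : ι → ℂ → ℂ}
    (hg : ∀ i ∈ J, s.LamIntegrable (g i)) : s.LamIntegrable fun ζ => ∑ i ∈ J, g i ζ := by
  have := CircleIntegrable.fun_sum J hg
  refine IntervalIntegrable.congr (fun θ _ => ?_) this
  simp only [Finset.mul_sum]

theorem Lam_add {g h : ℂ → ℂ} (hg : s.LamIntegrable g) (hh : s.LamIntegrable h) :
    s.Lam (fun ζ => g ζ + h ζ) = s.Lam g + s.Lam h := by
  simp only [Lam, mul_add]
  rw [circleIntegral.integral_add hg hh, mul_add]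

theorem Lam_const_mul (c : ℂ) (g : ℂ → ℂ) : s.Lam (fun ζ => c * g ζ) = c * s.Lam g := by
  have : ∀ ζ, s.w ζ * (c * g ζ) = c * (s.w ζ * g ζ) := fun ζ => mul_left_comm _ _ _
  simp only [Lam, this, circleIntegral.integral_const_mul]
  ring

theorem Lam_sum {ι : Type*} {J : Finset ι} {g : ι → ℂ → ℂ}
    (hg : ∀ i ∈ J, s.LamIntegrable (g i)) :
    s.Lam (fun ζ => ∑ i ∈ J, g i ζ) = ∑ i ∈ J, s.Lam (g i) := by
  simp only [Lam, Finset.mul_sum]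
  rw [circleIntegral.integral_fun_sum hg, Finset.mul_sum]

theorem Lam_sub {g h : ℂ → ℂ} (hg : s.LamIntegrable g) (hh : s.LamIntegrable h) :
    s.Lam (fun ζ => g ζ - h ζ) = s.Lam g - s.Lam h := by
  simp only [Lam, mul_sub]
  rw [circleIntegral.integral_sub hg hh, mul_sub]

theorem Lam_div_eq_cauchy (g : ℂ → ℂ) (x : ℂ) :
    s.Lam (fun ζ => g ζ / (ζ - x)) = cauchy (fun ζ => s.w ζ * g ζ) x := by
  simp only [Lam, cauchy, div_eq_mul_inv, mul_assoc]

theorem Lam_div_sq_eq_cauchyDeriv (g : ℂ → ℂ) (x : ℂ) :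
    s.Lam (fun ζ => g ζ / (ζ - x) ^ 2) = cauchyDeriv (fun ζ => s.w ζ * g ζ) x := by
  simp only [Lam, cauchyDeriv, div_eq_mul_inv, mul_assoc]

theorem IsRegular.lamIntegrable (hs : s.IsRegular) {g : ℂ → ℂ}
    (hg : ContinuousOn g (Metric.sphere 0 1)) : s.LamIntegrable g := hs.circleIntegrable_mul hg

theorem IsRegular.lamIntegrable_div (hs : s.IsRegular) {g : ℂ → ℂ}
    (hg : ContinuousOn g (Metric.sphere 0 1)) (j : Fin (m + 1)) :
    s.LamIntegrable fun ζ => g ζ / (ζ - s.z j) := hs.circleIntegrable_mul_div hg j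

variable (s) in
/-- The points at which the Cauchy integrals with respect to the weight converge. -/
def IsGood (x : ℂ) : Prop := ‖x‖ ≠ 1 ∨ ∃ j, x = s.z j

theorem IsGood.ne {x : ℂ} (hx : s.IsGood x) {ζ : ℂ} (hζ : ‖ζ‖ = 1) (hn : ∀ j, ζ ≠ s.z j) :
    ζ - x ≠ 0 := by
  rcases hx with hx | ⟨j, rfl⟩
  · exact sub_ne_zero_of_norm hζ hx
  · exact sub_ne_zero.2 (hn j)

theorem IsGood.of_z (j : Fin (m + 1)) : s.IsGood (s.z j) := Or.inr ⟨j, rfl⟩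

theorem continuousOn_inv_sub {x : ℂ} (hx : ‖x‖ ≠ 1) :
    ContinuousOn (fun ζ => (ζ - x)⁻¹) (Metric.sphere 0 1) :=
  ContinuousOn.inv₀ (by fun_prop) fun _ hζ => sub_ne_zero_of_norm (by simpa using hζ) hx

theorem analyticOnNhd_inv_sub {x : ℂ} (hx : ‖x‖ ≠ 1) :
    AnalyticOnNhd ℂ (fun ζ => (ζ - x)⁻¹) (Metric.sphere 0 1) := fun _ hζ =>
  (analyticAt_id.sub analyticAt_const).inv (sub_ne_zero_of_norm (by simpa using hζ) hx)

theorem IsRegular.lamIntegrable_div_sub (hs : s.IsRegular) {g : ℂ → ℂ}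
    (hg : ContinuousOn g (Metric.sphere 0 1)) {x : ℂ} (hx : s.IsGood x) :
    s.LamIntegrable fun ζ => g ζ / (ζ - x) := by
  rcases hx with hx | ⟨j, rfl⟩
  · exact hs.lamIntegrable (hg.div (by fun_prop) fun _ hζ =>
      sub_ne_zero_of_norm (by simpa using hζ) hx)
  · exact hs.lamIntegrable_div hg j

variable (s) in
/-- The Cauchy transform of the weight. -/
def G (x : ℂ) : ℂ := s.Lam fun ζ => 1 / (ζ - x)

theorem Lam_pow_sub_div (hs : s.IsRegular) {x : ℂ} (hx : s.IsGood x) (k : ℕ) :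
    s.Lam (fun ζ => ζ ^ k / (ζ - x)) = x ^ k * s.G x +
      ∑ i ∈ Finset.range k, s.Lam (fun ζ => ζ ^ (k - 1 - i)) * x ^ i := by
  have h1 : s.Lam (fun ζ => ζ ^ k / (ζ - x)) = s.Lam (fun ζ => x ^ k * (1 / (ζ - x)) +
      ∑ i ∈ Finset.range k, x ^ i * ζ ^ (k - 1 - i)) := by
    refine Lam_congr fun ζ hζ hn => ?_
    have hne := hx.ne hζ hn
    have := geom_sum₂_mul x ζ k
    rw [div_eq_iff hne, add_mul]
    field_simp
    linear_combination this
  have hint : ∀ i ∈ Finset.range k, s.LamIntegrable fun ζ => x ^ i * ζ ^ (k - 1 - i) :=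
    fun i _ => hs.lamIntegrable (by fun_prop)
  rw [h1, Lam_add ((hs.lamIntegrable_div_sub continuousOn_const hx).const_mul _)
    (LamIntegrable.sum hint), Lam_sum hint, Lam_const_mul, G]
  congr 1
  exact Finset.sum_congr rfl fun i _ => by rw [Lam_const_mul, mul_comm]

variable (s) in
/-- The polynomial `∮ w(ζ) (f(ζ) - f(x)) / (ζ - x) dζ / (2πi)` in `x`. -/
def secondKind (f : ℂ[X]) : ℂ[X] := f.sum fun k c =>
  ∑ i ∈ Finset.range k, C (c * s.Lam fun ζ => ζ ^ (k - 1 - i)) * X ^ i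

theorem IsRegular.Lam_eval_div (hs : s.IsRegular) (f : ℂ[X]) {x : ℂ} (hx : s.IsGood x) :
    s.Lam (fun ζ => f.eval ζ / (ζ - x)) = f.eval x * s.G x + (s.secondKind f).eval x := by
  have h1 : (fun ζ => f.eval ζ / (ζ - x)) =
      fun ζ => ∑ k ∈ f.support, f.coeff k * (ζ ^ k / (ζ - x)) := by
    ext ζ
    rw [eval_eq_sum, Polynomial.sum, Finset.sum_div]
    exact Finset.sum_congr rfl fun k _ => by ring
  rw [h1, Lam_sum fun k _ => (hs.lamIntegrable_div_sub (by fun_prop) hx).const_mul _]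
  simp only [Lam_const_mul, Lam_pow_sub_div hs hx, mul_add, Finset.sum_add_distrib]
  congr 1
  · rw [eval_eq_sum, Polynomial.sum, Finset.sum_mul]
    exact Finset.sum_congr rfl fun k _ => by ring
  · rw [secondKind, Polynomial.sum, eval_finsetSum]
    refine Finset.sum_congr rfl fun k _ => ?_
    rw [eval_finsetSum, Finset.mul_sum]
    refine Finset.sum_congr rfl fun i _ => ?_
    simp only [eval_mul, eval_C, eval_pow, eval_X]; ring

theorem IsRegular.Lam_inv_sub_div (hs : s.IsRegular) {x : ℂ} (hx : ‖x‖ ≠ 1) {j : Fin (m + 1)}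
    (hj : x ≠ s.z j) :
    s.Lam (fun ζ => (ζ - x)⁻¹ / (ζ - s.z j)) = (s.G x - s.G (s.z j)) / (x - s.z j) := by
  have h1 : s.Lam (fun ζ => (ζ - x)⁻¹ / (ζ - s.z j)) =
      s.Lam (fun ζ => (x - s.z j)⁻¹ * (1 / (ζ - x) - 1 / (ζ - s.z j))) := by
    refine Lam_congr fun ζ hζ hn => ?_
    have h2 := sub_ne_zero_of_norm hζ hx
    have h3 := sub_ne_zero.2 (hn j)
    have h4 := sub_ne_zero.2 hj
    field_simp
    ring
  rw [h1, Lam_const_mul, Lam_sub (hs.lamIntegrable_div_sub continuousOn_const (Or.inl hx))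
    (hs.lamIntegrable_div continuousOn_const j), G, G, div_eq_inv_mul]

theorem G_eq_cauchy (x : ℂ) : s.G x = cauchy s.w x := by
  rw [G, Lam_div_eq_cauchy fun _ => 1]; simp

theorem IsRegular.hasDerivAt_G (hs : s.IsRegular) {x : ℂ} (hx : ‖x‖ ≠ 1) :
    HasDerivAt s.G (∑ j, ρ j * s.Lam fun ζ => (ζ - x)⁻¹ / (ζ - s.z j)) x := by
  have h1 := hasDerivAt_cauchy hs.circleIntegrable_weight hx
  rw [← funext fun x => G_eq_cauchy (s := s) x] at h1
  refine h1.congr_deriv ?_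
  have h2 := hs.Lam_deriv (analyticOnNhd_inv_sub hx)
  have h3 : s.Lam (deriv fun ζ => (ζ - x)⁻¹) = s.Lam fun ζ => -1 * (1 / (ζ - x) ^ 2) := by
    refine Lam_congr fun ζ hζ _ => ?_
    have := ((hasDerivAt_id ζ).sub_const x).inv (sub_ne_zero_of_norm hζ hx)
    refine (show HasDerivAt (fun ζ => (ζ - x)⁻¹) _ ζ from this).deriv.trans ?_
    simp only [id]; ring
  rw [h3, Lam_const_mul, Lam_div_sq_eq_cauchyDeriv fun _ => 1] at h2
  simp only [mul_one] at h2
  linear_combination -h2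

end System

end BOPUC

end

noncomputable section

open Polynomial Filter Set MeasureTheory
open scoped Topology Interval

namespace BOPUC

theorem natDegree_le_of_degree_lt_succ {g : ℂ[X]} {d : ℕ} (h : g.degree < (d + 1 : ℕ)) :
    g.natDegree ≤ d :=
  natDegree_le_iff_coeff_eq_zero.2 fun _ hk => (degree_lt_iff_coeff_zero _ _).1 h _ hk

theorem degree_sub_C_mul_lt {g e : ℂ[X]} {d : ℕ} (hg : g.natDegree ≤ d) (he : e.natDegree ≤ d)
    (h : e.coeff d ≠ 0) : (g - C (g.coeff d / e.coeff d) * e).degree < d := by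
  rw [degree_lt_iff_coeff_zero]
  intro k hk
  rcases hk.eq_or_lt with rfl | hk
  · simp [h]
  · rw [coeff_sub, coeff_C_mul, coeff_eq_zero_of_natDegree_lt (hg.trans_lt hk),
      coeff_eq_zero_of_natDegree_lt (he.trans_lt hk), mul_zero, sub_zero]

theorem eq_zero_of_degree_lt {F : ℂ[X] →ₗ[ℂ] ℂ} {e : ℕ → ℂ[X]} {N : ℕ}
    (he : ∀ k < N, (e k).natDegree ≤ k) (hc : ∀ k < N, (e k).coeff k ≠ 0)
    (hF : ∀ k < N, F (e k) = 0) {g : ℂ[X]} (hg : g.degree < N) : F g = 0 := by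
  induction N generalizing g with
  | zero =>
    have : g = 0 := by
      rw [← degree_eq_bot]; exact Nat.WithBot.lt_zero_iff.1 (by simpa using hg)
    rw [this, map_zero]
  | succ N ih =>
    have h1 := ih (fun k hk => he k (hk.trans N.lt_succ_self))
      (fun k hk => hc k (hk.trans N.lt_succ_self)) (fun k hk => hF k (hk.trans N.lt_succ_self))
      (degree_sub_C_mul_lt (natDegree_le_of_degree_lt_succ hg)
        (he N N.lt_succ_self) (hc N N.lt_succ_self))
    rwa [map_sub, ← smul_eq_C_mul, map_smul, hF N N.lt_succ_self, smul_zero, sub_zero] at h1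

theorem apply_eq_coeff_div {F : ℂ[X] →ₗ[ℂ] ℂ} {e : ℕ → ℂ[X]} {N : ℕ}
    (he : ∀ k ≤ N, (e k).natDegree ≤ k) (hc : ∀ k ≤ N, (e k).coeff k ≠ 0)
    (hF : ∀ k < N, F (e k) = 0) (hN : F (e N) = 1) {g : ℂ[X]} (hg : g.natDegree ≤ N) :
    F g = g.coeff N / (e N).coeff N := by
  have h1 := eq_zero_of_degree_lt (F := F) (fun k hk => he k hk.le) (fun k hk => hc k hk.le) hF
    (degree_sub_C_mul_lt hg (he N le_rfl) (hc N le_rfl))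
  rwa [map_sub, ← smul_eq_C_mul, map_smul, hN, smul_eq_mul, mul_one, sub_eq_zero] at h1

namespace System

variable {m : ℕ} {ρ : Fin (m + 1) → ℂ} {s : System m ρ}

theorem sphere_ne_zero {ζ : ℂ} (hζ : ‖ζ‖ = 1) : ζ ≠ 0 := by
  rintro rfl; simp at hζ

theorem continuousOn_inv_sphere : ContinuousOn (fun ζ : ℂ => ζ⁻¹) (Metric.sphere 0 1) :=
  continuousOn_inv₀.mono fun _ hζ => sphere_ne_zero (by simpa using hζ)

theorem continuousOn_div_pow (f : ℂ[X]) (k : ℕ) :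
    ContinuousOn (fun ζ : ℂ => f.eval ζ / ζ ^ k) (Metric.sphere 0 1) :=
  f.continuousOn.div (by fun_prop) fun _ hζ =>
    pow_ne_zero _ (sphere_ne_zero (by simpa using hζ))

theorem continuousOn_pairing (f g : ℂ[X]) :
    ContinuousOn (fun ζ : ℂ => f.eval ζ * g.eval ζ⁻¹ / ζ) (Metric.sphere 0 1) := by
  refine ContinuousOn.div (f.continuousOn.mul ?_) continuousOn_id fun _ hζ =>
    sphere_ne_zero (by simpa using hζ)
  exact g.continuous.comp_continuousOn continuousOn_inv_sphere

/-- The bilinear form `⟨f, g⟩ = ∮ w(ζ) f(ζ) g(1/ζ) dζ / (2πiζ)`. -/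
def IsRegular.pairing (hs : s.IsRegular) : ℂ[X] →ₗ[ℂ] ℂ[X] →ₗ[ℂ] ℂ :=
  LinearMap.mk₂ ℂ (fun f g => s.Lam fun ζ => f.eval ζ * g.eval ζ⁻¹ / ζ)
    (fun f₁ f₂ g => by
      rw [← Lam_add (hs.lamIntegrable (continuousOn_pairing _ _))
        (hs.lamIntegrable (continuousOn_pairing _ _))]
      congr 1; ext ζ; rw [eval_add]; ring)
    (fun c f g => by
      rw [smul_eq_mul, ← Lam_const_mul]
      congr 1; ext ζ; rw [eval_smul, smul_eq_mul]; ring)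
    (fun f g₁ g₂ => by
      rw [← Lam_add (hs.lamIntegrable (continuousOn_pairing _ _))
        (hs.lamIntegrable (continuousOn_pairing _ _))]
      congr 1; ext ζ; rw [eval_add]; ring)
    (fun c f g => by
      rw [smul_eq_mul, ← Lam_const_mul]
      congr 1; ext ζ; rw [eval_smul, smul_eq_mul]; ring)

theorem IsRegular.pairing_apply (hs : s.IsRegular) (f g : ℂ[X]) :
    hs.pairing f g = s.Lam fun ζ => f.eval ζ * g.eval ζ⁻¹ / ζ := rfl

theorem IsRegular.pairing_X_pow (hs : s.IsRegular) (f : ℂ[X]) (k : ℕ) :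
    hs.pairing f (X ^ k) = s.Lam fun ζ => f.eval ζ / ζ ^ (k + 1) := by
  rw [hs.pairing_apply]
  congr 1; ext ζ
  rw [eval_pow, eval_X, inv_pow, pow_succ, div_mul_eq_div_div, div_eq_mul_inv (f.eval ζ)]

/-- The value of the mean over the circle in terms of the functional `Lam`. -/
theorem circleMean_eq_Lam {f g : ℂ → ℂ}
    (h : ∀ ζ, ‖ζ‖ = 1 → (∀ j, ζ ≠ s.z j) → f ζ / ζ = s.w ζ * g ζ) :
    circleMean f = s.Lam g := by
  rw [circleMean, Lam, circleIntegral, circleIntegral]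
  congr 1
  refine intervalIntegral.integral_congr_ae ?_
  filter_upwards [s.ae_circleMap_ne] with θ hθ _
  rw [h _ (by simp) hθ]

theorem conj_eq_inv {ζ : ℂ} (hζ : ‖ζ‖ = 1) : (starRingEnd ℂ) ζ = ζ⁻¹ :=
  (Complex.inv_eq_conj hζ).symm

namespace IsBiorthonormal

variable {N : ℕ}

theorem pairing_eq (hb : s.IsBiorthonormal N) (hs : s.IsRegular) {i j : ℕ} (hi : i ≤ N)
    (hj : j ≤ N) : hs.pairing (s.phi i) (s.phiBar j) = if i = j then 1 else 0 := by
  rw [← hb.orthonormal i hi j hj, hs.pairing_apply]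
  refine (circleMean_eq_Lam fun ζ hζ _ => ?_).symm
  rw [conj_eq_inv hζ]; ring

theorem kappa_ne_zero (hb : s.IsBiorthonormal N) (hs : s.IsRegular) {k : ℕ} (hk : k ≤ N) :
    s.kappa k ≠ 0 := by
  intro h
  have h1 : s.phi k = 0 := by
    rw [← leadingCoeff_eq_zero, leadingCoeff, hb.natDegree_phi k hk]; exact h
  have h2 := hb.pairing_eq hs hk hk
  rw [h1, map_zero, LinearMap.zero_apply, if_pos rfl] at h2
  exact zero_ne_one h2

theorem coeff_phiBar (hb : s.IsBiorthonormal N) {k : ℕ} (hk : k ≤ N) :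
    (s.phiBar k).coeff k = s.kappa k := hb.leading k hk

theorem pairing_phi (hb : s.IsBiorthonormal N) (hs : s.IsRegular) {k : ℕ} (hk : k ≤ N)
    {g : ℂ[X]} (hg : g.natDegree ≤ k) : hs.pairing (s.phi k) g = g.coeff k / s.kappa k := by
  rw [← hb.coeff_phiBar hk]
  refine apply_eq_coeff_div (fun j hj => (hb.natDegree_phiBar j (hj.trans hk)).le)
    (fun j hj => ?_) (fun j hj => ?_) ?_ hg
  · rw [hb.coeff_phiBar (hj.trans hk)]; exact hb.kappa_ne_zero hs (hj.trans hk)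
  · rw [hb.pairing_eq hs hk (hj.le.trans hk), if_neg hj.ne']
  · rw [hb.pairing_eq hs hk hk, if_pos rfl]

theorem pairing_phiBar (hb : s.IsBiorthonormal N) (hs : s.IsRegular) {k : ℕ} (hk : k ≤ N)
    {g : ℂ[X]} (hg : g.natDegree ≤ k) : hs.pairing g (s.phiBar k) = g.coeff k / s.kappa k := by
  refine apply_eq_coeff_div (F := hs.pairing.flip (s.phiBar k)) (e := s.phi)
    (fun j hj => (hb.natDegree_phi j (hj.trans hk)).le) (fun j hj => ?_) (fun j hj => ?_) ?_ hg
  · exact hb.kappa_ne_zero hs (hj.trans hk)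
  · rw [LinearMap.flip_apply, hb.pairing_eq hs (hj.le.trans hk) hk, if_neg hj.ne]
  · rw [LinearMap.flip_apply, hb.pairing_eq hs hk hk, if_pos rfl]

theorem Lam_phi_div_pow (hb : s.IsBiorthonormal N) (hs : s.IsRegular) {k j : ℕ} (hk : k ≤ N)
    (hj : j ≤ k) :
    s.Lam (fun ζ => (s.phi k).eval ζ / ζ ^ (j + 1)) = if j = k then 1 / s.kappa k else 0 := by
  rw [← hs.pairing_X_pow, hb.pairing_phi hs hk (by simpa using hj), coeff_X_pow]
  by_cases h : j = k
  · simp [h]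
  · simp [h, Ne.symm h]

theorem eval_phiStar (hb : s.IsBiorthonormal N) {k : ℕ} (hk : k ≤ N) {ζ : ℂ} (hζ : ζ ≠ 0) :
    (s.phiStar k).eval ζ = ζ ^ k * (s.phiBar k).eval ζ⁻¹ := by
  let _ : Invertible ζ⁻¹ := invertibleOfNonzero (inv_ne_zero hζ)
  have h1 := eval₂_reflect_mul_pow (RingHom.id ℂ) ζ⁻¹ k (s.phiBar k) (hb.natDegree_phiBar k hk).le
  rw [invOf_eq_inv, inv_inv] at h1
  rw [phiStar, eval, eval, ← h1, mul_left_comm, ← mul_pow, mul_inv_cancel₀ hζ, one_pow, mul_one]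

theorem natDegree_phiStar_le (hb : s.IsBiorthonormal N) {k : ℕ} (hk : k ≤ N) :
    (s.phiStar k).natDegree ≤ k :=
  (natDegree_reflect_le).trans (by rw [hb.natDegree_phiBar k hk, max_self])

theorem coeff_phiStar_zero (hb : s.IsBiorthonormal N) {k : ℕ} (hk : k ≤ N) :
    (s.phiStar k).coeff 0 = s.kappa k := by
  rw [phiStar, coeff_reflect, revAt_le (Nat.zero_le k), Nat.sub_zero, hb.coeff_phiBar hk]

theorem coeff_phiStar (k : ℕ) : (s.phiStar k).coeff k = s.phiBar0 k := by
  rw [phiStar, coeff_reflect, revAt_le le_rfl, Nat.sub_self, coeff_zero_eq_eval_zero, phiBar0]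

theorem Lam_phiStar_div_pow (hb : s.IsBiorthonormal N) (hs : s.IsRegular) {k j : ℕ} (hk : k ≤ N)
    (hj : j ≤ k) :
    s.Lam (fun ζ => (s.phiStar k).eval ζ / ζ ^ (j + 1)) = if j = 0 then 1 / s.kappa k else 0 := by
  have h1 := hb.pairing_phiBar hs hk (g := X ^ (k - j)) (by simp)
  rw [coeff_X_pow, hs.pairing_apply] at h1
  have h2 : s.Lam (fun ζ => (s.phiStar k).eval ζ / ζ ^ (j + 1)) =
      s.Lam fun ζ => (X ^ (k - j) : ℂ[X]).eval ζ * (s.phiBar k).eval ζ⁻¹ / ζ := by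
    refine Lam_congr fun ζ hζ _ => ?_
    have h0 := sphere_ne_zero hζ
    rw [hb.eval_phiStar hk h0, eval_pow, eval_X, pow_succ]
    obtain ⟨i, rfl⟩ := Nat.exists_eq_add_of_le hj
    rw [Nat.add_sub_cancel_left, pow_add]
    field_simp
  rw [h2, h1]
  by_cases h : j = 0
  · subst h; simp
  · rw [if_neg h, if_neg (by omega), zero_div]

theorem eq_zero_of_pairing (hb : s.IsBiorthonormal N) (hs : s.IsRegular) {k : ℕ} (hk : k ≤ N)
    {q : ℂ[X]} (hq : q.degree < (k + 1 : ℕ)) (h : ∀ j ≤ k, hs.pairing q (X ^ j) = 0) : q = 0 := by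
  have h1 : ∀ l ≤ k, hs.pairing q (s.phiBar l) = 0 := by
    intro l hl
    refine eq_zero_of_degree_lt (F := hs.pairing q) (e := fun j => X ^ j) (N := k + 1)
      (fun j _ => by simp) (fun j _ => by simp) (fun j hj => h j (Nat.lt_succ_iff.1 hj)) ?_
    refine lt_of_le_of_lt degree_le_natDegree ?_
    rw [hb.natDegree_phiBar l (hl.trans hk)]
    exact_mod_cast Nat.lt_succ_of_le hl
  have h2 : ∀ d, d ≤ k + 1 → q.degree < (d : ℕ) → q = 0 := by
    intro d
    induction d with
    | zero =>
      intro _ hd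
      rw [← degree_eq_bot]; exact Nat.WithBot.lt_zero_iff.1 (by simpa using hd)
    | succ d ih =>
      intro hd hq
      refine ih (Nat.le_of_succ_le hd) ?_
      have hdk : d ≤ k := Nat.le_of_succ_le_succ hd
      have hnd : q.natDegree ≤ d := natDegree_le_of_degree_lt_succ hq
      have h3 := hb.pairing_phiBar hs (hdk.trans hk) hnd
      rw [h1 d hdk, eq_comm, div_eq_zero_iff, or_iff_left (hb.kappa_ne_zero hs (hdk.trans hk))] at h3
      rw [degree_lt_iff_coeff_zero]
      intro j hj
      rcases hj.eq_or_lt with rfl | hj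
      · exact h3
      · exact coeff_eq_zero_of_natDegree_lt (hnd.trans_lt hj)
  exact h2 (k + 1) le_rfl hq

theorem eq_zero_of_Lam (hb : s.IsBiorthonormal N) (hs : s.IsRegular) {k : ℕ} (hk : k ≤ N)
    {Q : ℂ[X]} (hQ : Q.natDegree ≤ k + 1) (h0 : Q.coeff 0 = 0) (htop : Q.coeff (k + 1) = 0)
    (h : ∀ j, 1 ≤ j → j ≤ k → s.Lam (fun ζ => Q.eval ζ / ζ ^ (j + 1)) = 0) : Q = 0 := by
  obtain ⟨q, rfl⟩ := X_dvd_iff.2 h0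
  rcases Nat.eq_zero_or_pos k with rfl | hkpos
  · have : q = 0 := by
      ext j
      rw [coeff_zero]
      rcases Nat.eq_zero_or_pos j with rfl | hj
      · simpa [coeff_X_mul] using htop
      · have := coeff_eq_zero_of_natDegree_lt (p := X * q) (n := j + 1) (by omega)
        rwa [coeff_X_mul] at this
    rw [this, mul_zero]
  · obtain ⟨k, rfl⟩ := Nat.exists_eq_succ_of_ne_zero hkpos.ne'
    rw [hb.eq_zero_of_pairing hs (k := k) (by omega) (q := q) ?_ ?_, mul_zero]
    · rw [degree_lt_iff_coeff_zero]
      intro j hj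
      rcases hj.eq_or_lt with rfl | hj
      · rwa [coeff_X_mul] at htop
      · rw [← coeff_X_mul]
        exact coeff_eq_zero_of_natDegree_lt (by omega)
    · intro j hj
      rw [hs.pairing_X_pow, ← h (j + 1) (by omega) (by omega)]
      refine Lam_congr fun ζ hζ _ => ?_
      have h0 := sphere_ne_zero hζ
      rw [eval_mul, eval_X, pow_succ _ (j + 1)]
      field_simp

theorem phi_succ (hb : s.IsBiorthonormal N) (hs : s.IsRegular) {n : ℕ} (hn : n + 1 ≤ N) :
    C (s.kappa n) * s.phi (n + 1) =
      C (s.kappa (n + 1)) * (X * s.phi n) + C (s.phi0 (n + 1)) * s.phiStar n := by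
  have hn' : n ≤ N := Nat.le_of_succ_le hn
  rw [← sub_eq_zero]
  refine hb.eq_zero_of_Lam hs hn' ?_ ?_ ?_ ?_
  · have h1 : (C (s.kappa n) * s.phi (n + 1)).natDegree ≤ n + 1 :=
      (natDegree_C_mul_le _ _).trans (hb.natDegree_phi _ hn).le
    have h2 : (C (s.kappa (n + 1)) * (X * s.phi n)).natDegree ≤ n + 1 :=
      (natDegree_C_mul_le _ _).trans (natDegree_mul_le.trans (by
        rw [natDegree_X, hb.natDegree_phi _ hn']; omega))
    have h3 : (C (s.phi0 (n + 1)) * s.phiStar n).natDegree ≤ n + 1 :=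
      (natDegree_C_mul_le _ _).trans ((hb.natDegree_phiStar_le hn').trans n.le_succ)
    exact (natDegree_sub_le_of_le h1 (natDegree_add_le_of_degree_le h2 h3)).trans (max_self _).le
  · simp only [coeff_sub, coeff_add, coeff_C_mul, coeff_X_mul_zero, mul_zero, zero_add,
      hb.coeff_phiStar_zero hn']
    rw [coeff_zero_eq_eval_zero, phi0]; ring
  · simp only [coeff_sub, coeff_add, coeff_C_mul, coeff_X_mul]
    rw [coeff_eq_zero_of_natDegree_lt ((hb.natDegree_phiStar_le hn').trans_lt n.lt_succ_self)]
    rw [kappa, kappa]; ring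
  · intro j h1j hj
    have e : (fun ζ => (C (s.kappa n) * s.phi (n + 1) - (C (s.kappa (n + 1)) * (X * s.phi n) +
        C (s.phi0 (n + 1)) * s.phiStar n)).eval ζ / ζ ^ (j + 1)) = fun ζ =>
        s.kappa n * ((s.phi (n + 1)).eval ζ / ζ ^ (j + 1)) -
          (s.kappa (n + 1) * ((X * s.phi n).eval ζ / ζ ^ (j + 1)) +
          s.phi0 (n + 1) * ((s.phiStar n).eval ζ / ζ ^ (j + 1))) := by
      ext ζ
      simp only [eval_sub, eval_add, eval_mul, eval_C, eval_X]; ring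
    have i1 := hs.lamIntegrable (continuousOn_div_pow (s.phi (n + 1)) (j + 1))
    have i2 := hs.lamIntegrable (continuousOn_div_pow (X * s.phi n) (j + 1))
    have i3 := hs.lamIntegrable (continuousOn_div_pow (s.phiStar n) (j + 1))
    rw [e, Lam_sub (i1.const_mul _) ((i2.const_mul _).add (i3.const_mul _)),
      Lam_add (i2.const_mul _) (i3.const_mul _), Lam_const_mul, Lam_const_mul, Lam_const_mul,
      hb.Lam_phi_div_pow hs hn (by omega), if_neg (by omega), hb.Lam_phiStar_div_pow hs hn' hj,
      if_neg (by omega)]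
    obtain ⟨i, rfl⟩ := Nat.exists_eq_succ_of_ne_zero (by omega : j ≠ 0)
    have e2 : s.Lam (fun ζ => (X * s.phi n).eval ζ / ζ ^ (i.succ + 1)) =
        s.Lam fun ζ => (s.phi n).eval ζ / ζ ^ (i + 1) := by
      refine Lam_congr fun ζ hζ _ => ?_
      have h0 := sphere_ne_zero hζ
      rw [eval_mul, eval_X, pow_succ _ i.succ]
      field_simp
    rw [e2, hb.Lam_phi_div_pow hs hn' (by omega), if_neg (by omega)]; ring

theorem phiStar_succ (hb : s.IsBiorthonormal N) (hs : s.IsRegular) {n : ℕ} (hn : n + 1 ≤ N) :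
    C (s.kappa n) * s.phiStar (n + 1) =
      C (s.kappa (n + 1)) * s.phiStar n + C (s.phiBar0 (n + 1)) * (X * s.phi n) := by
  have hn' : n ≤ N := Nat.le_of_succ_le hn
  rw [← sub_eq_zero]
  refine hb.eq_zero_of_Lam hs hn' ?_ ?_ ?_ ?_
  · have h1 : (C (s.kappa n) * s.phiStar (n + 1)).natDegree ≤ n + 1 :=
      (natDegree_C_mul_le _ _).trans (hb.natDegree_phiStar_le hn)
    have h2 : (C (s.phiBar0 (n + 1)) * (X * s.phi n)).natDegree ≤ n + 1 :=
      (natDegree_C_mul_le _ _).trans (natDegree_mul_le.trans (by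
        rw [natDegree_X, hb.natDegree_phi _ hn']; omega))
    have h3 : (C (s.kappa (n + 1)) * s.phiStar n).natDegree ≤ n + 1 :=
      (natDegree_C_mul_le _ _).trans ((hb.natDegree_phiStar_le hn').trans n.le_succ)
    exact (natDegree_sub_le_of_le h1 (natDegree_add_le_of_degree_le h3 h2)).trans (max_self _).le
  · simp only [coeff_sub, coeff_add, coeff_C_mul, coeff_X_mul_zero, mul_zero, add_zero,
      hb.coeff_phiStar_zero hn', hb.coeff_phiStar_zero hn]
    ring
  · simp only [coeff_sub, coeff_add, coeff_C_mul, coeff_X_mul]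
    rw [coeff_eq_zero_of_natDegree_lt ((hb.natDegree_phiStar_le hn').trans_lt n.lt_succ_self),
      coeff_phiStar, kappa, kappa]; ring
  · intro j h1j hj
    have e : (fun ζ => (C (s.kappa n) * s.phiStar (n + 1) - (C (s.kappa (n + 1)) * s.phiStar n +
        C (s.phiBar0 (n + 1)) * (X * s.phi n))).eval ζ / ζ ^ (j + 1)) = fun ζ =>
        s.kappa n * ((s.phiStar (n + 1)).eval ζ / ζ ^ (j + 1)) -
          (s.kappa (n + 1) * ((s.phiStar n).eval ζ / ζ ^ (j + 1)) +
          s.phiBar0 (n + 1) * ((X * s.phi n).eval ζ / ζ ^ (j + 1))) := by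
      ext ζ
      simp only [eval_sub, eval_add, eval_mul, eval_C, eval_X]; ring
    have i1 := hs.lamIntegrable (continuousOn_div_pow (s.phiStar (n + 1)) (j + 1))
    have i2 := hs.lamIntegrable (continuousOn_div_pow (X * s.phi n) (j + 1))
    have i3 := hs.lamIntegrable (continuousOn_div_pow (s.phiStar n) (j + 1))
    rw [e, Lam_sub (i1.const_mul _) ((i3.const_mul _).add (i2.const_mul _)),
      Lam_add (i3.const_mul _) (i2.const_mul _), Lam_const_mul, Lam_const_mul, Lam_const_mul,
      hb.Lam_phiStar_div_pow hs hn (by omega), if_neg (by omega), hb.Lam_phiStar_div_pow hs hn' hj,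
      if_neg (by omega)]
    obtain ⟨i, rfl⟩ := Nat.exists_eq_succ_of_ne_zero (by omega : j ≠ 0)
    have e2 : s.Lam (fun ζ => (X * s.phi n).eval ζ / ζ ^ (i.succ + 1)) =
        s.Lam fun ζ => (s.phi n).eval ζ / ζ ^ (i + 1) := by
      refine Lam_congr fun ζ hζ _ => ?_
      have h0 := sphere_ne_zero hζ
      rw [eval_mul, eval_X, pow_succ _ i.succ]
      field_simp
    rw [e2, hb.Lam_phi_div_pow hs hn' (by omega), if_neg (by omega)]; ring

end IsBiorthonormal

end System

end BOPUC

end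

noncomputable section

open Polynomial Filter Set MeasureTheory
open scoped Topology Interval

namespace BOPUC

namespace System

variable {m : ℕ} {ρ : Fin (m + 1) → ℂ} {s : System m ρ}

theorem continuousOn_div_pow' {g : ℂ → ℂ} (hg : ContinuousOn g (Metric.sphere 0 1)) (k : ℕ) :
    ContinuousOn (fun ζ : ℂ => g ζ / ζ ^ k) (Metric.sphere 0 1) :=
  hg.div (by fun_prop) fun _ hζ => pow_ne_zero _ (sphere_ne_zero (by simpa using hζ))

theorem IsRegular.Lam_div_sub_eq (hs : s.IsRegular) {g : ℂ → ℂ}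
    (hg : ContinuousOn g (Metric.sphere 0 1)) {x : ℂ} (hx : s.IsGood x) (k : ℕ) :
    s.Lam (fun ζ => g ζ / (ζ - x)) = x ^ k * s.Lam (fun ζ => g ζ / ζ ^ k / (ζ - x)) +
      ∑ i ∈ Finset.range k, x ^ i * s.Lam fun ζ => g ζ / ζ ^ (i + 1) := by
  induction k with
  | zero => simp
  | succ k ih =>
    have h1 : s.Lam (fun ζ => g ζ / ζ ^ k / (ζ - x)) =
        s.Lam (fun ζ => x * (g ζ / ζ ^ (k + 1) / (ζ - x)) + g ζ / ζ ^ (k + 1)) := by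
      refine Lam_congr fun ζ hζ hn => ?_
      have h2 := hx.ne hζ hn
      have h3 := sphere_ne_zero hζ
      field_simp
      ring
    rw [ih, h1, Lam_add ((hs.lamIntegrable_div_sub (continuousOn_div_pow' hg _) hx).const_mul _)
      (hs.lamIntegrable (continuousOn_div_pow' hg _)), Lam_const_mul, Finset.sum_range_succ]
    ring

/-- The Herglotz transform in terms of the Cauchy transform. -/
theorem IsRegular.circleMean_herglotz (hs : s.IsRegular) {f g : ℂ → ℂ}
    (hg : ContinuousOn g (Metric.sphere 0 1)) {x : ℂ} (hx : s.IsGood x)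
    (h : ∀ ζ, ‖ζ‖ = 1 → f ζ = (ζ + x) / (ζ - x) * s.w ζ * g ζ) :
    circleMean f = 2 * s.Lam (fun ζ => g ζ / (ζ - x)) - s.Lam fun ζ => g ζ / ζ := by
  have i1 := (hs.lamIntegrable_div_sub hg hx).const_mul 2
  have i2 : s.LamIntegrable fun ζ => g ζ / ζ := by
    simpa using hs.lamIntegrable (continuousOn_div_pow' hg 1)
  rw [← Lam_const_mul, ← Lam_sub i1 i2]
  refine circleMean_eq_Lam fun ζ hζ hn => ?_
  have h2 := hx.ne hζ hn
  have h3 := sphere_ne_zero hζ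
  rw [h ζ hζ]
  field_simp
  ring

theorem IsRegular.F_eq (hs : s.IsRegular) {x : ℂ} (hx : s.IsGood x) :
    s.F x = 2 * s.G x - s.Lam fun ζ => 1 / ζ :=
  hs.circleMean_herglotz (g := fun _ => 1) continuousOn_const hx fun ζ _ => by rw [mul_one]

variable (s) in
/-- The pair `(φ_n, φ*_n)`. -/
def pVec (n : ℕ) : Fin 2 → ℂ[X] := ![s.phi n, s.phiStar n]

variable (s) in
/-- The pair `(ε_n, -ε*_n)`. -/
def qVec (n : ℕ) : Fin 2 → ℂ → ℂ := ![s.eps n, fun x => -s.epsStar n x]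

variable (s) in
/-- The value of `(ε_n, -ε*_n)` at infinity. -/
def qInf (n : ℕ) : Fin 2 → ℂ := ![0, -(2 / s.kappa n)]

namespace IsBiorthonormal

variable {N : ℕ}

theorem natDegree_pVec_le (hb : s.IsBiorthonormal N) {n : ℕ} (hn : n ≤ N) (a : Fin 2) :
    (s.pVec n a).natDegree ≤ n := by
  fin_cases a
  · exact (hb.natDegree_phi n hn).le
  · exact hb.natDegree_phiStar_le hn

theorem Lam_phi_div (hb : s.IsBiorthonormal N) (hs : s.IsRegular) {n : ℕ} (hn : n ≤ N) :
    s.Lam (fun ζ => (s.phi n).eval ζ / ζ) = if n = 0 then 1 / s.kappa 0 else 0 := by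
  have := hb.Lam_phi_div_pow hs hn (Nat.zero_le n)
  simp only [zero_add, pow_one] at this
  rw [this]
  by_cases h : n = 0
  · subst h; simp
  · simp [h, Ne.symm h]

theorem phi_zero (hb : s.IsBiorthonormal N) : s.phi 0 = C (s.kappa 0) :=
  eq_C_of_natDegree_le_zero (hb.natDegree_phi 0 (Nat.zero_le N)).le

theorem phiStar_zero (hb : s.IsBiorthonormal N) : s.phiStar 0 = C (s.kappa 0) := by
  rw [← hb.coeff_phiStar_zero (Nat.zero_le N)]
  exact eq_C_of_natDegree_le_zero (hb.natDegree_phiStar_le (Nat.zero_le N))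

theorem Lam_one_div (hb : s.IsBiorthonormal N) (hs : s.IsRegular) :
    s.kappa 0 * s.Lam (fun ζ => 1 / ζ) = 1 / s.kappa 0 := by
  have := hb.Lam_phi_div hs (Nat.zero_le N)
  rw [hb.phi_zero, if_pos rfl] at this
  rw [← this, ← Lam_const_mul]
  simp [div_eq_mul_inv]

theorem eps_eq (hb : s.IsBiorthonormal N) (hs : s.IsRegular) {n : ℕ} (hn : n ≤ N) {x : ℂ}
    (hx : s.IsGood x) : s.eps n x = 2 * s.Lam fun ζ => (s.phi n).eval ζ / (ζ - x) := by
  rw [eps, psi, hs.F_eq hx]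
  split_ifs with h
  · subst h
    simp only [hb.phi_zero, eval_C]
    have h1 : s.Lam (fun ζ => s.kappa 0 / (ζ - x)) = s.kappa 0 * s.G x := by
      rw [G, ← Lam_const_mul]; simp [div_eq_mul_inv]
    rw [h1]
    linear_combination -hb.Lam_one_div hs
  · have h0 := hb.Lam_phi_div hs hn
    rw [if_neg h] at h0
    have hc : ContinuousOn (fun ζ => (s.phi n).eval ζ) (Metric.sphere 0 1) := (s.phi n).continuousOn
    rw [hs.circleMean_herglotz (g := fun ζ => (s.phi n).eval ζ - (s.phi n).eval x) (by fun_prop) hx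
      fun ζ _ => rfl]
    have e1 : (fun ζ => ((s.phi n).eval ζ - (s.phi n).eval x) / (ζ - x)) =
        fun ζ => (s.phi n).eval ζ / (ζ - x) - (s.phi n).eval x * (1 / (ζ - x)) := by ext ζ; ring
    have e2 : (fun ζ => ((s.phi n).eval ζ - (s.phi n).eval x) / ζ) =
        fun ζ => (s.phi n).eval ζ / ζ - (s.phi n).eval x * (1 / ζ) := by ext ζ; ring
    have i1 := hs.lamIntegrable_div_sub hc hx
    have i2 := (hs.lamIntegrable_div_sub (g := fun _ => 1) continuousOn_const hx).const_mul
      ((s.phi n).eval x)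
    have i3 : s.LamIntegrable fun ζ => (s.phi n).eval ζ / ζ := by
      simpa using hs.lamIntegrable (continuousOn_div_pow (s.phi n) 1)
    have i4 : s.LamIntegrable fun ζ => (s.phi n).eval x * (1 / ζ) := by
      simpa using (hs.lamIntegrable (continuousOn_div_pow 1 1)).const_mul ((s.phi n).eval x)
    rw [e1, e2, Lam_sub i1 i2, Lam_sub i3 i4, Lam_const_mul, Lam_const_mul, h0, G]
    ring

theorem epsStar_eq (hb : s.IsBiorthonormal N) (hs : s.IsRegular) {n : ℕ} (hn : n ≤ N) {x : ℂ}
    (hx : s.IsGood x) :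
    s.epsStar n x = 2 / s.kappa n - 2 * s.Lam fun ζ => (s.phiStar n).eval ζ / (ζ - x) := by
  rw [epsStar, psiStar, hs.F_eq hx]
  split_ifs with h
  · subst h
    simp only [hb.phiStar_zero, eval_C]
    have h1 : s.Lam (fun ζ => s.kappa 0 / (ζ - x)) = s.kappa 0 * s.G x := by
      rw [G, ← Lam_const_mul]; simp [div_eq_mul_inv]
    rw [h1]
    linear_combination hb.Lam_one_div hs
  · have hc : ContinuousOn (fun ζ => (s.phiStar n).eval ζ) (Metric.sphere 0 1) :=
      (s.phiStar n).continuousOn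
    have hc' := continuousOn_div_pow (s.phiStar n) n
    have h0 := hb.Lam_phiStar_div_pow hs hn le_rfl
    rw [if_neg h] at h0
    have h1 := hs.Lam_div_sub_eq hc hx n
    have h2 : ∑ i ∈ Finset.range n, x ^ i * s.Lam (fun ζ => (s.phiStar n).eval ζ / ζ ^ (i + 1)) =
        1 / s.kappa n := by
      rw [Finset.sum_eq_single 0]
      · rw [hb.Lam_phiStar_div_pow hs hn (Nat.zero_le _), if_pos rfl, pow_zero, one_mul]
      · intro i hi hi0
        rw [hb.Lam_phiStar_div_pow hs hn (Finset.mem_range.1 hi).le, if_neg hi0, mul_zero]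
      · intro h'; exact absurd (Finset.mem_range.2 (Nat.pos_of_ne_zero h)) h'
    rw [h2] at h1
    rw [hs.circleMean_herglotz (g := fun ζ => x ^ n * ((s.phiStar n).eval ζ / ζ ^ n) -
        (s.phiStar n).eval x) (by fun_prop) hx fun ζ hζ => by
          rw [conj_eq_inv hζ, hb.eval_phiStar hn (sphere_ne_zero hζ),
            mul_div_cancel_left₀ _ (pow_ne_zero _ (sphere_ne_zero hζ))] ]
    have e1 : (fun ζ => (x ^ n * ((s.phiStar n).eval ζ / ζ ^ n) - (s.phiStar n).eval x) / (ζ - x)) =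
        fun ζ => x ^ n * ((s.phiStar n).eval ζ / ζ ^ n / (ζ - x)) -
          (s.phiStar n).eval x * (1 / (ζ - x)) := by ext ζ; ring
    have e2 : (fun ζ => (x ^ n * ((s.phiStar n).eval ζ / ζ ^ n) - (s.phiStar n).eval x) / ζ) =
        fun ζ => x ^ n * ((s.phiStar n).eval ζ / ζ ^ (n + 1)) -
          (s.phiStar n).eval x * (1 / ζ) := by ext ζ; rw [pow_succ]; ring
    have i1 := (hs.lamIntegrable_div_sub hc' hx).const_mul (x ^ n)
    have i2 := (hs.lamIntegrable_div_sub (g := fun _ => 1) continuousOn_const hx).const_mul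
      ((s.phiStar n).eval x)
    have i3 := (hs.lamIntegrable (continuousOn_div_pow (s.phiStar n) (n + 1))).const_mul (x ^ n)
    have i4 : s.LamIntegrable fun ζ => (s.phiStar n).eval x * (1 / ζ) := by
      simpa using (hs.lamIntegrable (continuousOn_div_pow 1 1)).const_mul ((s.phiStar n).eval x)
    rw [e1, e2, Lam_sub i1 i2, Lam_sub i3 i4, Lam_const_mul, Lam_const_mul, Lam_const_mul,
      Lam_const_mul, h0, G]
    linear_combination 2 * h1

theorem qVec_eq (hb : s.IsBiorthonormal N) (hs : s.IsRegular) {n : ℕ} (hn : n ≤ N) {x : ℂ}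
    (hx : s.IsGood x) (a : Fin 2) :
    s.qVec n a x = 2 * s.Lam (fun ζ => (s.pVec n a).eval ζ / (ζ - x)) + s.qInf n a := by
  fin_cases a
  · simpa [qVec, pVec, qInf] using hb.eps_eq hs hn hx
  · simp [qVec, pVec, qInf, hb.epsStar_eq hs hn hx]; ring

theorem qVec_eq_pow (hb : s.IsBiorthonormal N) (hs : s.IsRegular) {n : ℕ} (hn : n ≤ N) {x : ℂ}
    (hx : s.IsGood x) (a : Fin 2) :
    s.qVec n a x = 2 * (x ^ (n + (a : ℕ)) *
      s.Lam fun ζ => (s.pVec n a).eval ζ / ζ ^ (n + (a : ℕ)) / (ζ - x)) := by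
  rw [hb.qVec_eq hs hn hx, hs.Lam_div_sub_eq (s.pVec n a).continuousOn hx (n + (a : ℕ))]
  fin_cases a
  · simp only [pVec, qInf, Fin.zero_eta, Fin.isValue, Matrix.cons_val_zero, add_zero]
    rw [Finset.sum_eq_zero, add_zero]
    intro i hi
    rw [hb.Lam_phi_div_pow hs hn (Finset.mem_range.1 hi).le, if_neg (Finset.mem_range.1 hi).ne,
      mul_zero]
  · simp only [pVec, qInf, Fin.mk_one, Fin.isValue, Matrix.cons_val_one, Matrix.cons_val_zero]
    rw [Finset.sum_eq_single 0]
    · rw [hb.Lam_phiStar_div_pow hs hn (Nat.zero_le _), if_pos rfl]; ring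
    · intro i hi hi0
      rw [hb.Lam_phiStar_div_pow hs hn (Nat.lt_succ_iff.1 (Finset.mem_range.1 hi)), if_neg hi0,
        mul_zero]
    · intro h'; exact absurd (Finset.mem_range.2 n.succ_pos) h'

/-- The polynomials `α_a` in `q_a = 2 (p_a G + α_a)`. -/
def _root_.BOPUC.System.alpha (s : System m ρ) (n : ℕ) (a : Fin 2) : ℂ[X] :=
  s.secondKind (s.pVec n a) + C (s.qInf n a / 2)

theorem qVec_eq_alpha (hb : s.IsBiorthonormal N) (hs : s.IsRegular) {n : ℕ} (hn : n ≤ N) {x : ℂ}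
    (hx : s.IsGood x) (a : Fin 2) :
    s.qVec n a x = 2 * ((s.pVec n a).eval x * s.G x + (s.alpha n a).eval x) := by
  rw [hb.qVec_eq hs hn hx, hs.Lam_eval_div _ hx, alpha, eval_add, eval_C]
  ring

theorem Lam_X_mul_div (hs : s.IsRegular) (f : ℂ[X]) {x : ℂ} (hx : s.IsGood x) :
    s.Lam (fun ζ => (X * f).eval ζ / (ζ - x)) =
      x * s.Lam (fun ζ => f.eval ζ / (ζ - x)) + s.Lam fun ζ => f.eval ζ := by
  rw [← Lam_const_mul, ← Lam_add ((hs.lamIntegrable_div_sub f.continuousOn hx).const_mul x)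
    (hs.lamIntegrable f.continuousOn)]
  refine Lam_congr fun ζ hζ hn => ?_
  have h2 := hx.ne hζ hn
  rw [eval_mul, eval_X]
  field_simp
  ring

theorem Lam_linear_div (hs : s.IsRegular) (a b : ℂ) (f g : ℂ[X]) {x : ℂ} (hx : s.IsGood x) :
    s.Lam (fun ζ => (C a * f + C b * g).eval ζ / (ζ - x)) =
      a * s.Lam (fun ζ => f.eval ζ / (ζ - x)) + b * s.Lam fun ζ => g.eval ζ / (ζ - x) := by
  rw [← Lam_const_mul, ← Lam_const_mul,
    ← Lam_add ((hs.lamIntegrable_div_sub f.continuousOn hx).const_mul a)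
    ((hs.lamIntegrable_div_sub g.continuousOn hx).const_mul b)]
  congr 1; ext ζ
  simp only [eval_add, eval_mul, eval_C]; ring

theorem isGood_zero : s.IsGood 0 := Or.inl (by simp)

theorem Lam_X_mul_div_zero (f : ℂ[X]) :
    s.Lam (fun ζ => (X * f).eval ζ / (ζ - 0)) = s.Lam fun ζ => f.eval ζ := by
  refine Lam_congr fun ζ hζ _ => ?_
  rw [eval_mul, eval_X, sub_zero, mul_div_cancel_left₀ _ (sphere_ne_zero hζ)]

theorem eps_succ (hb : s.IsBiorthonormal N) (hs : s.IsRegular) {n : ℕ} (hn : n + 1 ≤ N) {x : ℂ}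
    (hx : s.IsGood x) :
    s.kappa n * s.eps (n + 1) x = s.kappa (n + 1) * (x * s.eps n x) -
      s.phi0 (n + 1) * s.epsStar n x := by
  have hn' : n ≤ N := Nat.le_of_succ_le hn
  have key : ∀ y, s.IsGood y → s.kappa n * s.Lam (fun ζ => (s.phi (n + 1)).eval ζ / (ζ - y)) =
      s.kappa (n + 1) * s.Lam (fun ζ => (X * s.phi n).eval ζ / (ζ - y)) +
        s.phi0 (n + 1) * s.Lam fun ζ => (s.phiStar n).eval ζ / (ζ - y) := fun y hy => by
    rw [← Lam_linear_div hs _ _ _ _ hy, ← hb.phi_succ hs hn, ← Lam_const_mul]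
    congr 1; ext ζ; rw [eval_mul, eval_C]; ring
  have h0 := key 0 isGood_zero
  have h1 := key x hx
  rw [Lam_X_mul_div_zero] at h0
  simp only [sub_zero] at h0
  have h2 := hb.Lam_phiStar_div_pow hs hn' (Nat.zero_le n)
  simp only [zero_add, pow_one, if_true] at h2
  rw [hb.Lam_phi_div hs hn, if_neg n.succ_ne_zero, mul_zero, h2] at h0
  rw [Lam_X_mul_div hs _ hx] at h1
  rw [hb.eps_eq hs hn hx, hb.eps_eq hs hn' hx, hb.epsStar_eq hs hn' hx]
  linear_combination 2 * h1 - 2 * h0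

theorem epsStar_succ (hb : s.IsBiorthonormal N) (hs : s.IsRegular) {n : ℕ} (hn : n + 1 ≤ N) {x : ℂ}
    (hx : s.IsGood x) :
    s.kappa n * s.epsStar (n + 1) x = s.kappa (n + 1) * s.epsStar n x -
      s.phiBar0 (n + 1) * (x * s.eps n x) := by
  have hn' : n ≤ N := Nat.le_of_succ_le hn
  have key : ∀ y, s.IsGood y → s.kappa n * s.Lam (fun ζ => (s.phiStar (n + 1)).eval ζ / (ζ - y)) =
      s.kappa (n + 1) * s.Lam (fun ζ => (s.phiStar n).eval ζ / (ζ - y)) +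
        s.phiBar0 (n + 1) * s.Lam fun ζ => (X * s.phi n).eval ζ / (ζ - y) := fun y hy => by
    rw [← Lam_linear_div hs _ _ _ _ hy, ← hb.phiStar_succ hs hn, ← Lam_const_mul]
    congr 1; ext ζ; rw [eval_mul, eval_C]; ring
  have h0 := key 0 isGood_zero
  have h1 := key x hx
  rw [Lam_X_mul_div_zero] at h0
  simp only [sub_zero] at h0
  have h2 := hb.Lam_phiStar_div_pow hs hn' (Nat.zero_le n)
  have h3 := hb.Lam_phiStar_div_pow hs hn (Nat.zero_le (n + 1))
  simp only [zero_add, pow_one, if_true] at h2 h3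
  rw [h2, h3] at h0
  rw [Lam_X_mul_div hs _ hx] at h1
  rw [hb.eps_eq hs hn' hx, hb.epsStar_eq hs hn hx, hb.epsStar_eq hs hn' hx]
  linear_combination 2 * h0 - 2 * h1

end IsBiorthonormal

end System

end BOPUC

end

noncomputable section

open Polynomial Filter Set MeasureTheory
open scoped Topology Interval

namespace BOPUC

theorem tendsto_inv_sub_cobounded (a : ℂ) :
    Tendsto (fun x : ℂ => (x - a)⁻¹) (Bornology.cobounded ℂ) (𝓝 0) := by
  refine tendsto_inv₀_cobounded.comp ?_
  rw [tendsto_norm_atTop_iff_cobounded.symm]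
  refine tendsto_atTop_mono (f := fun x : ℂ => ‖x‖ - ‖a‖) (fun x => norm_sub_norm_le x a) ?_
  exact tendsto_atTop_add_const_right _ _ tendsto_norm_cobounded_atTop

theorem eq_C_of_tendsto {P : ℂ[X]} {l : ℂ}
    (h : Tendsto (fun x => P.eval x) (Bornology.cobounded ℂ) (𝓝 l)) : P = C l := by
  by_cases hd : 0 < P.degree
  · have h1 := P.tendsto_norm_atTop hd (tendsto_norm_cobounded_atTop (E := ℂ))
    exact absurd h.norm (not_tendsto_nhds_of_tendsto_atTop h1 _)
  · have h1 := eq_C_of_degree_le_zero (not_lt.1 hd)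
    rw [h1] at h ⊢
    simp only [eval_C] at h
    rw [tendsto_nhds_unique h tendsto_const_nhds]

theorem exists_eq_X_pow_mul {P : ℂ[X]} {n : ℕ} {l : ℂ}
    (h : Tendsto (fun x => P.eval x / x ^ n) (𝓝[≠] 0) (𝓝 l)) :
    ∃ Q : ℂ[X], P = X ^ n * Q ∧ Q.eval 0 = l := by
  induction n generalizing P with
  | zero =>
    refine ⟨P, by simp, ?_⟩
    simp only [pow_zero, div_one] at h
    exact tendsto_nhds_unique ((P.continuous.tendsto 0).mono_left nhdsWithin_le_nhds) h
  | succ n ih =>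
    have h1 : Tendsto (fun x => P.eval x / x ^ (n + 1) * x ^ (n + 1)) (𝓝[≠] (0 : ℂ)) (𝓝 (l * 0)) := by
      refine h.mul (Tendsto.mono_left ?_ nhdsWithin_le_nhds)
      have : Continuous fun x : ℂ => x ^ (n + 1) := by fun_prop
      simpa using this.tendsto 0
    have h2 : P.eval 0 = 0 := by
      rw [mul_zero] at h1
      refine tendsto_nhds_unique ((P.continuous.tendsto 0).mono_left nhdsWithin_le_nhds)
        (h1.congr' ?_)
      filter_upwards [self_mem_nhdsWithin] with x hx
      exact div_mul_cancel₀ _ (pow_ne_zero _ hx)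
    rw [← coeff_zero_eq_eval_zero] at h2
    obtain ⟨R, rfl⟩ := X_dvd_iff.2 h2
    obtain ⟨Q, rfl, hQ⟩ := ih (P := R) (h.congr' (by
      filter_upwards [self_mem_nhdsWithin] with x hx
      have hx' : x ≠ 0 := hx
      rw [eval_mul, eval_X, pow_succ]
      field_simp))
    exact ⟨Q, by ring, hQ⟩

/-- A family of polynomials of degree at most `d` is differentiable, coefficient by coefficient. -/
structure HasPolyDerivAt (d : ℕ) (f : ℝ → ℂ[X]) (f' : ℂ[X]) (t : ℝ) : Prop where
  natDegree_le : ∀ᶠ τ in 𝓝 t, (f τ).natDegree ≤ d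
  coeff : ∀ k, HasDerivAt (fun τ => (f τ).coeff k) (f'.coeff k) t

namespace HasPolyDerivAt

variable {d : ℕ} {f : ℝ → ℂ[X]} {f' : ℂ[X]} {t : ℝ}

theorem natDegree_deriv_le (h : HasPolyDerivAt d f f' t) : f'.natDegree ≤ d := by
  refine natDegree_le_iff_coeff_eq_zero.2 fun k hk => ?_
  refine (h.coeff k).unique (((hasDerivAt_const t (0 : ℂ)).congr_of_eventuallyEq ?_))
  filter_upwards [h.natDegree_le] with τ hτ
  exact coeff_eq_zero_of_natDegree_lt (hτ.trans_lt hk)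

theorem eval_comp (h : HasPolyDerivAt d f f' t) {x : ℝ → ℂ} {x' : ℂ} (hx : HasDerivAt x x' t) :
    HasDerivAt (fun τ => (f τ).eval (x τ))
      (f'.eval (x t) + (f t).derivative.eval (x t) * x') t := by
  have h1 : HasDerivAt (fun τ => ∑ k ∈ Finset.range (d + 1), (f τ).coeff k * x τ ^ k)
      (∑ k ∈ Finset.range (d + 1), (f'.coeff k * x t ^ k +
        (f t).coeff k * (k * x t ^ (k - 1) * x'))) t := by
    refine HasDerivAt.fun_sum fun k _ => (h.coeff k).mul (hx.pow k)
  refine (h1.congr_of_eventuallyEq ?_).congr_deriv ?_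
  · filter_upwards [h.natDegree_le] with τ hτ
    exact eval_eq_sum_range' (Nat.lt_succ_of_le hτ) _
  · rw [Finset.sum_add_distrib, eval_eq_sum_range' (Nat.lt_succ_of_le h.natDegree_deriv_le)]
    congr 1
    have h2 := derivative_eval (f t) (x t)
    rw [h2, Polynomial.sum_over_range' _ (by simp) (d + 1) (Nat.lt_succ_of_le
      h.natDegree_le.self_of_nhds), Finset.sum_mul]
    exact Finset.sum_congr rfl fun k _ => by ring

theorem eval (h : HasPolyDerivAt d f f' t) (x : ℂ) :
    HasDerivAt (fun τ => (f τ).eval x) (f'.eval x) t := by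
  simpa using h.eval_comp (hasDerivAt_const t x)

theorem derivative (h : HasPolyDerivAt d f f' t) :
    HasPolyDerivAt d (fun τ => (f τ).derivative) f'.derivative t where
  natDegree_le := h.natDegree_le.mono fun τ hτ =>
    (natDegree_derivative_le _).trans ((Nat.sub_le _ _).trans hτ)
  coeff k := by
    simp only [coeff_derivative]
    exact (h.coeff (k + 1)).mul_const _

end HasPolyDerivAt

theorem exists_hasPolyDerivAt {d : ℕ} {f : ℝ → ℂ[X]} {t : ℝ} {A : Set ℂ} (hA : A.Infinite)
    (hd : ∀ᶠ τ in 𝓝 t, (f τ).natDegree ≤ d)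
    (h : ∀ x ∈ A, DifferentiableAt ℝ (fun τ => (f τ).eval x) t) :
    ∃ f', HasPolyDerivAt d f f' t := by
  obtain ⟨J, hJ, hc⟩ := hA.exists_subset_card_eq (d + 1)
  refine ⟨∑ x ∈ J, C (deriv (fun τ => (f τ).eval x) t) * Lagrange.basis J id x, hd, fun k => ?_⟩
  have h1 : HasDerivAt (fun τ => ∑ x ∈ J, (f τ).eval x * (Lagrange.basis J id x).coeff k)
      (∑ x ∈ J, deriv (fun τ => (f τ).eval x) t * (Lagrange.basis J id x).coeff k) t :=
    HasDerivAt.fun_sum fun x hx => ((h x (hJ hx)).hasDerivAt).mul_const _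
  refine (h1.congr_of_eventuallyEq ?_).congr_deriv ?_
  · filter_upwards [hd] with τ hτ
    have h2 := Lagrange.eq_interpolate (s := J) (v := id) (f := f τ) (Function.injective_id.injOn)
      (by
        rw [hc]
        exact lt_of_le_of_lt degree_le_natDegree (by exact_mod_cast Nat.lt_succ_of_le hτ))
    conv_lhs => rw [h2]
    simp [Lagrange.interpolate_apply, coeff_C_mul]
  · simp [coeff_C_mul]

namespace System

variable {m : ℕ} {ρ : Fin (m + 1) → ℂ} {s : System m ρ}

variable (s) in
/-- The polynomial `W ∑_j a_j / (x - z_j)`. -/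
def residueSum (a : Fin (m + 1) → ℂ) : ℂ[X] :=
  ∑ j, C (a j) * ∏ k ∈ Finset.univ.erase j, (X - C (s.z k))

theorem two_mul_eval_V_eq_residueSum (x : ℂ) : 2 * s.V.eval x = (s.residueSum ρ).eval x := by
  rw [V, eval_mul, eval_C, residueSum]; ring

theorem derivative_W : s.W.derivative = s.residueSum fun _ => 1 := by
  rw [W, derivative_prod_finset, residueSum]
  exact Finset.sum_congr rfl fun j _ => by simp

theorem eval_residueSum (a : Fin (m + 1) → ℂ) {x : ℂ} (hx : ∀ j, x ≠ s.z j) :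
    (s.residueSum a).eval x = s.W.eval x * ∑ j, a j / (x - s.z j) := by
  rw [residueSum, eval_finsetSum, Finset.mul_sum]
  refine Finset.sum_congr rfl fun j _ => ?_
  have h : s.W.eval x = (x - s.z j) * ∏ k ∈ Finset.univ.erase j, (x - s.z k) := by
    rw [eval_W, Finset.mul_prod_erase _ (fun k => x - s.z k) (Finset.mem_univ j)]
  have h1 := sub_ne_zero.2 (hx j)
  rw [h, eval_mul, eval_C, eval_prod]
  simp only [eval_sub, eval_X, eval_C]
  field_simp

theorem eval_residueSum_z' (a : Fin (m + 1) → ℂ) (j : Fin (m + 1)) :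
    (s.residueSum a).eval (s.z j) = a j * ∏ k ∈ Finset.univ.erase j, (s.z j - s.z k) := by
  rw [residueSum, eval_finsetSum, Finset.sum_eq_single j]
  · rw [eval_mul, eval_C, eval_prod]; simp only [eval_sub, eval_X, eval_C]
  · intro i _ hij
    rw [eval_mul, eval_prod, Finset.prod_eq_zero (i := j), mul_zero]
    · exact Finset.mem_erase.2 ⟨hij.symm, Finset.mem_univ _⟩
    · simp
  · simp

theorem eval_derivative_W (j : Fin (m + 1)) :
    s.W.derivative.eval (s.z j) = ∏ k ∈ Finset.univ.erase j, (s.z j - s.z k) := by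
  rw [derivative_W, eval_residueSum_z', one_mul]

theorem eval_residueSum_z (a : Fin (m + 1) → ℂ) (j : Fin (m + 1)) :
    (s.residueSum a).eval (s.z j) = a j * s.W.derivative.eval (s.z j) := by
  rw [eval_residueSum_z', eval_derivative_W]

theorem eval_derivative_W_ne_zero (hinj : Function.Injective s.z) (j : Fin (m + 1)) :
    s.W.derivative.eval (s.z j) ≠ 0 := by
  rw [eval_derivative_W]
  exact Finset.prod_ne_zero_iff.2 fun k hk =>
    sub_ne_zero.2 fun h => (Finset.mem_erase.1 hk).1 (hinj h).symm

theorem two_mul_eval_V_z (j : Fin (m + 1)) :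
    2 * s.V.eval (s.z j) = ρ j * s.W.derivative.eval (s.z j) := by
  rw [two_mul_eval_V_eq_residueSum, eval_residueSum_z]

theorem natDegree_residueSum_le (a : Fin (m + 1) → ℂ) : (s.residueSum a).natDegree ≤ m := by
  refine natDegree_sum_le_of_forall_le _ _ fun j _ => (natDegree_C_mul_le _ _).trans ?_
  rw [natDegree_prod_of_monic _ _ fun j _ => monic_X_sub_C _]; simp

theorem W_dvd (hinj : Function.Injective s.z) {P : ℂ[X]} (h : ∀ j, P.eval (s.z j) = 0) :
    s.W ∣ P := by
  refine Finset.prod_dvd_of_coprime (fun i _ j _ hij => ?_) fun j _ => dvd_iff_isRoot.2 (h j)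
  exact isCoprime_X_sub_C_of_isUnit_sub (isUnit_iff_ne_zero.2 (sub_ne_zero.2 (hinj.ne hij)))

theorem eventually_ne_z : ∀ᶠ x in Bornology.cobounded ℂ, ∀ j, x ≠ s.z j := by
  rw [eventually_all]
  intro j
  have := (tendsto_norm_cobounded_atTop (E := ℂ)).eventually_gt_atTop ‖s.z j‖
  filter_upwards [this] with x hx h
  rw [h] at hx; exact lt_irrefl _ hx

theorem tendsto_residue_sum (a : Fin (m + 1) → ℂ) :
    Tendsto (fun x => ∑ j, a j / (x - s.z j)) (Bornology.cobounded ℂ) (𝓝 0) := by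
  have : Tendsto (fun x => ∑ j, a j * (x - s.z j)⁻¹) (Bornology.cobounded ℂ)
      (𝓝 (∑ j : Fin (m + 1), a j * 0)) :=
    tendsto_finsetSum _ fun j _ => (tendsto_inv_sub_cobounded _).const_mul _
  simpa [div_eq_mul_inv] using this

/-- Liouville's theorem for rational functions with simple poles. -/
theorem eq_residueSum_of_tendsto (hinj : Function.Injective s.z) {P : ℂ[X]} {l : ℂ}
    (h : Tendsto (fun x => P.eval x / s.W.eval x) (Bornology.cobounded ℂ) (𝓝 l)) :
    P = C l * s.W + s.residueSum fun j => P.eval (s.z j) / s.W.derivative.eval (s.z j) := by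
  set a : Fin (m + 1) → ℂ := fun j => P.eval (s.z j) / s.W.derivative.eval (s.z j)
  have h1 : ∀ j, (P - (C l * s.W + s.residueSum a)).eval (s.z j) = 0 := fun j => by
    rw [eval_sub, eval_add, eval_mul, eval_W_z, eval_residueSum_z, mul_zero, zero_add,
      div_mul_cancel₀ _ (eval_derivative_W_ne_zero hinj j), sub_self]
  obtain ⟨R, hR⟩ := W_dvd hinj h1
  have h2 : Tendsto (fun x => R.eval x) (Bornology.cobounded ℂ) (𝓝 0) := by
    have h3 := (h.sub_const l).sub (s.tendsto_residue_sum a)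
    rw [sub_self, sub_zero] at h3
    refine h3.congr' ?_
    filter_upwards [s.eventually_ne_z] with x hx
    have h4 := congrArg (fun Q : ℂ[X] => Q.eval x) hR
    simp only [eval_sub, eval_add, eval_mul, eval_C, eval_residueSum a hx] at h4
    have h5 := eval_W_ne_zero hx
    field_simp
    linear_combination h4
  rw [eq_C_of_tendsto h2, map_zero, mul_zero, sub_eq_zero] at hR
  exact hR

/-- A polynomial is divisible by a power of the variable and by Liouville's theorem determined by
its values at the singular points. -/
theorem exists_quotient (hinj : Function.Injective s.z) {P : ℂ[X]} {n : ℕ} {l l₀ : ℂ}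
    (h₀ : Tendsto (fun x => P.eval x / x ^ n) (𝓝[≠] 0) (𝓝 l₀))
    (h : Tendsto (fun x => P.eval x / (x ^ n * s.W.eval x)) (Bornology.cobounded ℂ) (𝓝 l)) :
    ∃ Q : ℂ[X], P = X ^ n * Q ∧ Q.eval 0 = l₀ ∧
      Q = C l * s.W + s.residueSum fun j => Q.eval (s.z j) / s.W.derivative.eval (s.z j) := by
  obtain ⟨Q, rfl, hQ⟩ := exists_eq_X_pow_mul h₀
  refine ⟨Q, rfl, hQ, eq_residueSum_of_tendsto hinj (h.congr' ?_)⟩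
  filter_upwards [tendsto_norm_cobounded_atTop.eventually_gt_atTop 0] with x hx
  rw [eval_mul, eval_pow, eval_X]
  exact mul_div_mul_left _ _ (pow_ne_zero _ (norm_pos_iff.1 hx))

end System

end BOPUC

end

noncomputable section

open Polynomial Filter Set MeasureTheory
open scoped Topology Interval

namespace BOPUC

theorem tendsto_eval_div_pow {P : ℂ[X]} {n : ℕ} (hP : P.natDegree ≤ n) :
    Tendsto (fun x => P.eval x / x ^ n) (Bornology.cobounded ℂ) (𝓝 (P.coeff n)) := by
  have h1 : Tendsto (fun x : ℂ => ∑ i ∈ Finset.range (n + 1), P.coeff i * x⁻¹ ^ (n - i))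
      (Bornology.cobounded ℂ) (𝓝 (∑ i ∈ Finset.range (n + 1), P.coeff i * 0 ^ (n - i))) :=
    tendsto_finsetSum _ fun i _ => (tendsto_inv₀_cobounded.pow _).const_mul _
  have h2 : ∑ i ∈ Finset.range (n + 1), P.coeff i * (0 : ℂ) ^ (n - i) = P.coeff n := by
    rw [Finset.sum_range_succ, Finset.sum_eq_zero, zero_add, Nat.sub_self, pow_zero, mul_one]
    intro i hi
    rw [zero_pow (by have := Finset.mem_range.1 hi; omega), mul_zero]
  rw [h2] at h1
  refine h1.congr' ?_
  filter_upwards [tendsto_norm_cobounded_atTop.eventually_gt_atTop 0] with x hx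
  have hx0 : x ≠ 0 := norm_pos_iff.1 hx
  rw [eval_eq_sum_range' (Nat.lt_succ_of_le hP), Finset.sum_div]
  refine Finset.sum_congr rfl fun i hi => ?_
  obtain ⟨k, rfl⟩ := Nat.exists_eq_add_of_le (Nat.lt_succ_iff.1 (Finset.mem_range.1 hi))
  rw [Nat.add_sub_cancel_left, pow_add, inv_pow]
  field_simp

theorem tendsto_eval_derivative_div_pow {P : ℂ[X]} {n : ℕ} (hP : P.natDegree ≤ n) :
    Tendsto (fun x => P.derivative.eval x / x ^ n) (Bornology.cobounded ℂ) (𝓝 0) := by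
  have h1 : P.derivative.natDegree ≤ n :=
    (natDegree_derivative_le _).trans ((Nat.sub_le _ _).trans hP)
  have h2 := tendsto_eval_div_pow h1
  rwa [coeff_derivative, coeff_eq_zero_of_natDegree_lt (Nat.lt_succ_of_le hP), zero_mul] at h2

theorem eventually_norm_ne_one_zero : ∀ᶠ x : ℂ in 𝓝[≠] 0, ‖x‖ ≠ 1 :=
  mem_nhdsWithin_of_mem_nhds (isOpen_norm_ne_one.mem_nhds (by simp))

theorem eventually_norm_ne_one_cobounded : ∀ᶠ x : ℂ in Bornology.cobounded ℂ, ‖x‖ ≠ 1 :=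
  (tendsto_norm_cobounded_atTop.eventually_gt_atTop 1).mono fun _ hx => hx.ne'

theorem tendsto_eval_punctured (P : ℂ[X]) : Tendsto (fun x => P.eval x) (𝓝[≠] 0) (𝓝 (P.eval 0)) :=
  (P.continuous.tendsto 0).mono_left nhdsWithin_le_nhds

theorem infinite_norm_ne_one : {x : ℂ | ‖x‖ ≠ 1}.Infinite := by
  refine infinite_of_mem_nhds (0 : ℂ) (isOpen_norm_ne_one.mem_nhds (by simp))

theorem eq_of_eval_eq {P Q : ℂ[X]} (h : ∀ x : ℂ, ‖x‖ ≠ 1 → P.eval x = Q.eval x) : P = Q :=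
  Polynomial.eq_of_infinite_eval_eq P Q (infinite_norm_ne_one.mono fun x hx => h x hx)

namespace System

variable {m : ℕ} {ρ : Fin (m + 1) → ℂ} {s : System m ρ}

variable (s) in
/-- The derivative of `qVec`. -/
def qDeriv (n : ℕ) (a : Fin 2) (x : ℂ) : ℂ :=
  2 * s.Lam fun ζ => (s.pVec n a).eval ζ / (ζ - x) ^ 2

variable (s) in
/-- The value of `qVec / x ^ n` at the origin. -/
def qZero (n : ℕ) : Fin 2 → ℂ := ![2 / s.kappa n, 0]

theorem IsRegular.circleIntegrable_pVec (hs : s.IsRegular) (n : ℕ) (a : Fin 2) :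
    CircleIntegrable (fun ζ => s.w ζ * (s.pVec n a).eval ζ) 0 1 :=
  hs.circleIntegrable_mul (s.pVec n a).continuousOn

theorem tendsto_W_div (h0 : s.z 0 = 0) :
    Tendsto (fun x => s.W.eval x / x) (𝓝[≠] 0) (𝓝 (s.W.derivative.eval 0)) := by
  have h1 := hasDerivAt_iff_tendsto_slope.1 (s.W.hasDerivAt 0)
  refine h1.congr fun x => ?_
  have h2 : s.W.eval 0 = 0 := by simpa [h0] using s.eval_W_z 0
  rw [slope_def_field, h2, sub_zero, sub_zero]

namespace IsBiorthonormal

variable {n : ℕ} {N : ℕ}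

theorem qVec_eventuallyEq (hb : s.IsBiorthonormal N) (hs : s.IsRegular) (hn : n ≤ N) {x : ℂ}
    (hx : ‖x‖ ≠ 1) (a : Fin 2) :
    s.qVec n a =ᶠ[𝓝 x] fun y => 2 * cauchy (fun ζ => s.w ζ * (s.pVec n a).eval ζ) y + s.qInf n a := by
  filter_upwards [isOpen_norm_ne_one.mem_nhds hx] with y hy
  rw [hb.qVec_eq hs hn (Or.inl hy), Lam_div_eq_cauchy fun ζ => (s.pVec n a).eval ζ]

theorem hasDerivAt_qVec (hb : s.IsBiorthonormal N) (hs : s.IsRegular) (hn : n ≤ N) {x : ℂ}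
    (hx : ‖x‖ ≠ 1) (a : Fin 2) : HasDerivAt (s.qVec n a) (s.qDeriv n a x) x := by
  have h1 := (hasDerivAt_cauchy (hs.circleIntegrable_pVec n a) hx).const_mul 2
  refine ((h1.add_const (s.qInf n a)).congr_of_eventuallyEq
    (hb.qVec_eventuallyEq hs hn hx a)).congr_deriv ?_
  rw [qDeriv, Lam_div_sq_eq_cauchyDeriv fun ζ => (s.pVec n a).eval ζ]

theorem tendsto_qVec (hb : s.IsBiorthonormal N) (hs : s.IsRegular) (hn : n ≤ N) (a : Fin 2) :
    Tendsto (s.qVec n a) (Bornology.cobounded ℂ) (𝓝 (s.qInf n a)) := by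
  have h1 := ((tendsto_cauchy (hs.circleIntegrable_pVec n a)).const_mul 2).add_const (s.qInf n a)
  rw [mul_zero, zero_add] at h1
  refine h1.congr' ?_
  filter_upwards [eventually_norm_ne_one_cobounded] with x hx
  exact (hb.qVec_eventuallyEq hs hn hx a).self_of_nhds.symm

theorem tendsto_qDeriv (hs : s.IsRegular) (a : Fin 2) :
    Tendsto (s.qDeriv n a) (Bornology.cobounded ℂ) (𝓝 0) := by
  have h1 := (tendsto_cauchyDeriv (hs.circleIntegrable_pVec n a)).const_mul 2
  rw [mul_zero] at h1
  refine h1.congr fun x => ?_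
  rw [qDeriv, Lam_div_sq_eq_cauchyDeriv fun ζ => (s.pVec n a).eval ζ]

variable (s) in
/-- The density whose Cauchy transform is `q_a / (2 x ^ (n + a))`. -/
def reducedDensity (n : ℕ) (a : Fin 2) (ζ : ℂ) : ℂ :=
  s.w ζ * ((s.pVec n a).eval ζ / ζ ^ (n + (a : ℕ)))

theorem circleIntegrable_reducedDensity (hs : s.IsRegular) (n : ℕ) (a : Fin 2) :
    CircleIntegrable (reducedDensity s n a) 0 1 :=
  hs.circleIntegrable_mul (continuousOn_div_pow _ _)

theorem qVec_eq_cauchy (hb : s.IsBiorthonormal N) (hs : s.IsRegular) (hn : n ≤ N) {x : ℂ}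
    (hx : ‖x‖ ≠ 1) (a : Fin 2) :
    s.qVec n a x = 2 * (x ^ (n + (a : ℕ)) * cauchy (reducedDensity s n a) x) := by
  rw [hb.qVec_eq_pow hs hn (Or.inl hx),
    Lam_div_eq_cauchy fun ζ => (s.pVec n a).eval ζ / ζ ^ (n + (a : ℕ))]
  rfl

theorem cauchy_reducedDensity_zero (hb : s.IsBiorthonormal N) (hs : s.IsRegular) (hn : n ≤ N) :
    cauchy (reducedDensity s n 0) 0 = 1 / s.kappa n := by
  have h1 := hb.Lam_phi_div_pow hs hn le_rfl
  rw [if_pos rfl] at h1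
  rw [← h1, cauchy, Lam]
  congr 2; ext ζ
  simp only [reducedDensity, pVec, Matrix.cons_val_zero, Fin.val_zero, add_zero, sub_zero, pow_succ]
  rw [div_mul_eq_div_div, mul_assoc, ← div_eq_mul_inv]

theorem tendsto_pow_mul_cauchy (hb : s.IsBiorthonormal N) (hs : s.IsRegular) (hn : n ≤ N)
    (a : Fin 2) : Tendsto (fun x => 2 * (x ^ (a : ℕ) * cauchy (reducedDensity s n a) x)) (𝓝[≠] 0)
      (𝓝 (s.qZero n a)) := by
  have h1 : ContinuousAt (fun x => 2 * (x ^ (a : ℕ) * cauchy (reducedDensity s n a) x)) 0 := by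
    refine continuousAt_const.mul ((continuousAt_id.pow _).mul ?_)
    exact (hasDerivAt_cauchy (circleIntegrable_reducedDensity hs n a) (by simp)).continuousAt
  have h2 := h1.tendsto.mono_left (nhdsWithin_le_nhds (s := {0}ᶜ))
  convert h2 using 2
  fin_cases a
  · simp only [qZero, Fin.zero_eta, Matrix.cons_val_zero, pow_zero]
    rw [hb.cauchy_reducedDensity_zero hs hn]; ring
  · simp [qZero]

theorem tendsto_qVec_div_pow (hb : s.IsBiorthonormal N) (hs : s.IsRegular) (hn : n ≤ N)
    (a : Fin 2) : Tendsto (fun x => s.qVec n a x / x ^ n) (𝓝[≠] 0) (𝓝 (s.qZero n a)) := by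
  refine (hb.tendsto_pow_mul_cauchy hs hn a).congr' ?_
  filter_upwards [eventually_norm_ne_one_zero, self_mem_nhdsWithin] with x hx hx0
  have hx0 : x ≠ 0 := hx0
  rw [hb.qVec_eq_cauchy hs hn hx, pow_add]
  field_simp

theorem tendsto_W_mul_qDeriv_div_pow (hb : s.IsBiorthonormal N) (hs : s.IsRegular) (hn : n ≤ N)
    (a : Fin 2) : Tendsto (fun x => s.W.eval x * s.qDeriv n a x / x ^ n) (𝓝[≠] 0)
      (𝓝 (s.W.derivative.eval 0 * (n * s.qZero n a))) := by
  set H := cauchy (reducedDensity s n a) with hH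
  have hi := circleIntegrable_reducedDensity hs n a
  have hc : ContinuousAt (deriv H) 0 :=
    ((differentiableOn_cauchy hi).analyticAt (isOpen_norm_ne_one.mem_nhds (by simp))).deriv.continuousAt
  have h1 : Tendsto (fun x => s.W.eval x / x * ((n + (a : ℕ)) * (2 * (x ^ (a : ℕ) * H x)) +
      2 * (x ^ (a : ℕ) * x * deriv H x))) (𝓝[≠] 0)
      (𝓝 (s.W.derivative.eval 0 * ((n + (a : ℕ)) * s.qZero n a +
        2 * (0 ^ (a : ℕ) * 0 * deriv H 0)))) := by
    refine (tendsto_W_div hs.origin).mul (((hb.tendsto_pow_mul_cauchy hs hn a).const_mul _).add ?_)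
    have : ContinuousAt (fun x => 2 * (x ^ (a : ℕ) * x * deriv H x)) 0 :=
      continuousAt_const.mul (((continuousAt_id.pow _).mul continuousAt_id).mul hc)
    exact this.tendsto.mono_left nhdsWithin_le_nhds
  have h2 : s.W.derivative.eval 0 * ((n + (a : ℕ)) * s.qZero n a +
        2 * (0 ^ (a : ℕ) * 0 * deriv H 0)) = s.W.derivative.eval 0 * (n * s.qZero n a) := by
    fin_cases a
    · simp
    · simp [qZero]
  rw [h2] at h1
  refine h1.congr' ?_
  filter_upwards [eventually_norm_ne_one_zero, self_mem_nhdsWithin] with x hx hx0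
  have hx0 : x ≠ 0 := hx0
  have hH' : HasDerivAt H (deriv H x) x := (hasDerivAt_cauchy hi hx).differentiableAt.hasDerivAt
  have h3 : HasDerivAt (s.qVec n a) (2 * (((n + (a : ℕ) : ℕ) * x ^ (n + (a : ℕ) - 1)) * H x +
      x ^ (n + (a : ℕ)) * deriv H x)) x := by
    refine (((hasDerivAt_pow (n + (a : ℕ)) x).mul hH').const_mul 2).congr_of_eventuallyEq ?_
    filter_upwards [isOpen_norm_ne_one.mem_nhds hx] with y hy
    exact hb.qVec_eq_cauchy hs hn hy a
  rw [(hb.hasDerivAt_qVec hs hn hx a).unique h3]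
  have h4 : ((n + (a : ℕ) : ℕ) : ℂ) * x ^ (n + (a : ℕ) - 1) = (n + (a : ℕ)) * x ^ (n + (a : ℕ)) / x := by
    rcases Nat.eq_zero_or_pos (n + (a : ℕ)) with h | h
    · have h' : (n : ℂ) + (a : ℕ) = 0 := by exact_mod_cast h
      rw [h', h]; simp
    · obtain ⟨k, hk⟩ := Nat.exists_eq_succ_of_ne_zero h.ne'
      have h' : (n : ℂ) + (a : ℕ) = (k.succ : ℂ) := by exact_mod_cast hk
      rw [h', hk, Nat.succ_sub_one, pow_succ]
      field_simp
  rw [h4, pow_add]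
  field_simp

end IsBiorthonormal

end System

end BOPUC

end

noncomputable section

open Polynomial Filter Set MeasureTheory
open scoped Topology Interval

namespace BOPUC

namespace System

variable {m : ℕ} {ρ : Fin (m + 1) → ℂ} {s : System m ρ}

variable (s) in
/-- The polynomial `W G' - 2 V G`. -/
def odePoly : ℂ[X] := s.residueSum fun j => -(ρ j * s.G (s.z j))

variable (s) in
/-- The derivative of the Cauchy transform `G`. -/
def GDeriv (x : ℂ) : ℂ := ∑ j, ρ j * s.Lam fun ζ => (ζ - x)⁻¹ / (ζ - s.z j)

theorem IsRegular.eval_odePoly (hs : s.IsRegular) {x : ℂ} (hx : ‖x‖ ≠ 1) :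
    s.odePoly.eval x = s.W.eval x * s.GDeriv x - 2 * s.V.eval x * s.G x := by
  by_cases h : ∀ j, x ≠ s.z j
  · rw [odePoly, eval_residueSum _ h, two_mul_eval_V_eq_residueSum, eval_residueSum _ h, mul_assoc,
      ← mul_sub, Finset.sum_mul, GDeriv, ← Finset.sum_sub_distrib]
    congr 1
    refine Finset.sum_congr rfl fun j _ => ?_
    rw [hs.Lam_inv_sub_div hx (h j)]; ring
  · push Not at h
    obtain ⟨j, rfl⟩ := h
    rw [odePoly, eval_residueSum_z, eval_W_z, two_mul_eval_V_z]; ring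

variable (s) in
/-- The polynomial `W p_a' q_b - p_b (W q_a' - 2 V q_a)`. -/
def specPoly (n : ℕ) (a b : Fin 2) : ℂ[X] :=
  C 2 * (s.W * (s.pVec n a).derivative * s.alpha n b - s.pVec n b *
    (s.pVec n a * s.odePoly + s.W * (s.alpha n a).derivative - C 2 * s.V * s.alpha n a))

theorem tendsto_two_V_div_W : Tendsto (fun x => 2 * s.V.eval x / s.W.eval x)
    (Bornology.cobounded ℂ) (𝓝 0) := by
  refine (s.tendsto_residue_sum ρ).congr' ?_
  filter_upwards [s.eventually_ne_z] with x hx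
  rw [two_mul_eval_V_eq_residueSum, eval_residueSum _ hx, mul_div_cancel_left₀ _ (eval_W_ne_zero hx)]

namespace IsBiorthonormal

variable {n : ℕ} {N : ℕ}

theorem pVec_one_eval_zero (hb : s.IsBiorthonormal N) (hn : n ≤ N) :
    (s.pVec n 1).eval 0 = s.kappa n := by
  rw [← hb.coeff_phiStar_zero hn, coeff_zero_eq_eval_zero]; rfl

theorem qDeriv_eq (hb : s.IsBiorthonormal N) (hs : s.IsRegular) (hn : n ≤ N) {x : ℂ}
    (hx : ‖x‖ ≠ 1) (a : Fin 2) :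
    s.qDeriv n a x = 2 * ((s.pVec n a).derivative.eval x * s.G x +
      (s.pVec n a).eval x * s.GDeriv x + (s.alpha n a).derivative.eval x) := by
  refine (hb.hasDerivAt_qVec hs hn hx a).unique ?_
  have h1 := ((((s.pVec n a).hasDerivAt x).mul (hs.hasDerivAt_G hx)).add
    ((s.alpha n a).hasDerivAt x)).const_mul 2
  refine h1.congr_of_eventuallyEq ?_
  filter_upwards [isOpen_norm_ne_one.mem_nhds hx] with y hy
  exact hb.qVec_eq_alpha hs hn (Or.inl hy) a

theorem eval_specPoly (hb : s.IsBiorthonormal N) (hs : s.IsRegular) (hn : n ≤ N) {x : ℂ}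
    (hx : ‖x‖ ≠ 1) (a b : Fin 2) :
    (s.specPoly n a b).eval x = s.W.eval x * (s.pVec n a).derivative.eval x * s.qVec n b x -
      (s.pVec n b).eval x * (s.W.eval x * s.qDeriv n a x - 2 * s.V.eval x * s.qVec n a x) := by
  rw [hb.qDeriv_eq hs hn hx, hb.qVec_eq_alpha hs hn (Or.inl hx), hb.qVec_eq_alpha hs hn (Or.inl hx)]
  simp only [specPoly, eval_mul, eval_C, eval_sub, eval_add, hs.eval_odePoly hx]
  ring

theorem eval_specPoly_z (hb : s.IsBiorthonormal N) (hs : s.IsRegular) (hn : n ≤ N) (a b : Fin 2)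
    (j : Fin (m + 1)) :
    (s.specPoly n a b).eval (s.z j) = ρ j * s.W.derivative.eval (s.z j) *
      ((s.pVec n b).eval (s.z j) * s.qVec n a (s.z j)) := by
  have hV := s.two_mul_eval_V_z j
  rw [hb.qVec_eq_alpha hs hn (IsGood.of_z j)]
  simp only [specPoly, eval_mul, eval_C, eval_sub, eval_add, odePoly, eval_residueSum_z, eval_W_z,
    hV]
  ring

theorem tendsto_specPoly_zero (hb : s.IsBiorthonormal N) (hs : s.IsRegular) (hn : n ≤ N)
    (a b : Fin 2) : Tendsto (fun x => (s.specPoly n a b).eval x / x ^ n) (𝓝[≠] 0)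
      (𝓝 ((s.pVec n b).eval 0 * ((2 * s.V.eval 0 - n * s.W.derivative.eval 0) * s.qZero n a))) := by
  have h1 := ((tendsto_eval_punctured s.W).mul (tendsto_eval_punctured (s.pVec n a).derivative)).mul
    (hb.tendsto_qVec_div_pow hs hn b)
  have h2 := (tendsto_eval_punctured (s.pVec n b)).mul
    ((hb.tendsto_W_mul_qDeriv_div_pow hs hn a).sub
      (((tendsto_eval_punctured s.V).const_mul 2).mul (hb.tendsto_qVec_div_pow hs hn a)))
  have hW : s.W.eval 0 = 0 := by simpa [hs.origin] using s.eval_W_z 0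
  refine ((h1.sub h2).congr' ?_).trans (le_of_eq ?_)
  · filter_upwards [eventually_norm_ne_one_zero] with x hx
    rw [hb.eval_specPoly hs hn hx]
    ring
  · rw [hW]; congr 1; ring

theorem tendsto_specPoly_cobounded (hb : s.IsBiorthonormal N) (hs : s.IsRegular) (hn : n ≤ N)
    (a b : Fin 2) : Tendsto (fun x => (s.specPoly n a b).eval x / (x ^ n * s.W.eval x))
      (Bornology.cobounded ℂ) (𝓝 0) := by
  have h1 := (tendsto_eval_derivative_div_pow (hb.natDegree_pVec_le hn a)).mul
    (hb.tendsto_qVec hs hn b)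
  have h2 := (tendsto_eval_div_pow (hb.natDegree_pVec_le hn b)).mul
    ((tendsto_qDeriv (n := n) hs a).sub ((tendsto_two_V_div_W (s := s)).mul (hb.tendsto_qVec hs hn a)))
  have h3 := h1.sub h2
  simp only [zero_mul, sub_zero, mul_zero] at h3
  refine h3.congr' ?_
  filter_upwards [eventually_norm_ne_one_cobounded, s.eventually_ne_z, eventually_two_lt_norm] with
    x hx hz hx2
  have hW := eval_W_ne_zero hz
  have hx0 : x ≠ 0 := by rintro rfl; simp at hx2; linarith
  rw [hb.eval_specPoly hs hn hx]
  field_simp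

theorem casoratian (hb : s.IsBiorthonormal N) (hs : s.IsRegular) (hn : n ≤ N) {x : ℂ}
    (hx : s.IsGood x) :
    s.qVec n 0 x * (s.pVec n 1).eval x - s.qVec n 1 x * (s.pVec n 0).eval x = 2 * x ^ n := by
  have hκ := hb.kappa_ne_zero hs hn
  set P : ℂ[X] := C 2 * (s.alpha n 0 * s.pVec n 1 - s.alpha n 1 * s.pVec n 0) with hP
  have e : ∀ y, s.IsGood y → P.eval y =
      s.qVec n 0 y * (s.pVec n 1).eval y - s.qVec n 1 y * (s.pVec n 0).eval y := fun y hy => by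
    rw [hb.qVec_eq_alpha hs hn hy, hb.qVec_eq_alpha hs hn hy]
    simp only [hP, eval_mul, eval_sub, eval_C]; ring
  have h1 := ((hb.tendsto_qVec_div_pow hs hn 0).mul (tendsto_eval_punctured (s.pVec n 1))).sub
    ((hb.tendsto_qVec_div_pow hs hn 1).mul (tendsto_eval_punctured (s.pVec n 0)))
  obtain ⟨Q, hQ, -⟩ := exists_eq_X_pow_mul (P := P) (h1.congr' (by
    filter_upwards [eventually_norm_ne_one_zero] with y hy
    rw [e y (Or.inl hy)]; ring))
  have h2 := ((hb.tendsto_qVec hs hn 0).mul (tendsto_eval_div_pow (hb.natDegree_pVec_le hn 1))).sub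
    ((hb.tendsto_qVec hs hn 1).mul (tendsto_eval_div_pow (hb.natDegree_pVec_le hn 0)))
  have h3 : s.qInf n 0 * (s.pVec n 1).coeff n - s.qInf n 1 * (s.pVec n 0).coeff n = 2 := by
    have : (s.pVec n 0).coeff n = s.kappa n := rfl
    rw [this]
    simp only [qInf, Matrix.cons_val_zero, Matrix.cons_val_one]
    field_simp
    ring
  rw [h3] at h2
  have h4 : Q = C 2 := eq_C_of_tendsto (h2.congr' (by
    filter_upwards [eventually_norm_ne_one_cobounded, eventually_two_lt_norm] with y hy hy2
    have hy0 : y ≠ 0 := by rintro rfl; simp at hy2; linarith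
    have h5 := e y (Or.inl hy)
    rw [hQ, eval_mul, eval_pow, eval_X] at h5
    field_simp
    linear_combination -h5))
  rw [← e x hx, hQ, h4]
  simp only [eval_mul, eval_pow, eval_X, eval_C]; ring

end IsBiorthonormal

variable (s) in
/-- The matrix of polynomials `W A_n`. -/
def numPoly (n : ℕ) : Fin 2 → Fin 2 → ℂ[X] :=
  ![![-(s.Omega n + s.V - C (s.kappa (n + 1) / s.kappa n) * X * s.Theta n),
      C (s.phi0 (n + 1) / s.kappa n) * s.Theta n],
    ![-(C (s.phiBar0 (n + 1) / s.kappa n) * X * s.ThetaStar n),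
      s.OmegaStar n - s.V - C (s.kappa (n + 1) / s.kappa n) * s.ThetaStar n] ]

theorem eval_numPoly (n : ℕ) (a b : Fin 2) (x : ℂ) :
    (s.numPoly n a b).eval x = s.numerator n x a b := by
  fin_cases a <;> fin_cases b <;> simp [numPoly, numerator]

/-- What is needed of the polynomials at a single time. -/
structure IsAdmissible (s : System m ρ) (n : ℕ) : Prop where
  regular : s.IsRegular
  biorthonormal : s.IsBiorthonormal (n + 1)
  phi0_ne_zero : s.phi0 (n + 1) ≠ 0
  phiBar0_ne_zero : s.phiBar0 (n + 1) ≠ 0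

namespace IsAdmissible

variable {n : ℕ}

theorem deriv_eps (h : s.IsAdmissible n) {x : ℂ} (hx : ‖x‖ ≠ 1) :
    deriv (s.eps n) x = s.qDeriv n 0 x :=
  (h.biorthonormal.hasDerivAt_qVec h.regular n.le_succ hx 0).deriv

theorem deriv_epsStar (h : s.IsAdmissible n) {x : ℂ} (hx : ‖x‖ ≠ 1) :
    deriv (s.epsStar n) x = -s.qDeriv n 1 x := by
  have h1 := (h.biorthonormal.hasDerivAt_qVec h.regular n.le_succ hx 1).neg
  have h2 : -s.qVec n 1 = s.epsStar n := by ext y; simp [qVec]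
  rw [h2] at h1
  exact h1.deriv

theorem kappa_ne_zero (h : s.IsAdmissible n) : s.kappa n ≠ 0 :=
  h.biorthonormal.kappa_ne_zero h.regular n.le_succ

theorem exists_specPoly_eq (h : s.IsAdmissible n) (a b : Fin 2) :
    ∃ Q : ℂ[X], s.specPoly n a b = X ^ n * Q ∧
      Q.eval 0 = (s.pVec n b).eval 0 * ((2 * s.V.eval 0 - n * s.W.derivative.eval 0) * s.qZero n a) ∧
      Q = s.residueSum fun j => Q.eval (s.z j) / s.W.derivative.eval (s.z j) := by
  have := exists_quotient h.regular.injective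
    (h.biorthonormal.tendsto_specPoly_zero h.regular n.le_succ a b)
    (h.biorthonormal.tendsto_specPoly_cobounded h.regular n.le_succ a b)
  simpa using this

/-- Existence of the coefficient polynomials, and the matrix `W A_n` in terms of them. -/
theorem spectral (h : s.IsAdmissible n) :
    (s.IsTheta n (s.Theta n) ∧ s.IsThetaStar n (s.ThetaStar n) ∧ s.IsOmega n (s.Omega n) ∧
      s.IsOmegaStar n (s.OmegaStar n)) ∧
    ∀ a, s.specPoly n a 0 = C 2 * X ^ n * s.numPoly n a 1 ∧
      s.specPoly n a 1 = -(C 2 * X ^ n * s.numPoly n a 0) := by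
  have hb := h.biorthonormal
  have hs := h.regular
  have hn : n ≤ n + 1 := n.le_succ
  have hκ := h.kappa_ne_zero
  have hφ := h.phi0_ne_zero
  have hφ' := h.phiBar0_ne_zero
  choose Q hQ hQ0 hQr using h.exists_specPoly_eq
  have e : ∀ a b x, ‖x‖ ≠ 1 → x ^ n * (Q a b).eval x =
      s.W.eval x * (s.pVec n a).derivative.eval x * s.qVec n b x -
      (s.pVec n b).eval x * (s.W.eval x * s.qDeriv n a x - 2 * s.V.eval x * s.qVec n a x) :=
    fun a b x hx => by
      rw [← hb.eval_specPoly hs hn hx, hQ, eval_mul, eval_pow, eval_X]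
  obtain ⟨R, hR⟩ : X ∣ Q 1 1 := by
    rw [X_dvd_iff, coeff_zero_eq_eval_zero, hQ0]; simp [qZero]
  have uniq : ∀ {P P' : ℂ[X]} {c : ℂ} {k : ℕ}, c ≠ 0 →
      (∀ x, ‖x‖ ≠ 1 → 2 * (c / s.kappa n) * x ^ k * P.eval x =
        2 * (c / s.kappa n) * x ^ k * P'.eval x) → P = P' := by
    intro P P' c k hc H
    have h1 : C (2 * (c / s.kappa n)) * X ^ k * P = C (2 * (c / s.kappa n)) * X ^ k * P' :=
      eq_of_eval_eq fun x hx => by simpa only [eval_mul, eval_C, eval_pow, eval_X] using H x hx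
    refine mul_left_cancel₀ (mul_ne_zero ?_ (pow_ne_zero _ X_ne_zero)) h1
    rw [Ne, C_eq_zero]
    exact mul_ne_zero two_ne_zero (div_ne_zero hc hκ)
  set c := s.kappa (n + 1) / s.kappa n with hc
  set θ : ℂ[X] := C (s.kappa n / (2 * s.phi0 (n + 1))) * Q 0 0 with hθ
  set θ' : ℂ[X] := C (s.kappa n / (2 * s.phiBar0 (n + 1))) * R with hθ'
  set ω : ℂ[X] := C c * X * θ + C (1 / 2) * Q 0 1 - s.V with hω
  set ω' : ℂ[X] := C c * θ' + C (1 / 2) * Q 1 0 + s.V with hω'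
  have t1 : s.IsTheta n θ := fun x hx => by
    have e1 := e 0 0 x hx
    rw [h.deriv_eps hx]
    simp only [hθ, eval_mul, eval_C]
    simp only [pVec, qVec, Matrix.cons_val_zero] at e1
    field_simp
    linear_combination e1
  have t2 : s.IsThetaStar n θ' := fun x hx => by
    have e1 := e 1 1 x hx
    rw [hR] at e1
    rw [h.deriv_epsStar hx]
    simp only [hθ', eval_mul, eval_C]
    simp only [pVec, qVec, Matrix.cons_val_one, Matrix.cons_val_zero, eval_mul, eval_X] at e1
    rw [pow_succ]
    field_simp
    linear_combination e1
  have t3 : s.IsOmega n ω := fun x hx => by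
    have e1 := e 0 0 x hx
    have e2 := e 0 1 x hx
    have e3 := hb.casoratian hs hn (Or.inl hx)
    have e4 := hb.eps_succ hs le_rfl (Or.inl hx)
    have e5 := congrArg (fun P : ℂ[X] => P.eval x) (hb.phi_succ hs le_rfl)
    rw [h.deriv_eps hx]
    simp only [pVec, qVec, Matrix.cons_val_one, Matrix.cons_val_zero, eval_mul, eval_X, eval_C,
      eval_add] at e1 e2 e3 e5
    simp only [hω, hθ, eval_mul, eval_C, eval_add, eval_sub, eval_X, hc]
    field_simp
    linear_combination (s.kappa (n + 1) * x) * e1 + s.phi0 (n + 1) * e2 +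
      s.phi0 (n + 1) * s.V.eval x * e3 -
      (s.W.eval x * (s.phi n).derivative.eval x + s.V.eval x * (s.phi n).eval x) * e4 +
      (s.W.eval x * s.qDeriv n 0 x - s.V.eval x * s.eps n x) * e5
  have t4 : s.IsOmegaStar n ω' := fun x hx => by
    have e1 := e 1 1 x hx
    have e2 := e 1 0 x hx
    have e3 := hb.casoratian hs hn (Or.inl hx)
    have e4 := hb.epsStar_succ hs le_rfl (Or.inl hx)
    have e5 := congrArg (fun P : ℂ[X] => P.eval x) (hb.phiStar_succ hs le_rfl)
    rw [h.deriv_epsStar hx]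
    rw [hR] at e1
    simp only [pVec, qVec, Matrix.cons_val_one, Matrix.cons_val_zero, eval_mul, eval_X, eval_C,
      eval_add] at e1 e2 e3 e5
    simp only [hω', hθ', eval_mul, eval_C, eval_add, hc]
    rw [pow_succ]
    field_simp
    linear_combination (s.kappa (n + 1)) * e1 + s.phiBar0 (n + 1) * x * e2 -
      s.phiBar0 (n + 1) * x * s.V.eval x * e3 +
      (s.W.eval x * (s.phiStar n).derivative.eval x + s.V.eval x * (s.phiStar n).eval x) * e4 +
      (s.W.eval x * s.qDeriv n 1 x + s.V.eval x * s.epsStar n x) * e5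
  have T1 : s.IsTheta n (s.Theta n) := Classical.epsilon_spec ⟨θ, t1⟩
  have T2 : s.IsThetaStar n (s.ThetaStar n) := Classical.epsilon_spec ⟨θ', t2⟩
  have T3 : s.IsOmega n (s.Omega n) := Classical.epsilon_spec ⟨ω, t3⟩
  have T4 : s.IsOmegaStar n (s.OmegaStar n) := Classical.epsilon_spec ⟨ω', t4⟩
  refine ⟨⟨T1, T2, T3, T4⟩, ?_⟩
  have E1 : s.Theta n = θ := uniq hφ fun x hx => (T1 x hx).trans (t1 x hx).symm
  have E2 : s.ThetaStar n = θ' := uniq hφ' fun x hx => (T2 x hx).trans (t2 x hx).symm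
  have E3 : s.Omega n = ω := uniq hφ fun x hx => (T3 x hx).trans (t3 x hx).symm
  have E4 : s.OmegaStar n = ω' := uniq hφ' fun x hx => (T4 x hx).trans (t4 x hx).symm
  have F1 : s.numPoly n 0 0 = -(C (1 / 2) * Q 0 1) := by
    change -(s.Omega n + s.V - C c * X * s.Theta n) = _
    rw [E1, E3, hω]; ring
  have F2 : s.numPoly n 0 1 = C (1 / 2) * Q 0 0 := by
    simp only [numPoly, Matrix.cons_val_zero, Matrix.cons_val_one, E1, hθ]
    rw [← mul_assoc, ← C_mul]
    congr 2; field_simp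
  have F3 : s.numPoly n 1 0 = -(C (1 / 2) * Q 1 1) := by
    simp only [numPoly, Matrix.cons_val_zero, Matrix.cons_val_one, E2, hθ', hR]
    rw [mul_mul_mul_comm, ← C_mul, mul_comm X]
    have : s.phiBar0 (n + 1) / s.kappa n * (s.kappa n / (2 * s.phiBar0 (n + 1))) = 1 / 2 := by
      field_simp
    rw [this]
  have F4 : s.numPoly n 1 1 = C (1 / 2) * Q 1 0 := by
    change s.OmegaStar n - s.V - C c * s.ThetaStar n = _
    rw [E2, E4, hω']; ring
  have two : (C 2 : ℂ[X]) * C (1 / 2) = 1 := by rw [← C_mul]; norm_num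
  intro a
  fin_cases a
  · refine ⟨?_, ?_⟩
    · simp only [Fin.zero_eta, F2, hQ]; linear_combination -X ^ n * Q 0 0 * two
    · simp only [Fin.zero_eta, F1, hQ]; linear_combination -X ^ n * Q 0 1 * two
  · refine ⟨?_, ?_⟩
    · simp only [Fin.mk_one, F4, hQ]; linear_combination -X ^ n * Q 1 0 * two
    · simp only [Fin.mk_one, F3, hQ]; linear_combination -X ^ n * Q 1 1 * two

end IsAdmissible

end System

end BOPUC

end

noncomputable section

open Polynomial Filter Set MeasureTheory
open scoped Topology Interval

namespace BOPUC

namespace System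

variable {m : ℕ} {ρ : Fin (m + 1) → ℂ} {s : System m ρ}

namespace IsAdmissible

variable {n : ℕ}

theorem mul_eval_numPoly_one (h : s.IsAdmissible n) (a : Fin 2) (x : ℂ) :
    2 * x ^ n * (s.numPoly n a 1).eval x = (s.specPoly n a 0).eval x := by
  rw [(h.spectral.2 a).1]; simp

theorem mul_eval_numPoly_zero (h : s.IsAdmissible n) (a : Fin 2) (x : ℂ) :
    2 * x ^ n * (s.numPoly n a 0).eval x = -(s.specPoly n a 1).eval x := by
  rw [(h.spectral.2 a).2]; simp

theorem mul_eval_numPoly_z (h : s.IsAdmissible n) (a : Fin 2) (j : Fin (m + 1)) :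
    2 * s.z j ^ n * (s.numPoly n a 0).eval (s.z j) = -(ρ j * s.W.derivative.eval (s.z j) *
        ((s.pVec n 1).eval (s.z j) * s.qVec n a (s.z j))) ∧
      2 * s.z j ^ n * (s.numPoly n a 1).eval (s.z j) = ρ j * s.W.derivative.eval (s.z j) *
        ((s.pVec n 0).eval (s.z j) * s.qVec n a (s.z j)) := by
  rw [h.mul_eval_numPoly_zero, h.mul_eval_numPoly_one,
    h.biorthonormal.eval_specPoly_z h.regular n.le_succ,
    h.biorthonormal.eval_specPoly_z h.regular n.le_succ]
  exact ⟨rfl, rfl⟩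

theorem numPoly_of_specPoly {P R Q : ℂ[X]} (h : P = X ^ n * Q) (h' : P = C 2 * X ^ n * R) :
    R = C (1 / 2) * Q := by
  have h1 : X ^ n * Q = X ^ n * (C 2 * R) := by rw [← h, h']; ring
  rw [mul_left_cancel₀ (pow_ne_zero _ X_ne_zero) h1, ← mul_assoc, ← C_mul]
  norm_num

theorem C_mul_residueSum (c : ℂ) (a : Fin (m + 1) → ℂ) :
    C c * s.residueSum a = s.residueSum fun j => c * a j := by
  simp only [residueSum, Finset.mul_sum, C_mul, mul_assoc]

theorem exists_numPoly_eq (h : s.IsAdmissible n) (a b : Fin 2) :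
    ∃ (c : ℂ) (b' : Fin 2) (Q : ℂ[X]), s.numPoly n a b = C c * Q ∧
      ((b = 0 ∧ b' = 1 ∧ c = -(1 / 2)) ∨ (b = 1 ∧ b' = 0 ∧ c = 1 / 2)) ∧
      Q.eval 0 = (s.pVec n b').eval 0 *
        ((2 * s.V.eval 0 - n * s.W.derivative.eval 0) * s.qZero n a) ∧
      Q = s.residueSum fun j => Q.eval (s.z j) / s.W.derivative.eval (s.z j) := by
  obtain ⟨h1, h2⟩ := h.spectral.2 a
  fin_cases b
  · obtain ⟨Q, hQ, hQ0, hQr⟩ := h.exists_specPoly_eq a 1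
    refine ⟨-(1 / 2), 1, Q, ?_, Or.inl ⟨rfl, rfl, rfl⟩, hQ0, hQr⟩
    have := numPoly_of_specPoly (R := -s.numPoly n a 0) hQ (by rw [h2]; ring)
    rw [C_neg, neg_mul, ← this, neg_neg]; rfl
  · obtain ⟨Q, hQ, hQ0, hQr⟩ := h.exists_specPoly_eq a 0
    exact ⟨1 / 2, 0, Q, numPoly_of_specPoly hQ h1, Or.inr ⟨rfl, rfl, rfl⟩, hQ0, hQr⟩

theorem numPoly_eq_residueSum (h : s.IsAdmissible n) (a b : Fin 2) :
    s.numPoly n a b = s.residueSum fun j =>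
      (s.numPoly n a b).eval (s.z j) / s.W.derivative.eval (s.z j) := by
  obtain ⟨c, b', Q, hQ, -, -, hr⟩ := h.exists_numPoly_eq a b
  have h1 := congrArg (fun P => C c * P) hr
  simp only [C_mul_residueSum] at h1
  rw [hQ]
  refine h1.trans ?_
  congr 1; ext j
  rw [eval_mul, eval_C]; ring

theorem natDegree_numPoly_le (h : s.IsAdmissible n) (a b : Fin 2) :
    (s.numPoly n a b).natDegree ≤ m := by
  rw [h.numPoly_eq_residueSum]; exact natDegree_residueSum_le _

theorem phiStar_eval_zero (h : s.IsAdmissible n) : (s.phiStar n).eval 0 = s.kappa n :=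
  h.biorthonormal.pVec_one_eval_zero n.le_succ

theorem eval_numPoly_zero (h : s.IsAdmissible n) :
    (s.numPoly n 0 0).eval 0 = n * s.W.derivative.eval 0 - 2 * s.V.eval 0 ∧
    (s.numPoly n 0 1).eval 0 =
      (2 * s.V.eval 0 - n * s.W.derivative.eval 0) * (s.phi0 n / s.kappa n) ∧
    (s.numPoly n 1 0).eval 0 = 0 ∧ (s.numPoly n 1 1).eval 0 = 0 := by
  have hκ := h.kappa_ne_zero
  have h1 := h.phiStar_eval_zero
  refine ⟨?_, ?_, ?_, ?_⟩
  · obtain ⟨c, b', Q, hQ, ⟨-, rfl, rfl⟩ | ⟨h0, -⟩, hQ0, -⟩ := h.exists_numPoly_eq 0 0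
    · rw [hQ, eval_mul, hQ0, eval_C]
      simp only [pVec, qZero, Matrix.cons_val_zero, Matrix.cons_val_one, h1]
      field_simp; ring
    · exact absurd h0 (by decide)
  · obtain ⟨c, b', Q, hQ, ⟨h0, -⟩ | ⟨-, rfl, rfl⟩, hQ0, -⟩ := h.exists_numPoly_eq 0 1
    · exact absurd h0 (by decide)
    · rw [hQ, eval_mul, hQ0, eval_C]
      simp only [pVec, qZero, Matrix.cons_val_zero, phi0]
      field_simp
  · obtain ⟨c, b', Q, hQ, -, hQ0, -⟩ := h.exists_numPoly_eq 1 0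
    rw [hQ, eval_mul, hQ0]; simp [qZero]
  · obtain ⟨c, b', Q, hQ, -, hQ0, -⟩ := h.exists_numPoly_eq 1 1
    rw [hQ, eval_mul, hQ0]; simp [qZero]

theorem eval_derivative_W_ne_zero (h : s.IsAdmissible n) (j : Fin (m + 1)) :
    s.W.derivative.eval (s.z j) ≠ 0 := System.eval_derivative_W_ne_zero h.regular.injective j

theorem residue_apply (h : s.IsAdmissible n) (j : Fin (m + 1)) (a b : Fin 2) :
    s.residue n j a b = (s.numPoly n a b).eval (s.z j) / s.W.derivative.eval (s.z j) := by
  have h1 := h.regular.exponent_ne_zero j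
  have h2 := h.eval_derivative_W_ne_zero j
  rw [residue, Matrix.smul_apply, smul_eq_mul, ← eval_numPoly, two_mul_eval_V_z]
  field_simp

theorem A_apply (h : s.IsAdmissible n) {x : ℂ} (hx : ∀ j, x ≠ s.z j) (a b : Fin 2) :
    s.A n x a b = ∑ j, s.residue n j a b / (x - s.z j) := by
  have hW := eval_W_ne_zero hx
  rw [A, Matrix.smul_apply, smul_eq_mul, ← eval_numPoly, h.numPoly_eq_residueSum,
    eval_residueSum _ hx, inv_mul_cancel_left₀ hW]
  exact Finset.sum_congr rfl fun j _ => by rw [h.residue_apply]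

theorem A_apply_eq (n : ℕ) (x : ℂ) (a b : Fin 2) :
    s.A n x a b = (s.numPoly n a b).eval x / s.W.eval x := by
  rw [A, Matrix.smul_apply, smul_eq_mul, ← eval_numPoly, inv_mul_eq_div]

theorem A_eq (h : s.IsAdmissible n) {x : ℂ} (hx : ∀ j, x ≠ s.z j) :
    s.A n x = ∑ j, (x - s.z j)⁻¹ • s.residue n j := by
  ext a b
  rw [h.A_apply hx, Matrix.sum_apply]
  exact Finset.sum_congr rfl fun j _ => by rw [Matrix.smul_apply, smul_eq_mul, inv_mul_eq_div]

theorem residue_zero (h : s.IsAdmissible n) :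
    s.residue n 0 = (ρ 0 / (2 * s.V.eval 0)) •
      !![(n : ℂ) * s.W.derivative.eval 0 - 2 * s.V.eval 0,
          (2 * s.V.eval 0 - (n : ℂ) * s.W.derivative.eval 0) * (s.phi0 n / s.kappa n);
        0, 0] := by
  obtain ⟨h1, h2, h3, h4⟩ := h.eval_numPoly_zero
  rw [residue, h.regular.origin]
  congr 1
  ext a b
  rw [← eval_numPoly]
  fin_cases a <;> fin_cases b
  exacts [h1, h2, h3, h4]

/-- The spectral equations. -/
theorem spectral_eq (h : s.IsAdmissible n) {x : ℂ} (hx : ‖x‖ ≠ 1) (hz : ∀ j, x ≠ s.z j)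
    (a : Fin 2) :
    (s.pVec n a).derivative.eval x =
      s.A n x a 0 * (s.pVec n 0).eval x + s.A n x a 1 * (s.pVec n 1).eval x ∧
    s.qDeriv n a x = 2 * s.V.eval x / s.W.eval x * s.qVec n a x +
      (s.A n x a 0 * s.qVec n 0 x + s.A n x a 1 * s.qVec n 1 x) := by
  have hW := eval_W_ne_zero hz
  have hx0 : x ≠ 0 := by rw [← h.regular.origin]; exact hz 0
  have hx0' : 2 * x ^ n ≠ 0 := mul_ne_zero two_ne_zero (pow_ne_zero _ hx0)
  have h1 := h.mul_eval_numPoly_zero a x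
  have h2 := h.mul_eval_numPoly_one a x
  have h3 := h.biorthonormal.casoratian h.regular n.le_succ (Or.inl hx)
  rw [h.biorthonormal.eval_specPoly h.regular n.le_succ hx] at h1 h2
  simp only [A_apply_eq]
  constructor
  · have h4 : s.W.eval x * (s.pVec n a).derivative.eval x = (s.numPoly n a 0).eval x *
        (s.pVec n 0).eval x + (s.numPoly n a 1).eval x * (s.pVec n 1).eval x := by
      refine mul_left_cancel₀ hx0' ?_
      linear_combination -(s.pVec n 0).eval x * h1 - (s.pVec n 1).eval x * h2 -
        s.W.eval x * (s.pVec n a).derivative.eval x * h3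
    field_simp
    linear_combination h4
  · have h4 : s.W.eval x * s.qDeriv n a x - 2 * s.V.eval x * s.qVec n a x =
        (s.numPoly n a 0).eval x * s.qVec n 0 x + (s.numPoly n a 1).eval x * s.qVec n 1 x := by
      refine mul_left_cancel₀ hx0' ?_
      linear_combination -s.qVec n 0 x * h1 - s.qVec n 1 x * h2 -
        (s.W.eval x * s.qDeriv n a x - 2 * s.V.eval x * s.qVec n a x) * h3
    field_simp
    linear_combination h4

theorem Y_apply_zero (x : ℂ) (a : Fin 2) : s.Y n x a 0 = (s.pVec n a).eval x := by
  fin_cases a <;> simp [Y, pairMatrix, pVec]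

theorem Y_apply_one (x : ℂ) (a : Fin 2) : s.Y n x a 1 = s.qVec n a x / s.w x := by
  fin_cases a <;> simp [Y, pairMatrix, qVec]

theorem hasEntryDerivAt_Y (h : s.IsAdmissible n) {x : ℂ} (hx : ‖x‖ ≠ 1) (hz : ∀ j, x ≠ s.z j)
    (hw : HasDerivAt s.w (2 * s.V.eval x / s.W.eval x * s.w x) x) (hw0 : s.w x ≠ 0) :
    HasEntryDerivAt (fun y => s.Y n y) (s.A n x * s.Y n x) x := by
  intro a b
  obtain ⟨h1, h2⟩ := h.spectral_eq hx hz a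
  rw [Matrix.mul_apply, Fin.sum_univ_two]
  fin_cases b
  · simp only [Fin.zero_eta, Y_apply_zero]
    rw [← h1]
    exact (s.pVec n a).hasDerivAt x
  · simp only [Fin.mk_one, Y_apply_one]
    refine ((h.biorthonormal.hasDerivAt_qVec h.regular n.le_succ hx a).div hw hw0).congr_deriv ?_
    rw [h2]
    field_simp
    ring

/-- The trace of the matrix `W A_n` at a singular point. -/
theorem trace_numPoly (h : s.IsAdmissible n) {j : Fin (m + 1)} (hj : j ≠ 0) :
    (s.numPoly n 0 0).eval (s.z j) + (s.numPoly n 1 1).eval (s.z j) = -(2 * s.V.eval (s.z j)) := by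
  have hz : s.z j ≠ 0 := by rw [← h.regular.origin]; exact h.regular.injective.ne hj
  have h3 := h.biorthonormal.casoratian h.regular n.le_succ (IsGood.of_z j)
  refine mul_left_cancel₀ (mul_ne_zero two_ne_zero (pow_ne_zero n hz)) ?_
  rw [mul_add, (h.mul_eval_numPoly_z 0 j).1, (h.mul_eval_numPoly_z 1 j).2, two_mul_eval_V_z]
  linear_combination -ρ j * s.W.derivative.eval (s.z j) * h3

theorem brackets (h : s.IsAdmissible n) (j : Fin (m + 1)) :
    (s.numPoly n 0 0).eval (s.z j) - (s.numPoly n 1 1).eval (s.z j) = -2 * s.omegaBracket n j ∧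
      s.omegaStarBracket n j = s.omegaBracket n j := by
  by_cases hj : j = 0
  · subst hj
    obtain ⟨h1, -, -, h4⟩ := h.eval_numPoly_zero
    rw [h.regular.origin, h1, h4]
    simp only [omegaBracket, omegaStarBracket, if_true, and_true]
    ring
  · have h1 := h.trace_numPoly hj
    simp only [omegaBracket, omegaStarBracket, if_neg hj]
    simp only [eval_numPoly, numerator, Matrix.of_apply, Matrix.cons_val', Matrix.cons_val_zero,
      Matrix.cons_val_one, Matrix.cons_val_fin_one] at h1 ⊢
    exact ⟨by linear_combination -h1, by linear_combination h1⟩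

end IsAdmissible

end System

end BOPUC

end

noncomputable section

open Polynomial Filter Set MeasureTheory
open scoped Topology Interval Matrix

namespace BOPUC

section Differentiability

variable {ι : Type*} [Fintype ι] [DecidableEq ι] {M : ℝ → Matrix ι ι ℂ} {t : ℝ}

theorem differentiableAt_det (h : ∀ i j, DifferentiableAt ℝ (fun τ => M τ i j) t) :
    DifferentiableAt ℝ (fun τ => (M τ).det) t := by
  simp only [Matrix.det_apply]
  refine DifferentiableAt.fun_sum fun σ _ => DifferentiableAt.const_smul ?_ _
  exact DifferentiableAt.fun_finsetProd fun i _ => h _ _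

theorem differentiableAt_inv_apply (h : ∀ i j, DifferentiableAt ℝ (fun τ => M τ i j) t)
    (h0 : (M t).det ≠ 0) (i j : ι) : DifferentiableAt ℝ (fun τ => (M τ)⁻¹ i j) t := by
  simp only [Matrix.inv_def, Matrix.smul_apply, smul_eq_mul, Ring.inverse_eq_inv',
    Matrix.adjugate_apply]
  refine ((differentiableAt_det h).inv h0).mul (differentiableAt_det fun k l => ?_)
  by_cases hk : k = j
  · subst hk; simp only [Matrix.updateRow_self]; exact differentiableAt_const _
  · simp only [Matrix.updateRow_ne hk]; exact h k l

theorem differentiableAt_of_sq {f : ℝ → ℂ} (h : DifferentiableAt ℝ (fun τ => f τ ^ 2) t)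
    (hc : ContinuousAt f t) (h0 : f t ≠ 0) : DifferentiableAt ℝ f t := by
  have h1 := hasDerivAt_iff_tendsto_slope.1 h.hasDerivAt
  have h2 : Tendsto (fun τ => f τ + f t) (𝓝[≠] t) (𝓝 (f t + f t)) :=
    (hc.tendsto.mono_left nhdsWithin_le_nhds).add_const _
  have h3 : f t + f t ≠ 0 := by rw [← two_mul]; exact mul_ne_zero two_ne_zero h0
  refine (hasDerivAt_iff_tendsto_slope.2 ((h1.div h2 h3).congr' ?_)).differentiableAt
  filter_upwards [h2.eventually_ne h3] with τ hτ
  rw [Pi.div_apply, slope_def_module, slope_def_module, sq, sq, div_eq_iff hτ, smul_mul_assoc]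
  congr 1; ring

end Differentiability

theorem exists_hasPolyDerivAt_of_coeff {d : ℕ} {f : ℝ → ℂ[X]} {t : ℝ}
    (hd : ∀ᶠ τ in 𝓝 t, (f τ).natDegree ≤ d)
    (h : ∀ k ≤ d, DifferentiableAt ℝ (fun τ => (f τ).coeff k) t) :
    ∃ f', HasPolyDerivAt d f f' t := by
  refine exists_hasPolyDerivAt infinite_univ hd fun x _ => ?_
  have h1 : DifferentiableAt ℝ (fun τ => ∑ k ∈ Finset.range (d + 1), (f τ).coeff k * x ^ k) t :=
    DifferentiableAt.fun_sum fun k hk =>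
      (h k (Nat.lt_succ_iff.1 (Finset.mem_range.1 hk))).mul_const _
  refine h1.congr_of_eventuallyEq ?_
  filter_upwards [hd] with τ hτ
  exact eval_eq_sum_range' (Nat.lt_succ_of_le hτ) _

namespace System

variable {m : ℕ} {ρ : Fin (m + 1) → ℂ} {s : System m ρ} {N n : ℕ}

variable (s) in
/-- The Toeplitz matrix of the weight. -/
def toeplitz (n : ℕ) : Matrix (Fin (n + 1)) (Fin (n + 1)) ℂ :=
  Matrix.of fun i j => s.Lam fun ζ => ζ ^ (i : ℕ) / ζ ^ ((j : ℕ) + 1)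

theorem toeplitz_apply (hs : s.IsRegular) (i j : Fin (n + 1)) :
    s.toeplitz n i j = hs.pairing (X ^ (i : ℕ)) (X ^ (j : ℕ)) := by
  rw [hs.pairing_X_pow]; simp [toeplitz]

theorem sum_X_pow_eq {f : ℂ[X]} (hf : f.natDegree ≤ n) :
    ∑ i : Fin (n + 1), f.coeff i • (X : ℂ[X]) ^ (i : ℕ) = f := by
  conv_rhs => rw [f.as_sum_range' (n + 1) (Nat.lt_succ_of_le hf)]
  rw [Fin.sum_univ_eq_sum_range (fun i => f.coeff i • (X : ℂ[X]) ^ i)]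
  exact Finset.sum_congr rfl fun i _ => by rw [smul_eq_C_mul, C_mul_X_pow_eq_monomial]

theorem vecMul_toeplitz (hs : s.IsRegular) {f : ℂ[X]} (hf : f.natDegree ≤ n) (j : Fin (n + 1)) :
    ((fun i : Fin (n + 1) => f.coeff i) ᵥ* s.toeplitz n) j = hs.pairing f (X ^ (j : ℕ)) := by
  conv_rhs => rw [← sum_X_pow_eq hf]
  rw [map_sum, LinearMap.sum_apply, Matrix.vecMul, dotProduct]
  exact Finset.sum_congr rfl fun i _ => by
    rw [map_smul, LinearMap.smul_apply, smul_eq_mul, toeplitz_apply hs]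

theorem toeplitz_mulVec (hs : s.IsRegular) {f : ℂ[X]} (hf : f.natDegree ≤ n) (j : Fin (n + 1)) :
    (s.toeplitz n *ᵥ (fun i : Fin (n + 1) => f.coeff i)) j = hs.pairing (X ^ (j : ℕ)) f := by
  conv_rhs => rw [← sum_X_pow_eq hf]
  rw [map_sum, Matrix.mulVec, dotProduct]
  exact Finset.sum_congr rfl fun i _ => by
    rw [map_smul, smul_eq_mul, toeplitz_apply hs, mul_comm]

namespace IsBiorthonormal

theorem det_toeplitz_ne_zero (hb : s.IsBiorthonormal N) (hs : s.IsRegular) (hn : n ≤ N) :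
    (s.toeplitz n).det ≠ 0 := by
  intro h
  obtain ⟨v, hv, h0⟩ := Matrix.exists_vecMul_eq_zero_iff.2 h
  set q : ℂ[X] := ∑ i : Fin (n + 1), C (v i) * X ^ (i : ℕ) with hq
  have hdeg : q.degree < (n + 1 : ℕ) := by
    refine (Polynomial.degree_sum_le _ _).trans_lt ?_
    rw [Finset.sup_lt_iff (WithBot.bot_lt_coe _)]
    intro i _
    exact (degree_C_mul_X_pow_le _ _).trans_lt (by exact_mod_cast i.2)
  have hco : ∀ i : Fin (n + 1), q.coeff i = v i := fun i => by
    rw [hq, finsetSum_coeff, Finset.sum_eq_single i]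
    · simp
    · intro k _ hk
      rw [coeff_C_mul_X_pow, if_neg]
      exact fun h => hk (Fin.ext h.symm)
    · simp
  have hq0 : q = 0 := by
    refine hb.eq_zero_of_pairing hs hn hdeg fun j hj => ?_
    have h1 := vecMul_toeplitz (n := n) hs (natDegree_le_of_degree_lt_succ hdeg)
      ⟨j, Nat.lt_succ_of_le hj⟩
    rw [← h1]
    simp only [hco, h0, Pi.zero_apply]
  refine hv (funext fun i => ?_)
  rw [← hco, hq0, coeff_zero, Pi.zero_apply]

theorem coeff_phi_eq (hb : s.IsBiorthonormal N) (hs : s.IsRegular) (hn : n ≤ N)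
    (i : Fin (n + 1)) :
    (s.phi n).coeff i = 1 / s.kappa n * (s.toeplitz n)⁻¹ (Fin.last n) i := by
  have hu : IsUnit (s.toeplitz n).det := isUnit_iff_ne_zero.2 (hb.det_toeplitz_ne_zero hs hn)
  have h1 : (fun i : Fin (n + 1) => (s.phi n).coeff i) ᵥ* s.toeplitz n =
      Pi.single (Fin.last n) (1 / s.kappa n) := by
    ext j
    rw [vecMul_toeplitz hs (hb.natDegree_phi n hn).le,
      hb.pairing_phi hs hn (by simpa using Nat.lt_succ_iff.1 j.2), coeff_X_pow]
    by_cases hj : j = Fin.last n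
    · subst hj; simp
    · rw [Pi.single_eq_of_ne hj, if_neg, zero_div]
      exact fun h => hj (Fin.ext h.symm)
  have h2 := congrArg (fun v => (v ᵥ* (s.toeplitz n)⁻¹) i) h1
  simp only [Matrix.vecMul_vecMul, Matrix.mul_nonsing_inv _ hu, Matrix.vecMul_one] at h2
  rw [h2, Matrix.single_vecMul]
  rfl

theorem coeff_phiBar_eq (hb : s.IsBiorthonormal N) (hs : s.IsRegular) (hn : n ≤ N)
    (i : Fin (n + 1)) :
    (s.phiBar n).coeff i = 1 / s.kappa n * (s.toeplitz n)⁻¹ i (Fin.last n) := by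
  have hu : IsUnit (s.toeplitz n).det := isUnit_iff_ne_zero.2 (hb.det_toeplitz_ne_zero hs hn)
  have h1 : s.toeplitz n *ᵥ (fun i : Fin (n + 1) => (s.phiBar n).coeff i) =
      Pi.single (Fin.last n) (1 / s.kappa n) := by
    ext j
    rw [toeplitz_mulVec hs (hb.natDegree_phiBar n hn).le,
      hb.pairing_phiBar hs hn (by simpa using Nat.lt_succ_iff.1 j.2), coeff_X_pow]
    by_cases hj : j = Fin.last n
    · subst hj; simp
    · rw [Pi.single_eq_of_ne hj, if_neg, zero_div]
      exact fun h => hj (Fin.ext h.symm)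
  have h2 := congrArg (fun v => ((s.toeplitz n)⁻¹ *ᵥ v) i) h1
  simp only [Matrix.mulVec_mulVec, Matrix.nonsing_inv_mul _ hu, Matrix.one_mulVec] at h2
  rw [h2, Matrix.mulVec_single]
  simp [mul_comm]

end IsBiorthonormal

end System

/-- A deformation with the polynomials of degree up to `n + 1`. -/
structure IsAdmissibleDeformation {m : ℕ} {ρ : Fin (m + 1) → ℂ} (s : ℝ → System m ρ) (S : Set ℝ)
    (D : Set (ℝ × ℂ)) (n : ℕ) : Prop where
  deformation : IsDeformation s S D
  biorthonormal : ∀ t ∈ S, (s t).IsBiorthonormal (n + 1)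
  continuousOn_kappa : ContinuousOn (fun t => (s t).kappa n) S
  phi0_ne_zero : ∀ t ∈ S, (s t).phi0 (n + 1) ≠ 0
  phiBar0_ne_zero : ∀ t ∈ S, (s t).phiBar0 (n + 1) ≠ 0

namespace IsAdmissibleDeformation

variable {m : ℕ} {ρ : Fin (m + 1) → ℂ} {s : ℝ → System m ρ} {S : Set ℝ} {D : Set (ℝ × ℂ)} {n : ℕ}
  {t : ℝ}

theorem isAdmissible (h : IsAdmissibleDeformation s S D n) (ht : t ∈ S) :
    (s t).IsAdmissible n where
  regular := h.deformation.isRegular ht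
  biorthonormal := h.biorthonormal t ht
  phi0_ne_zero := h.phi0_ne_zero t ht
  phiBar0_ne_zero := h.phiBar0_ne_zero t ht

theorem eventually_mem (h : IsAdmissibleDeformation s S D n) (ht : t ∈ S) : ∀ᶠ τ in 𝓝 t, τ ∈ S :=
  h.deformation.isOpen_times.mem_nhds ht

theorem differentiableAt_inv_toeplitz (h : IsAdmissibleDeformation s S D n) (ht : t ∈ S)
    (i j : Fin (n + 1)) : DifferentiableAt ℝ (fun τ => ((s τ).toeplitz n)⁻¹ i j) t := by
  have ha := h.isAdmissible ht
  refine differentiableAt_inv_apply (fun k l => ?_)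
    (ha.biorthonormal.det_toeplitz_ne_zero ha.regular n.le_succ) i j
  have hg : AnalyticOnNhd ℂ (fun ζ : ℂ => ζ ^ (k : ℕ) / ζ ^ ((l : ℕ) + 1)) (Metric.sphere 0 1) :=
    fun ζ hζ => (analyticAt_id.pow _).div (analyticAt_id.pow _)
      (pow_ne_zero _ (System.sphere_ne_zero (by simpa using hζ)))
  exact (h.deformation.hasDerivAt_Lam ht hg).differentiableAt

theorem differentiableAt_kappa (h : IsAdmissibleDeformation s S D n) (ht : t ∈ S) :
    DifferentiableAt ℝ (fun τ => (s τ).kappa n) t := by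
  refine differentiableAt_of_sq ?_ ((h.continuousOn_kappa).continuousAt
    (h.deformation.isOpen_times.mem_nhds ht)) (h.isAdmissible ht).kappa_ne_zero
  refine (h.differentiableAt_inv_toeplitz ht (Fin.last n) (Fin.last n)).congr_of_eventuallyEq ?_
  filter_upwards [h.eventually_mem ht] with τ hτ
  have ha := h.isAdmissible hτ
  have h1 := ha.biorthonormal.coeff_phi_eq ha.regular n.le_succ (Fin.last n)
  have h2 : (s τ).kappa n = (s τ).kappa n := rfl
  nth_rewrite 1 [System.kappa] at h2
  rw [Fin.val_last, h2, one_div, eq_inv_mul_iff_mul_eq₀ ha.kappa_ne_zero] at h1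
  rw [sq, h1]

theorem differentiableAt_coeff_phi (h : IsAdmissibleDeformation s S D n) (ht : t ∈ S) {k : ℕ}
    (hk : k ≤ n) : DifferentiableAt ℝ (fun τ => ((s τ).phi n).coeff k) t := by
  have h1 := ((differentiableAt_const (1 : ℂ)).fun_div (h.differentiableAt_kappa ht)
    (h.isAdmissible ht).kappa_ne_zero).fun_mul
    (h.differentiableAt_inv_toeplitz ht (Fin.last n) ⟨k, Nat.lt_succ_of_le hk⟩)
  refine h1.congr_of_eventuallyEq ?_
  filter_upwards [h.eventually_mem ht] with τ hτ
  have ha := h.isAdmissible hτ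
  exact ha.biorthonormal.coeff_phi_eq ha.regular n.le_succ ⟨k, Nat.lt_succ_of_le hk⟩

theorem differentiableAt_coeff_phiBar (h : IsAdmissibleDeformation s S D n) (ht : t ∈ S) {k : ℕ}
    (hk : k ≤ n) : DifferentiableAt ℝ (fun τ => ((s τ).phiBar n).coeff k) t := by
  have h1 := ((differentiableAt_const (1 : ℂ)).fun_div (h.differentiableAt_kappa ht)
    (h.isAdmissible ht).kappa_ne_zero).fun_mul
    (h.differentiableAt_inv_toeplitz ht ⟨k, Nat.lt_succ_of_le hk⟩ (Fin.last n))
  refine h1.congr_of_eventuallyEq ?_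
  filter_upwards [h.eventually_mem ht] with τ hτ
  have ha := h.isAdmissible hτ
  exact ha.biorthonormal.coeff_phiBar_eq ha.regular n.le_succ ⟨k, Nat.lt_succ_of_le hk⟩

theorem differentiableAt_phiBar0 (h : IsAdmissibleDeformation s S D n) (ht : t ∈ S) :
    DifferentiableAt ℝ (fun τ => (s τ).phiBar0 n) t := by
  have := h.differentiableAt_coeff_phiBar ht (Nat.zero_le n)
  simp only [coeff_zero_eq_eval_zero] at this
  exact this

theorem exists_hasPolyDerivAt_pVec (h : IsAdmissibleDeformation s S D n) (ht : t ∈ S)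
    (a : Fin 2) : ∃ p', HasPolyDerivAt n (fun τ => (s τ).pVec n a) p' t := by
  refine exists_hasPolyDerivAt_of_coeff ?_ fun k hk => ?_
  · filter_upwards [h.eventually_mem ht] with τ hτ
    exact (h.biorthonormal τ hτ).natDegree_pVec_le n.le_succ a
  · fin_cases a
    · exact h.differentiableAt_coeff_phi ht hk
    · change DifferentiableAt ℝ (fun τ => ((s τ).phiStar n).coeff k) t
      simp only [System.phiStar, coeff_reflect, revAt_le hk]
      exact h.differentiableAt_coeff_phiBar ht (Nat.sub_le n k)

end IsAdmissibleDeformation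

section

variable {m : ℕ} {ρ : Fin (m + 1) → ℂ} {s : ℝ → System m ρ} {S : Set ℝ} {D : Set (ℝ × ℂ)} {t : ℝ}

variable (s) in
/-- The logarithmic time derivative of the weight, up to sign. -/
def timeSum (t : ℝ) (x : ℂ) : ℂ := ∑ j, ρ j * dotz s j t / (x - (s t).z j)

theorem IsDeformation.lamIntegrable_timeSum_mul (hs : IsDeformation s S D) (ht : t ∈ S) {g : ℂ → ℂ}
    (hg : ContinuousOn g (Metric.sphere 0 1)) :
    (s t).LamIntegrable fun ζ => timeSum s t ζ * g ζ := by
  have h1 := System.LamIntegrable.sum (J := Finset.univ) fun j _ =>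
    ((hs.isRegular ht).lamIntegrable_div hg j).const_mul (ρ j * dotz s j t)
  refine h1.congr fun ζ _ _ => ?_
  rw [timeSum, Finset.sum_mul]
  exact Finset.sum_congr rfl fun j _ => by ring

theorem IsDeformation.Lam_timeSum_mul (hs : IsDeformation s S D) (ht : t ∈ S) {g : ℂ → ℂ}
    (hg : ContinuousOn g (Metric.sphere 0 1)) :
    (s t).Lam (fun ζ => timeSum s t ζ * g ζ) =
      ∑ j, ρ j * dotz s j t * (s t).Lam fun ζ => g ζ / (ζ - (s t).z j) := by
  simp only [← System.Lam_const_mul]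
  rw [← System.Lam_sum fun j _ =>
    ((hs.isRegular ht).lamIntegrable_div hg j).const_mul (ρ j * dotz s j t)]
  congr 1; ext ζ
  rw [timeSum, Finset.sum_mul]
  exact Finset.sum_congr rfl fun j _ => by ring

/-- Differentiation of an integral against the weight and a polynomial depending on time. -/
theorem IsDeformation.hasDerivAt_Lam_eval_mul (hs : IsDeformation s S D) (ht : t ∈ S)
    {d : ℕ} {f : ℝ → ℂ[X]} {f' : ℂ[X]} (hf : HasPolyDerivAt d f f' t) {g : ℂ → ℂ}
    (hg : AnalyticOnNhd ℂ g (Metric.sphere 0 1)) :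
    HasDerivAt (fun τ => (s τ).Lam fun ζ => (f τ).eval ζ * g ζ)
      ((s t).Lam fun ζ => (f'.eval ζ - timeSum s t ζ * (f t).eval ζ) * g ζ) t := by
  have hgc := hg.continuousOn
  have ha : ∀ k : ℕ, AnalyticOnNhd ℂ (fun ζ => ζ ^ k * g ζ) (Metric.sphere 0 1) := fun k ζ hζ =>
    (analyticAt_id.pow k).mul (hg ζ hζ)
  have hexp : ∀ τ ∈ S, ∀ P : ℂ[X], P.natDegree ≤ d → (s τ).Lam (fun ζ => P.eval ζ * g ζ) =
      ∑ k ∈ Finset.range (d + 1), P.coeff k * (s τ).Lam fun ζ => ζ ^ k * g ζ := by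
    intro τ hτ P hP
    simp only [← System.Lam_const_mul]
    rw [← System.Lam_sum fun k _ =>
      ((hs.isRegular hτ).lamIntegrable (ha k).continuousOn).const_mul _]
    congr 1; ext ζ
    rw [eval_eq_sum_range' (Nat.lt_succ_of_le hP), Finset.sum_mul]
    exact Finset.sum_congr rfl fun k _ => by ring
  have h1 : HasDerivAt (fun τ => ∑ k ∈ Finset.range (d + 1),
      (f τ).coeff k * (s τ).Lam fun ζ => ζ ^ k * g ζ)
      (∑ k ∈ Finset.range (d + 1), (f'.coeff k * ((s t).Lam fun ζ => ζ ^ k * g ζ) +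
        (f t).coeff k * -∑ j, ρ j * dotz s j t *
          (s t).Lam fun ζ => ζ ^ k * g ζ / (ζ - (s t).z j))) t :=
    HasDerivAt.fun_sum fun k _ => (hf.coeff k).mul (hs.hasDerivAt_Lam ht (ha k))
  refine (h1.congr_of_eventuallyEq ?_).congr_deriv ?_
  · filter_upwards [hf.natDegree_le, hs.isOpen_times.mem_nhds ht] with τ hτ hS
    exact hexp τ hS _ hτ
  · have hP : ContinuousOn (fun ζ => (f t).eval ζ * g ζ) (Metric.sphere 0 1) :=
      (f t).continuousOn.mul hgc
    have h2 : (fun ζ => (f'.eval ζ - timeSum s t ζ * (f t).eval ζ) * g ζ) =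
        fun ζ => f'.eval ζ * g ζ - timeSum s t ζ * ((f t).eval ζ * g ζ) := by ext ζ; ring
    have hP' : ContinuousOn (fun ζ => f'.eval ζ * g ζ) (Metric.sphere 0 1) :=
      f'.continuousOn.mul hgc
    rw [h2, System.Lam_sub ((hs.isRegular ht).lamIntegrable hP')
      (hs.lamIntegrable_timeSum_mul ht hP), hexp t ht _ hf.natDegree_deriv_le,
      Finset.sum_add_distrib, sub_eq_add_neg]
    congr 1
    have h3 : ∀ k, ∑ j, ρ j * dotz s j t * ((s t).Lam fun ζ => ζ ^ k * g ζ / (ζ - (s t).z j)) =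
        (s t).Lam fun ζ => timeSum s t ζ * (ζ ^ k * g ζ) := fun k =>
      (hs.Lam_timeSum_mul ht (ha k).continuousOn).symm
    simp only [h3, mul_neg, Finset.sum_neg_distrib]
    simp only [← System.Lam_const_mul]
    rw [← System.Lam_sum fun k _ => (hs.lamIntegrable_timeSum_mul ht (ha k).continuousOn).const_mul _]
    congr 2; ext ζ
    rw [eval_eq_sum_range' (Nat.lt_succ_of_le hf.natDegree_le.self_of_nhds), Finset.sum_mul,
      Finset.mul_sum]
    exact Finset.sum_congr rfl fun k _ => by ring

end

end BOPUC

end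

noncomputable section

open Polynomial Filter Set MeasureTheory
open scoped Topology Interval

namespace BOPUC

section

variable {m : ℕ} {ρ : Fin (m + 1) → ℂ} (s : ℝ → System m ρ) (n : ℕ) (t : ℝ) (a : Fin 2)

/-- The time derivative of the polynomials `(φ_n, φ*_n)`. -/
def pDot : ℂ[X] := Classical.epsilon fun p' => HasPolyDerivAt n (fun τ => (s τ).pVec n a) p' t

/-- The time derivative of `(φ_n, φ*_n)`, as functions multiplied by the weight. -/
def timeDensity (ζ : ℂ) : ℂ :=
  (pDot s n t a).eval ζ - timeSum s t ζ * ((s t).pVec n a).eval ζ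

/-- The time derivative of the value of `(ε_n, -ε*_n)` at infinity. -/
def qInfDot : Fin 2 → ℂ := ![0, 2 * dotkappa s n t / (s t).kappa n ^ 2]

/-- The time derivative of `(ε_n, -ε*_n)`. -/
def qDot (x : ℂ) : ℂ := 2 * (s t).Lam (fun ζ => timeDensity s n t a ζ / (ζ - x)) + qInfDot s n t a

/-- The mixed derivative of `(ε_n, -ε*_n)`. -/
def qDerivDot (x : ℂ) : ℂ := 2 * (s t).Lam fun ζ => timeDensity s n t a ζ / (ζ - x) ^ 2

end

namespace IsAdmissibleDeformation

variable {m : ℕ} {ρ : Fin (m + 1) → ℂ} {s : ℝ → System m ρ} {S : Set ℝ} {D : Set (ℝ × ℂ)} {n : ℕ}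
  {t : ℝ}

theorem hasPolyDerivAt_pVec (h : IsAdmissibleDeformation s S D n) (ht : t ∈ S) (a : Fin 2) :
    HasPolyDerivAt n (fun τ => (s τ).pVec n a) (pDot s n t a) t :=
  Classical.epsilon_spec (h.exists_hasPolyDerivAt_pVec ht a)

theorem hasDerivAt_kappa (h : IsAdmissibleDeformation s S D n) (ht : t ∈ S) :
    HasDerivAt (fun τ => (s τ).kappa n) (dotkappa s n t) t := (h.differentiableAt_kappa ht).hasDerivAt

theorem hasDerivAt_phiBar0 (h : IsAdmissibleDeformation s S D n) (ht : t ∈ S) :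
    HasDerivAt (fun τ => (s τ).phiBar0 n) (dotphiBar0 s n t) t :=
  (h.differentiableAt_phiBar0 ht).hasDerivAt

theorem hasDerivAt_qInf (h : IsAdmissibleDeformation s S D n) (ht : t ∈ S) (a : Fin 2) :
    HasDerivAt (fun τ => (s τ).qInf n a) (qInfDot s n t a) t := by
  have hκ := (h.isAdmissible ht).kappa_ne_zero
  fin_cases a
  · exact hasDerivAt_const t (0 : ℂ)
  · change HasDerivAt (fun τ => -(2 / (s τ).kappa n)) (2 * dotkappa s n t / (s t).kappa n ^ 2) t
    refine (((hasDerivAt_const t (2 : ℂ)).fun_div (h.hasDerivAt_kappa ht) hκ).fun_neg).congr_deriv ?_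
    field_simp; ring

theorem circleIntegrable_timeDensity (h : IsAdmissibleDeformation s S D n) (ht : t ∈ S)
    (a : Fin 2) {g : ℂ → ℂ} (hg : ContinuousOn g (Metric.sphere 0 1)) :
    CircleIntegrable (fun ζ => (s t).w ζ * (timeDensity s n t a ζ * g ζ)) 0 1 := by
  have h1 := (h.isAdmissible ht).regular.lamIntegrable (((pDot s n t a).continuousOn).mul hg)
  have h2 := (h.deformation.lamIntegrable_timeSum_mul ht
    (g := fun ζ => ((s t).pVec n a).eval ζ * g ζ) (((s t).pVec n a).continuousOn.mul hg)).const_mul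
    (-1)
  refine (h1.add h2).congr fun ζ _ _ => ?_
  simp only [Pi.mul_apply, timeDensity]; ring

theorem circleIntegrable_timeDensity' (h : IsAdmissibleDeformation s S D n) (ht : t ∈ S)
    (a : Fin 2) : CircleIntegrable (fun ζ => (s t).w ζ * timeDensity s n t a ζ) 0 1 := by
  simpa using h.circleIntegrable_timeDensity ht a (g := fun _ => 1) continuousOn_const

theorem hasDerivAt_Lam_pVec (h : IsAdmissibleDeformation s S D n) (ht : t ∈ S) (a : Fin 2)
    {g : ℂ → ℂ} (hg : AnalyticOnNhd ℂ g (Metric.sphere 0 1)) :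
    HasDerivAt (fun τ => (s τ).Lam fun ζ => ((s τ).pVec n a).eval ζ * g ζ)
      ((s t).Lam fun ζ => timeDensity s n t a ζ * g ζ) t :=
  h.deformation.hasDerivAt_Lam_eval_mul ht (h.hasPolyDerivAt_pVec ht a) hg

theorem hasDerivAt_qVec_time (h : IsAdmissibleDeformation s S D n) (ht : t ∈ S) (a : Fin 2)
    {x : ℂ} (hx : ‖x‖ ≠ 1) :
    HasDerivAt (fun τ => (s τ).qVec n a x) (qDot s n t a x) t := by
  have h1 := ((h.hasDerivAt_Lam_pVec ht a (System.analyticOnNhd_inv_sub hx)).const_mul 2).add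
    (h.hasDerivAt_qInf ht a)
  refine h1.congr_of_eventuallyEq ?_
  filter_upwards [h.eventually_mem ht] with τ hτ
  have ha := h.isAdmissible hτ
  exact ha.biorthonormal.qVec_eq ha.regular n.le_succ (Or.inl hx) a

theorem hasDerivAt_qDeriv_time (h : IsAdmissibleDeformation s S D n) (ht : t ∈ S) (a : Fin 2)
    {x : ℂ} (hx : ‖x‖ ≠ 1) :
    HasDerivAt (fun τ => (s τ).qDeriv n a x) (qDerivDot s n t a x) t := by
  have hg : AnalyticOnNhd ℂ (fun ζ => ((ζ - x) ^ 2)⁻¹) (Metric.sphere 0 1) := fun ζ hζ =>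
    ((analyticAt_id.sub analyticAt_const).pow 2).inv
      (pow_ne_zero _ (sub_ne_zero_of_norm (by simpa using hζ) hx))
  exact (h.hasDerivAt_Lam_pVec ht a hg).const_mul 2

theorem qDot_eq_cauchy (a : Fin 2) (x : ℂ) : qDot s n t a x =
    2 * cauchy (fun ζ => (s t).w ζ * timeDensity s n t a ζ) x + qInfDot s n t a := by
  rw [qDot, System.Lam_div_eq_cauchy]

theorem hasDerivAt_qDot (h : IsAdmissibleDeformation s S D n) (ht : t ∈ S) (a : Fin 2)
    {x : ℂ} (hx : ‖x‖ ≠ 1) : HasDerivAt (qDot s n t a) (qDerivDot s n t a x) x := by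
  have h1 := ((hasDerivAt_cauchy (h.circleIntegrable_timeDensity' ht a) hx).const_mul 2).add_const
    (qInfDot s n t a)
  rw [← System.Lam_div_sq_eq_cauchyDeriv] at h1
  exact h1.congr_of_eventuallyEq (Eventually.of_forall fun y => qDot_eq_cauchy a y)

theorem tendsto_qDot (h : IsAdmissibleDeformation s S D n) (ht : t ∈ S) (a : Fin 2) :
    Tendsto (qDot s n t a) (Bornology.cobounded ℂ) (𝓝 (qInfDot s n t a)) := by
  have h1 := ((tendsto_cauchy (h.circleIntegrable_timeDensity' ht a)).const_mul 2).add_const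
    (qInfDot s n t a)
  rw [mul_zero, zero_add] at h1
  exact h1.congr fun x => (qDot_eq_cauchy a x).symm

theorem tendsto_qDot_div_pow (h : IsAdmissibleDeformation s S D n) (ht : t ∈ S) (a : Fin 2) :
    ∃ c, Tendsto (fun x => qDot s n t a x / x ^ n) (𝓝[≠] 0) (𝓝 c) ∧ (a = 1 → c = 0) := by
  set k : ℂ → ℂ := fun ζ => (s t).w ζ * (timeDensity s n t a ζ * (ζ ^ (n + (a : ℕ)))⁻¹) with hk
  have han : AnalyticOnNhd ℂ (fun ζ : ℂ => (ζ ^ (n + (a : ℕ)))⁻¹) (Metric.sphere 0 1) :=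
    fun ζ hζ => (analyticAt_id.pow _).inv
      (pow_ne_zero _ (System.sphere_ne_zero (by simpa using hζ)))
  have hki : CircleIntegrable k 0 1 := h.circleIntegrable_timeDensity ht a han.continuousOn
  refine ⟨2 * (0 ^ (a : ℕ) * cauchy k 0), ?_, ?_⟩
  · have h1 : ContinuousAt (fun x => 2 * (x ^ (a : ℕ) * cauchy k x)) 0 :=
      continuousAt_const.mul ((continuousAt_id.pow _).mul
        (hasDerivAt_cauchy hki (by simp)).continuousAt)
    refine (h1.tendsto.mono_left nhdsWithin_le_nhds).congr' ?_
    filter_upwards [eventually_norm_ne_one_zero, self_mem_nhdsWithin] with x hx hx0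
    have hx0 : x ≠ 0 := hx0
    have h2 : HasDerivAt (fun τ => (s τ).qVec n a x)
        (2 * (x ^ (n + (a : ℕ)) * cauchy k x)) t := by
      have h3 := ((h.hasDerivAt_Lam_pVec ht a
        (han.mul (System.analyticOnNhd_inv_sub hx))).const_mul (x ^ (n + (a : ℕ)))).const_mul 2
      refine (h3.congr_of_eventuallyEq ?_).congr_deriv ?_
      · filter_upwards [h.eventually_mem ht] with τ hτ
        have ha := h.isAdmissible hτ
        rw [ha.biorthonormal.qVec_eq_pow ha.regular n.le_succ (Or.inl hx) a]
        congr 3; ext ζ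
        rw [← mul_assoc, div_eq_mul_inv, div_eq_mul_inv]
      · simp only [System.Lam, cauchy, hk, mul_assoc]
    rw [(h.hasDerivAt_qVec_time ht a hx).unique h2, pow_add]
    field_simp
  · rintro rfl; simp

end IsAdmissibleDeformation

end BOPUC

end

noncomputable section

open Polynomial Filter Set MeasureTheory
open scoped Topology Interval

namespace BOPUC

section

variable {m : ℕ} {ρ : Fin (m + 1) → ℂ} (s : ℝ → System m ρ) (n : ℕ) (t : ℝ)

/-- The polynomial `W ∑_j ρ_j ż_j / (x - z_j)`. -/
def timeSumPoly : ℂ[X] := (s t).residueSum fun j => ρ j * dotz s j t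

/-- The polynomial `W ṗ_a q_b - p_b (W q̇_a + W σ q_a)`, where `ẇ = -σ w`. -/
def timePoly (a b : Fin 2) : ℂ[X] :=
  C 2 * ((s t).W * pDot s n t a * (s t).alpha n b) - (s t).pVec n b *
    (C 2 * ((s t).W * (s t).secondKind (pDot s n t a)) + C (qInfDot s n t a) * (s t).W +
      (s t).residueSum fun j => ρ j * dotz s j t * (s t).qVec n a ((s t).z j))

/-- The value of `timePoly / (x ^ n W)` at infinity. -/
def timeLimit (a b : Fin 2) : ℂ :=
  (pDot s n t a).coeff n * (s t).qInf n b - ((s t).pVec n b).coeff n * qInfDot s n t a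

end

namespace IsAdmissibleDeformation

variable {m : ℕ} {ρ : Fin (m + 1) → ℂ} {s : ℝ → System m ρ} {S : Set ℝ} {D : Set (ℝ × ℂ)} {n : ℕ}
  {t : ℝ}

theorem eval_timeSumPoly {x : ℂ} (hz : ∀ j, x ≠ (s t).z j) :
    (timeSumPoly s t).eval x = (s t).W.eval x * timeSum s t x :=
  System.eval_residueSum _ hz

theorem Lam_div_div (h : IsAdmissibleDeformation s S D n) (ht : t ∈ S) (a : Fin 2) {x : ℂ}
    (hx : ‖x‖ ≠ 1) {j : Fin (m + 1)} (hj : x ≠ (s t).z j) :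
    2 * (s t).Lam (fun ζ => ((s t).pVec n a).eval ζ / (ζ - x) / (ζ - (s t).z j)) =
      ((s t).qVec n a x - (s t).qVec n a ((s t).z j)) / (x - (s t).z j) := by
  have ha := h.isAdmissible ht
  have h1 : (s t).Lam (fun ζ => ((s t).pVec n a).eval ζ / (ζ - x) / (ζ - (s t).z j)) =
      (s t).Lam (fun ζ => (x - (s t).z j)⁻¹ * (((s t).pVec n a).eval ζ / (ζ - x) -
        ((s t).pVec n a).eval ζ / (ζ - (s t).z j))) := by
    refine System.Lam_congr fun ζ hζ hn => ?_
    have h2 := sub_ne_zero_of_norm hζ hx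
    have h3 := sub_ne_zero.2 (hn j)
    have h4 := sub_ne_zero.2 hj
    field_simp
    ring
  rw [h1, System.Lam_const_mul, System.Lam_sub
    (ha.regular.lamIntegrable_div_sub ((s t).pVec n a).continuousOn (Or.inl hx))
    (ha.regular.lamIntegrable_div ((s t).pVec n a).continuousOn j),
    ha.biorthonormal.qVec_eq ha.regular n.le_succ (Or.inl hx),
    ha.biorthonormal.qVec_eq ha.regular n.le_succ (System.IsGood.of_z j)]
  ring

theorem mul_qDot (h : IsAdmissibleDeformation s S D n) (ht : t ∈ S) (a : Fin 2) {x : ℂ}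
    (hx : ‖x‖ ≠ 1) : (s t).W.eval x * qDot s n t a x +
      (timeSumPoly s t).eval x * (s t).qVec n a x =
      2 * (s t).W.eval x * ((pDot s n t a).eval x * (s t).G x +
        ((s t).secondKind (pDot s n t a)).eval x) + qInfDot s n t a * (s t).W.eval x +
      ((s t).residueSum fun j => ρ j * dotz s j t * (s t).qVec n a ((s t).z j)).eval x := by
  have ha := h.isAdmissible ht
  by_cases hz : ∀ j, x ≠ (s t).z j
  · have hc : ContinuousOn (fun ζ => ((s t).pVec n a).eval ζ * (ζ - x)⁻¹) (Metric.sphere 0 1) :=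
      ((s t).pVec n a).continuousOn.mul (System.continuousOn_inv_sub hx)
    have h1 : (fun ζ => timeDensity s n t a ζ / (ζ - x)) = fun ζ =>
        (pDot s n t a).eval ζ / (ζ - x) -
          timeSum s t ζ * (((s t).pVec n a).eval ζ * (ζ - x)⁻¹) := by
      ext ζ; rw [timeDensity]; ring
    have h2 : 2 * ∑ j, ρ j * dotz s j t *
        (s t).Lam (fun ζ => ((s t).pVec n a).eval ζ * (ζ - x)⁻¹ / (ζ - (s t).z j)) =
        timeSum s t x * (s t).qVec n a x -
          ∑ j, ρ j * dotz s j t * (s t).qVec n a ((s t).z j) / (x - (s t).z j) := by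
      rw [timeSum, Finset.sum_mul, ← Finset.sum_sub_distrib, Finset.mul_sum]
      refine Finset.sum_congr rfl fun j _ => ?_
      have h3 := h.Lam_div_div ht a hx (hz j)
      simp only [← div_eq_mul_inv]
      rw [mul_left_comm, h3]; ring
    rw [qDot, h1, System.Lam_sub (ha.regular.lamIntegrable_div_sub (pDot s n t a).continuousOn
        (Or.inl hx)) (h.deformation.lamIntegrable_timeSum_mul ht hc),
      h.deformation.Lam_timeSum_mul ht hc, ha.regular.Lam_eval_div _ (Or.inl hx),
      eval_timeSumPoly hz, System.eval_residueSum _ hz]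
    linear_combination -(s t).W.eval x * h2
  · push Not at hz
    obtain ⟨j, rfl⟩ := hz
    rw [timeSumPoly, System.eval_W_z, System.eval_residueSum_z, System.eval_residueSum_z]
    ring

theorem eval_timePoly (h : IsAdmissibleDeformation s S D n) (ht : t ∈ S) (a b : Fin 2) {x : ℂ}
    (hx : ‖x‖ ≠ 1) : (timePoly s n t a b).eval x =
      (s t).W.eval x * (pDot s n t a).eval x * (s t).qVec n b x - ((s t).pVec n b).eval x *
        ((s t).W.eval x * qDot s n t a x + (timeSumPoly s t).eval x * (s t).qVec n a x) := by
  have ha := h.isAdmissible ht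
  rw [h.mul_qDot ht a hx, ha.biorthonormal.qVec_eq_alpha ha.regular n.le_succ (Or.inl hx) b]
  simp only [timePoly, eval_mul, eval_sub, eval_add, eval_C]
  ring

theorem eval_timePoly_z (h : IsAdmissibleDeformation s S D n) (ht : t ∈ S) (a b : Fin 2)
    (j : Fin (m + 1)) : (timePoly s n t a b).eval ((s t).z j) =
      -(dotz s j t * ((s t).specPoly n a b).eval ((s t).z j)) := by
  have ha := h.isAdmissible ht
  rw [ha.biorthonormal.eval_specPoly_z ha.regular n.le_succ]
  simp only [timePoly, eval_mul, eval_sub, eval_add, eval_C, System.eval_residueSum_z,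
    System.eval_W_z]
  ring

theorem eval_timeSumPoly_zero (h : IsAdmissibleDeformation s S D n) (ht : t ∈ S) :
    (timeSumPoly s t).eval 0 = 0 := by
  have h0 := h.deformation.origin t ht
  have := System.eval_residueSum_z (s := s t) (fun j => ρ j * dotz s j t) 0
  rw [h0, h.deformation.dotz_zero ht] at this
  rw [timeSumPoly, this]; ring

theorem tendsto_timePoly_zero (h : IsAdmissibleDeformation s S D n) (ht : t ∈ S) (a b : Fin 2) :
    Tendsto (fun x => (timePoly s n t a b).eval x / x ^ n) (𝓝[≠] 0) (𝓝 0) := by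
  have ha := h.isAdmissible ht
  obtain ⟨c, hc, -⟩ := h.tendsto_qDot_div_pow ht a
  have hq := fun a => ha.biorthonormal.tendsto_qVec_div_pow ha.regular n.le_succ a
  have hW : (s t).W.eval 0 = 0 := by simpa [ha.regular.origin] using (s t).eval_W_z 0
  have h1 := ((tendsto_eval_punctured (s t).W).mul (tendsto_eval_punctured (pDot s n t a))).mul
    (hq b)
  have h2 := (tendsto_eval_punctured ((s t).pVec n b)).mul
    (((tendsto_eval_punctured (s t).W).mul hc).add
      ((tendsto_eval_punctured (timeSumPoly s t)).mul (hq a)))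
  have h3 := h1.sub h2
  simp only [hW, h.eval_timeSumPoly_zero ht, zero_mul, add_zero, mul_zero, sub_zero] at h3
  refine h3.congr' ?_
  filter_upwards [eventually_norm_ne_one_zero] with x hx
  rw [h.eval_timePoly ht a b hx]
  ring

theorem tendsto_timePoly_cobounded (h : IsAdmissibleDeformation s S D n) (ht : t ∈ S)
    (a b : Fin 2) : Tendsto (fun x => (timePoly s n t a b).eval x / (x ^ n * (s t).W.eval x))
      (Bornology.cobounded ℂ) (𝓝 (timeLimit s n t a b)) := by
  have ha := h.isAdmissible ht
  have hq := fun a => ha.biorthonormal.tendsto_qVec ha.regular n.le_succ a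
  have h1 := (tendsto_eval_div_pow (h.hasPolyDerivAt_pVec ht a).natDegree_deriv_le).mul (hq b)
  have h2 := (tendsto_eval_div_pow (ha.biorthonormal.natDegree_pVec_le n.le_succ b)).mul
    ((h.tendsto_qDot ht a).add
      (((s t).tendsto_residue_sum fun j => ρ j * dotz s j t).mul (hq a)))
  have h3 := h1.sub h2
  rw [zero_mul, add_zero] at h3
  refine h3.congr' ?_
  filter_upwards [eventually_norm_ne_one_cobounded, (s t).eventually_ne_z, eventually_two_lt_norm]
    with x hx hz hx2
  have hW := System.eval_W_ne_zero hz
  have hx0 : x ≠ 0 := by rintro rfl; simp at hx2; linarith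
  rw [h.eval_timePoly ht a b hx, eval_timeSumPoly hz, timeSum]
  field_simp

theorem deriv_coeff_pVec (h : IsAdmissibleDeformation s S D n) (ht : t ∈ S) :
    (pDot s n t 0).coeff n = dotkappa s n t ∧ (pDot s n t 1).coeff n = dotphiBar0 s n t ∧
      (pDot s n t 1).eval 0 = dotkappa s n t := by
  refine ⟨?_, ?_, ?_⟩
  · exact ((h.hasPolyDerivAt_pVec ht 0).coeff n).unique (h.hasDerivAt_kappa ht)
  · refine ((h.hasPolyDerivAt_pVec ht 1).coeff n).unique
      ((h.hasDerivAt_phiBar0 ht).congr_of_eventuallyEq (Eventually.of_forall fun τ => ?_))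
    exact System.IsBiorthonormal.coeff_phiStar n
  · refine ((h.hasPolyDerivAt_pVec ht 1).eval 0).unique
      ((h.hasDerivAt_kappa ht).congr_of_eventuallyEq ?_)
    filter_upwards [h.eventually_mem ht] with τ hτ
    exact (h.biorthonormal τ hτ).pVec_one_eval_zero n.le_succ

theorem Binf_eq (h : IsAdmissibleDeformation s S D n) (ht : t ∈ S) (a : Fin 2) :
    timeLimit s n t a 1 = -(2 * Binf s n t a 0) ∧ timeLimit s n t a 0 = 2 * Binf s n t a 1 := by
  have ha := h.isAdmissible ht
  have hκ := ha.kappa_ne_zero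
  obtain ⟨h1, h2, -⟩ := h.deriv_coeff_pVec ht
  have h3 : ((s t).pVec n 0).coeff n = (s t).kappa n := rfl
  have h4 : ((s t).pVec n 1).coeff n = (s t).phiBar0 n := System.IsBiorthonormal.coeff_phiStar n
  fin_cases a
  · simp only [timeLimit, Binf, Fin.zero_eta, h1, h3, h4, System.qInf, qInfDot, Matrix.of_apply,
      Matrix.cons_val', Matrix.cons_val_zero, Matrix.cons_val_one, Matrix.cons_val_fin_one]
    constructor
    · field_simp; ring
    · ring
  · simp only [timeLimit, Binf, Fin.mk_one, h2, h3, h4, System.qInf, qInfDot, Matrix.of_apply,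
      Matrix.cons_val', Matrix.cons_val_zero, Matrix.cons_val_one, Matrix.cons_val_fin_one]
    constructor
    · field_simp; ring
    · field_simp; ring

theorem exists_timePoly_eq (h : IsAdmissibleDeformation s S D n) (ht : t ∈ S) (a b : Fin 2) :
    ∃ Q : ℂ[X], timePoly s n t a b = X ^ n * Q ∧ Q.eval 0 = 0 ∧
      Q = C (timeLimit s n t a b) * (s t).W +
        (s t).residueSum fun j => Q.eval ((s t).z j) / (s t).W.derivative.eval ((s t).z j) :=
  System.exists_quotient (h.isAdmissible ht).regular.injective (h.tendsto_timePoly_zero ht a b)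
    (h.tendsto_timePoly_cobounded ht a b)

theorem B_apply (x : ℂ) (a b : Fin 2) :
    B s n t x a b = Binf s n t a b -
      ∑ j, dotz s j t * (s t).residue n j a b / (x - (s t).z j) := by
  rw [B, Matrix.sub_apply, Matrix.sum_apply]
  congr 1
  exact Finset.sum_congr rfl fun j _ => by rw [Matrix.smul_apply, smul_eq_mul]; ring

/-- If `P = X ^ n Q` takes the value `- 2 z_j ^ n ż_j c_j` at the singular points, then `Q / W` is
determined. -/
theorem quotient_eq (h : IsAdmissibleDeformation s S D n) (ht : t ∈ S) {P Q : ℂ[X]} {l : ℂ}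
    {c : Fin (m + 1) → ℂ} (hP : P = X ^ n * Q) (hQ0 : Q.eval 0 = 0)
    (hQ : Q = C l * (s t).W +
      (s t).residueSum fun j => Q.eval ((s t).z j) / (s t).W.derivative.eval ((s t).z j))
    (hc : ∀ j, P.eval ((s t).z j) = -(dotz s j t * (2 * (s t).z j ^ n *
      (c j * (s t).W.derivative.eval ((s t).z j))))) {x : ℂ} (hz : ∀ j, x ≠ (s t).z j) :
    P.eval x = x ^ n * ((s t).W.eval x * (l - 2 * ∑ j, dotz s j t * c j / (x - (s t).z j))) := by
  have ha := h.isAdmissible ht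
  have h1 : ∀ j, Q.eval ((s t).z j) / (s t).W.derivative.eval ((s t).z j) =
      -(2 * (dotz s j t * c j)) := by
    intro j
    have hW := ha.eval_derivative_W_ne_zero j
    rw [div_eq_iff hW]
    by_cases hj : j = 0
    · subst hj
      rw [ha.regular.origin, hQ0, h.deformation.dotz_zero ht]; ring
    · have hzj : (s t).z j ≠ 0 := by rw [← ha.regular.origin]; exact ha.regular.injective.ne hj
      refine mul_left_cancel₀ (pow_ne_zero n hzj) ?_
      have h2 := hc j
      rw [hP, eval_mul, eval_pow, eval_X] at h2
      rw [h2]; ring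
  simp only [h1] at hQ
  have h2 : ∑ j, -(2 * (dotz s j t * c j)) / (x - (s t).z j) =
      -(2 * ∑ j, dotz s j t * c j / (x - (s t).z j)) := by
    rw [Finset.mul_sum, ← Finset.sum_neg_distrib]
    exact Finset.sum_congr rfl fun j _ => by ring
  rw [hP, eval_mul, eval_pow, eval_X, hQ, eval_add, eval_mul, eval_C, System.eval_residueSum _ hz,
    h2]
  ring

theorem eval_timePoly_eq (h : IsAdmissibleDeformation s S D n) (ht : t ∈ S) (a : Fin 2) {x : ℂ}
    (hz : ∀ j, x ≠ (s t).z j) :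
    (timePoly s n t a 0).eval x = 2 * x ^ n * (s t).W.eval x * B s n t x a 1 ∧
    (timePoly s n t a 1).eval x = -(2 * x ^ n * (s t).W.eval x * B s n t x a 0) := by
  have ha := h.isAdmissible ht
  have hB := h.Binf_eq ht a
  constructor
  · obtain ⟨Q, hQ, hQ0, hQr⟩ := h.exists_timePoly_eq ht a 0
    rw [h.quotient_eq ht (c := fun j => (s t).residue n j a 1) hQ hQ0 hQr (fun j => ?_) hz, hB.2,
      B_apply]
    · ring
    · have hW := ha.eval_derivative_W_ne_zero j
      rw [h.eval_timePoly_z ht, ← ha.mul_eval_numPoly_one, ha.residue_apply, div_mul_cancel₀ _ hW]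
  · obtain ⟨Q, hQ, hQ0, hQr⟩ := h.exists_timePoly_eq ht a 1
    rw [h.quotient_eq ht (c := fun j => -(s t).residue n j a 0) hQ hQ0 hQr (fun j => ?_) hz, hB.1,
      B_apply]
    · simp only [mul_neg, neg_div, Finset.sum_neg_distrib]; ring
    · have hW := ha.eval_derivative_W_ne_zero j
      have h1 := ha.mul_eval_numPoly_zero a ((s t).z j)
      rw [h.eval_timePoly_z ht, ha.residue_apply, neg_mul, div_mul_cancel₀ _ hW]
      linear_combination -dotz s j t * h1

/-- The matrix `B_n` in terms of the time derivatives. -/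
theorem two_mul_B (h : IsAdmissibleDeformation s S D n) (ht : t ∈ S) (a : Fin 2) {x : ℂ}
    (hx : ‖x‖ ≠ 1) (hz : ∀ j, x ≠ (s t).z j) :
    2 * x ^ n * B s n t x a 1 = (pDot s n t a).eval x * (s t).qVec n 0 x -
      ((s t).pVec n 0).eval x * (qDot s n t a x + timeSum s t x * (s t).qVec n a x) ∧
    2 * x ^ n * B s n t x a 0 = -((pDot s n t a).eval x * (s t).qVec n 1 x -
      ((s t).pVec n 1).eval x * (qDot s n t a x + timeSum s t x * (s t).qVec n a x)) := by
  have hW := System.eval_W_ne_zero hz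
  obtain ⟨h1, h2⟩ := h.eval_timePoly_eq ht a hz
  rw [h.eval_timePoly ht _ _ hx, eval_timeSumPoly hz] at h1 h2
  constructor
  · refine mul_left_cancel₀ hW ?_
    linear_combination -h1
  · refine mul_left_cancel₀ hW ?_
    linear_combination h2

/-- The deformation equations. -/
theorem time_eq (h : IsAdmissibleDeformation s S D n) (ht : t ∈ S) (a : Fin 2) {x : ℂ}
    (hx : ‖x‖ ≠ 1) (hz : ∀ j, x ≠ (s t).z j) :
    (pDot s n t a).eval x = B s n t x a 0 * ((s t).pVec n 0).eval x +
      B s n t x a 1 * ((s t).pVec n 1).eval x ∧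
    qDot s n t a x = -timeSum s t x * (s t).qVec n a x +
      (B s n t x a 0 * (s t).qVec n 0 x + B s n t x a 1 * (s t).qVec n 1 x) := by
  have ha := h.isAdmissible ht
  have hx0 : x ≠ 0 := by rw [← ha.regular.origin]; exact hz 0
  have hx0' : 2 * x ^ n ≠ 0 := mul_ne_zero two_ne_zero (pow_ne_zero _ hx0)
  obtain ⟨h1, h2⟩ := h.two_mul_B ht a hx hz
  have h3 := ha.biorthonormal.casoratian ha.regular n.le_succ (Or.inl hx)
  constructor
  · refine mul_left_cancel₀ hx0' ?_
    linear_combination -((s t).pVec n 1).eval x * h1 - ((s t).pVec n 0).eval x * h2 -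
      (pDot s n t a).eval x * h3
  · refine mul_left_cancel₀ hx0' ?_
    linear_combination -(s t).qVec n 1 x * h1 - (s t).qVec n 0 x * h2 -
      (qDot s n t a x + timeSum s t x * (s t).qVec n a x) * h3

theorem tendsto_sum_dotz_div (h : IsAdmissibleDeformation s S D n) (ht : t ∈ S)
    (c : Fin (m + 1) → ℂ) : Tendsto (fun x => ∑ j, dotz s j t * c j / (x - (s t).z j)) (𝓝[≠] 0)
      (𝓝 (∑ j, dotz s j t * c j / (0 - (s t).z j))) := by
  have ha := h.isAdmissible ht
  refine tendsto_finsetSum _ fun j _ => ?_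
  by_cases hj : j = 0
  · subst hj; simp [h.deformation.dotz_zero ht]
  · have hzj : (s t).z j ≠ 0 := by rw [← ha.regular.origin]; exact ha.regular.injective.ne hj
    refine Tendsto.div tendsto_const_nhds ?_ (by simpa using hzj)
    exact (tendsto_id.mono_left nhdsWithin_le_nhds).sub_const _

/-- The second row of the matrix `B_n` at the origin. -/
theorem B_zero (h : IsAdmissibleDeformation s S D n) (ht : t ∈ S) :
    B s n t 0 1 0 = 0 ∧ B s n t 0 1 1 = dotkappa s n t / (s t).kappa n := by
  have ha := h.isAdmissible ht
  have hκ := ha.kappa_ne_zero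
  obtain ⟨c, hc, hc0⟩ := h.tendsto_qDot_div_pow ht 1
  rw [hc0 rfl] at hc
  have hq := fun a => ha.biorthonormal.tendsto_qVec_div_pow ha.regular n.le_succ a
  have hσ : Tendsto (timeSum s t) (𝓝[≠] 0) (𝓝 (timeSum s t 0)) := by
    have := h.tendsto_sum_dotz_div ht ρ
    simp only [mul_comm (dotz s _ t)] at this
    exact this
  have hB : ∀ b, Tendsto (fun x => B s n t x 1 b) (𝓝[≠] 0) (𝓝 (B s n t 0 1 b)) := fun b => by
    simp only [B_apply]
    exact (h.tendsto_sum_dotz_div ht _).const_sub _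
  have hev : ∀ᶠ x : ℂ in 𝓝[≠] 0, x ≠ 0 ∧ ‖x‖ ≠ 1 ∧ ∀ j, x ≠ (s t).z j := by
    refine Eventually.and self_mem_nhdsWithin (eventually_norm_ne_one_zero.and (eventually_all.2 fun j => ?_))
    by_cases hj : j = 0
    · subst hj; rw [ha.regular.origin]; exact self_mem_nhdsWithin
    · have hzj : (0 : ℂ) ≠ (s t).z j := by
        rw [← ha.regular.origin]; exact ha.regular.injective.ne (Ne.symm hj)
      exact mem_nhdsWithin_of_mem_nhds (isOpen_ne.mem_nhds hzj)
  have key := (hc.add (hσ.mul (hq 1)))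
  constructor
  · refine tendsto_nhds_unique (hB 0) ?_
    have h1 := ((tendsto_eval_punctured (pDot s n t 1)).mul (hq 1)).sub
      ((tendsto_eval_punctured ((s t).pVec n 1)).mul key)
    have h2 := h1.const_mul (-(1 / 2))
    have e : -(1 / 2) * ((pDot s n t 1).eval 0 * (s t).qZero n 1 - ((s t).pVec n 1).eval 0 *
        (0 + timeSum s t 0 * (s t).qZero n 1)) = 0 := by simp [System.qZero]
    rw [e] at h2
    refine h2.congr' ?_
    filter_upwards [hev] with x hx
    have hx0 := hx.1
    have h3 := (h.two_mul_B ht 1 hx.2.1 hx.2.2).2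
    field_simp
    linear_combination -h3
  · refine tendsto_nhds_unique (hB 1) ?_
    have h1 := ((tendsto_eval_punctured (pDot s n t 1)).mul (hq 0)).sub
      ((tendsto_eval_punctured ((s t).pVec n 0)).mul key)
    have h2 := h1.const_mul (1 / 2)
    have e : 1 / 2 * ((pDot s n t 1).eval 0 * (s t).qZero n 0 - ((s t).pVec n 0).eval 0 *
        (0 + timeSum s t 0 * (s t).qZero n 1)) = dotkappa s n t / (s t).kappa n := by
      rw [(h.deriv_coeff_pVec ht).2.2]
      simp only [System.qZero, Matrix.cons_val_zero, Matrix.cons_val_one]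
      field_simp; ring
    rw [e] at h2
    refine h2.congr' ?_
    filter_upwards [hev] with x hx
    have hx0 := hx.1
    have h3 := (h.two_mul_B ht 1 hx.2.1 hx.2.2).1
    field_simp
    linear_combination -h3

end IsAdmissibleDeformation

end BOPUC

end

noncomputable section

open Polynomial Filter Set MeasureTheory
open scoped Topology Interval

namespace BOPUC

theorem hasDerivAt_div_iff {e w : ℝ → ℂ} {c d : ℂ} {t : ℝ} (hw : HasDerivAt w (-c * w t) t)
    (h0 : w t ≠ 0) : HasDerivAt (fun τ => e τ / w τ) (d / w t) t ↔ HasDerivAt e (d - c * e t) t := by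
  constructor
  · intro h
    refine ((h.mul hw).congr_of_eventuallyEq ?_).congr_deriv ?_
    · filter_upwards [hw.continuousAt.eventually_ne h0] with τ hτ
      exact (div_mul_cancel₀ _ hτ).symm
    · field_simp; ring
  · intro h
    refine (h.fun_div hw h0).congr_deriv ?_
    field_simp; ring

namespace IsAdmissibleDeformation

variable {m : ℕ} {ρ : Fin (m + 1) → ℂ} {s : ℝ → System m ρ} {S : Set ℝ} {D : Set (ℝ × ℂ)} {n : ℕ}
  {t : ℝ}

theorem z_ne_zero (h : IsAdmissibleDeformation s S D n) (ht : t ∈ S) (j : Fin m) :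
    (s t).z j.succ ≠ 0 := by
  have ha := h.isAdmissible ht
  rw [← ha.regular.origin]; exact ha.regular.injective.ne (Fin.succ_ne_zero j)

theorem residue_succ (h : IsAdmissibleDeformation s S D n) (ht : t ∈ S) (a : Fin 2) (j : Fin m) :
    (s t).residue n j.succ a 0 = -(ρ j.succ / (2 * (s t).z j.succ ^ n) *
        (((s t).phiStar n).eval ((s t).z j.succ) * (s t).qVec n a ((s t).z j.succ))) ∧
      (s t).residue n j.succ a 1 = ρ j.succ / (2 * (s t).z j.succ ^ n) *
        (((s t).phi n).eval ((s t).z j.succ) * (s t).qVec n a ((s t).z j.succ)) := by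
  have ha := h.isAdmissible ht
  have hz := pow_ne_zero n (h.z_ne_zero ht j)
  have hW := ha.eval_derivative_W_ne_zero j.succ
  obtain ⟨h1, h2⟩ := ha.mul_eval_numPoly_z a j.succ
  rw [ha.residue_apply, ha.residue_apply]
  simp only [System.pVec, Matrix.cons_val_zero, Matrix.cons_val_one] at h1 h2
  constructor
  · field_simp; linear_combination h1
  · field_simp; linear_combination h2

theorem B_apply_succ (h : IsAdmissibleDeformation s S D n) (ht : t ∈ S) (x : ℂ) (a b : Fin 2) :
    B s n t x a b = Binf s n t a b -
      ∑ j : Fin m, dotz s j.succ t * (s t).residue n j.succ a b / (x - (s t).z j.succ) := by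
  rw [B_apply, Fin.sum_univ_succ, h.deformation.dotz_zero ht]; ring

theorem B_sub_B_zero (h : IsAdmissibleDeformation s S D n) (ht : t ∈ S) {x : ℂ}
    (hz : ∀ j, x ≠ (s t).z j) (a b : Fin 2) :
    B s n t x a b = B s n t 0 a b - ∑ j : Fin m, dotz s j.succ t / (s t).z j.succ *
      (s t).residue n j.succ a b * (x / (x - (s t).z j.succ)) := by
  rw [h.B_apply_succ ht, h.B_apply_succ ht, sub_sub, ← Finset.sum_add_distrib]
  congr 1
  refine Finset.sum_congr rfl fun j _ => ?_
  have h1 := h.z_ne_zero ht j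
  have h2 := sub_ne_zero.2 (hz j.succ)
  rw [zero_sub]
  field_simp
  ring

theorem timeSum_succ (h : IsAdmissibleDeformation s S D n) (ht : t ∈ S) (x : ℂ) :
    timeSum s t x = ∑ j : Fin m, ρ j.succ * dotz s j.succ t / (x - (s t).z j.succ) := by
  rw [timeSum, Fin.sum_univ_succ, h.deformation.dotz_zero ht]; ring

theorem trace_B (h : IsAdmissibleDeformation s S D n) (ht : t ∈ S) (x : ℂ) :
    B s n t x 0 0 + B s n t x 1 1 = timeSum s t x := by
  have ha := h.isAdmissible ht
  have h1 : Binf s n t 0 0 + Binf s n t 1 1 = 0 := by simp [Binf]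
  rw [h.B_apply_succ ht, h.B_apply_succ ht, h.timeSum_succ ht, sub_add_sub_comm, h1, zero_sub,
    ← Finset.sum_add_distrib, ← Finset.sum_neg_distrib]
  refine Finset.sum_congr rfl fun j _ => ?_
  have hW := ha.eval_derivative_W_ne_zero j.succ
  have h2 : (s t).residue n j.succ 0 0 + (s t).residue n j.succ 1 1 = -ρ j.succ := by
    rw [ha.residue_apply, ha.residue_apply, ← add_div, ha.trace_numPoly (Fin.succ_ne_zero j),
      System.two_mul_eval_V_z]
    field_simp
  rw [← add_div, ← mul_add, h2]; ring

theorem zpow_neg_eq (z : ℂ) : z ^ (-(n : ℤ)) = 1 / z ^ n := by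
  rw [zpow_neg, zpow_natCast, one_div]

theorem zpow_one_sub_eq {z : ℂ} (hz : z ≠ 0) : z ^ (1 - (n : ℤ)) = z / z ^ n := by
  rw [zpow_sub₀ hz, zpow_one, zpow_natCast]

/-- The coefficients of the deformation system are the entries of `B_n`. -/
theorem deformationSystem_iff (h : IsAdmissibleDeformation s S D n) (ht : t ∈ S) {x : ℂ}
    (hz : ∀ j, x ≠ (s t).z j) (f fs e es : ℝ → ℂ) :
    DeformationSystem s n t x f fs e es ↔
      HasDerivAt f (B s n t x 0 0 * f t + B s n t x 0 1 * fs t) t ∧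
      HasDerivAt fs (B s n t x 1 0 * f t + B s n t x 1 1 * fs t) t ∧
      HasDerivAt e (B s n t x 0 0 * e t - B s n t x 0 1 * es t - timeSum s t x * e t) t ∧
      HasDerivAt es (B s n t x 1 1 * es t - B s n t x 1 0 * e t - timeSum s t x * es t) t := by
  have ha := h.isAdmissible ht
  have hz0 := h.z_ne_zero ht
  have hres := h.residue_succ ht
  have q0 : ∀ y, (s t).qVec n 0 y = (s t).eps n y := fun y => rfl
  have q1 : ∀ y, (s t).qVec n 1 y = -(s t).epsStar n y := fun y => rfl
  obtain ⟨hB10, hB11⟩ := h.B_zero ht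
  have htr := h.trace_B ht x
  set k := dotkappa s n t / (s t).kappa n with hk
  have i00 : Binf s n t 0 0 = k := rfl
  have i01 : Binf s n t 0 1 = 0 := rfl
  have i11 : Binf s n t 1 1 = -k := rfl
  have c2 : 1 / 2 * ∑ j : Fin m, ρ j.succ * (dotz s j.succ t / (s t).z j.succ) *
      (s t).z j.succ ^ (1 - (n : ℤ)) * (s t).eps n ((s t).z j.succ) *
      ((s t).phi n).eval ((s t).z j.succ) * (1 / (x - (s t).z j.succ)) = -B s n t x 0 1 := by
    rw [h.B_apply_succ ht, i01, zero_sub, neg_neg, Finset.mul_sum]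
    refine Finset.sum_congr rfl fun j _ => ?_
    have h1 := hz0 j
    rw [(hres 0 j).2, zpow_one_sub_eq h1, q0]
    field_simp
  have c6 : 1 / 2 * ∑ j : Fin m, ρ j.succ * (dotz s j.succ t / (s t).z j.succ) *
      (s t).z j.succ ^ (1 - (n : ℤ)) * (s t).eps n ((s t).z j.succ) *
      ((s t).phiStar n).eval ((s t).z j.succ) * (1 / (x - (s t).z j.succ)) =
        B s n t x 0 0 - k := by
    rw [h.B_apply_succ ht, i00, sub_sub_cancel_left, ← Finset.sum_neg_distrib, Finset.mul_sum]
    refine Finset.sum_congr rfl fun j _ => ?_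
    have h1 := hz0 j
    rw [(hres 0 j).1, zpow_one_sub_eq h1, q0]
    field_simp
  have c3 : 1 / 2 * ∑ j : Fin m, ρ j.succ * (dotz s j.succ t / (s t).z j.succ) *
      (s t).z j.succ ^ (1 - (n : ℤ)) * (s t).epsStar n ((s t).z j.succ) *
      ((s t).phi n).eval ((s t).z j.succ) * (1 / (x - (s t).z j.succ)) =
        B s n t x 1 1 + k := by
    rw [h.B_apply_succ ht, i11, sub_add_eq_add_sub, neg_add_cancel, zero_sub,
      ← Finset.sum_neg_distrib, Finset.mul_sum]
    refine Finset.sum_congr rfl fun j _ => ?_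
    have h1 := hz0 j
    rw [(hres 1 j).2, zpow_one_sub_eq h1, q1]
    field_simp
  have c4 : 1 / 2 * ∑ j : Fin m, ρ j.succ * (dotz s j.succ t / (s t).z j.succ) *
      (s t).z j.succ ^ (-(n : ℤ)) * (s t).epsStar n ((s t).z j.succ) *
      ((s t).phiStar n).eval ((s t).z j.succ) * (x / (x - (s t).z j.succ)) = -B s n t x 1 0 := by
    rw [h.B_sub_B_zero ht hz, hB10, zero_sub, neg_neg, Finset.mul_sum]
    refine Finset.sum_congr rfl fun j _ => ?_
    rw [(hres 1 j).1, zpow_neg_eq, q1]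
    ring
  have c5 : 1 / 2 * ∑ j : Fin m, ρ j.succ * (dotz s j.succ t / (s t).z j.succ) *
      (s t).z j.succ ^ (-(n : ℤ)) * (s t).epsStar n ((s t).z j.succ) *
      ((s t).phi n).eval ((s t).z j.succ) * (x / (x - (s t).z j.succ)) = B s n t x 1 1 - k := by
    rw [h.B_sub_B_zero ht hz, hB11, sub_sub_cancel_left, ← Finset.sum_neg_distrib, Finset.mul_sum]
    refine Finset.sum_congr rfl fun j _ => ?_
    rw [(hres 1 j).2, zpow_neg_eq, q1]
    ring
  have c1 : -∑ j : Fin m, ρ j.succ * (dotz s j.succ t / (s t).z j.succ) +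
      1 / 2 * ∑ j : Fin m, ρ j.succ * (dotz s j.succ t / (s t).z j.succ) *
      (s t).z j.succ ^ (-(n : ℤ)) * (s t).eps n ((s t).z j.succ) *
      ((s t).phiStar n).eval ((s t).z j.succ) * (x / (x - (s t).z j.succ)) =
        B s n t x 0 0 + k := by
    have e1 : B s n t x 0 0 + k = timeSum s t x - (B s n t x 1 1 - k) := by rw [← htr]; ring
    rw [e1, ← c5, h.timeSum_succ ht, Finset.mul_sum, Finset.mul_sum, ← Finset.sum_neg_distrib,
      ← Finset.sum_add_distrib, ← Finset.sum_sub_distrib]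
    refine Finset.sum_congr rfl fun j _ => ?_
    have h1 := hz0 j
    have h2 := sub_ne_zero.2 (hz j.succ)
    have h3 := ha.biorthonormal.casoratian ha.regular n.le_succ (System.IsGood.of_z j.succ)
    simp only [q0, q1, System.pVec, Matrix.cons_val_zero, Matrix.cons_val_one] at h3
    have h4 : (s t).eps n ((s t).z j.succ) * ((s t).phiStar n).eval ((s t).z j.succ) =
        2 * (s t).z j.succ ^ n - (s t).epsStar n ((s t).z j.succ) *
          ((s t).phi n).eval ((s t).z j.succ) := by linear_combination h3
    rw [zpow_neg_eq, mul_assoc (_ * _) ((s t).eps n _), h4]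
    field_simp
    ring
  simp only [DeformationSystem]
  rw [c2, c3, c4, c5, c6, ← hk]
  have g1 : -k - ∑ j : Fin m, ρ j.succ * (dotz s j.succ t / (s t).z j.succ) +
      1 / 2 * ∑ j : Fin m, ρ j.succ * (dotz s j.succ t / (s t).z j.succ) *
      (s t).z j.succ ^ (-(n : ℤ)) * (s t).eps n ((s t).z j.succ) *
      ((s t).phiStar n).eval ((s t).z j.succ) * (x / (x - (s t).z j.succ)) = B s n t x 0 0 := by
    linear_combination c1
  rw [g1]
  refine and_congr (iff_of_eq ?_) (and_congr (iff_of_eq ?_) (and_congr (iff_of_eq ?_)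
    (iff_of_eq ?_)))
  · congr 1; ring
  · congr 1; ring
  · congr 1; linear_combination -e t * htr
  · congr 1; linear_combination -es t * htr

theorem hasDerivAt_weight_time (h : IsAdmissibleDeformation s S D n) {x : ℂ} (hx : (t, x) ∈ D) :
    HasDerivAt (fun τ => (s τ).w x) (-timeSum s t x * (s t).w x) t :=
  h.deformation.time_derivative t x hx

theorem matrixDeformationEquation_iff (h : IsAdmissibleDeformation s S D n) {x : ℂ}
    (hx : (t, x) ∈ D) (hw : (s t).w x ≠ 0) (f fs e es : ℝ → ℂ) :
    MatrixDeformationEquation s n t x f fs e es ↔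
      HasDerivAt f (B s n t x 0 0 * f t + B s n t x 0 1 * fs t) t ∧
      HasDerivAt fs (B s n t x 1 0 * f t + B s n t x 1 1 * fs t) t ∧
      HasDerivAt e (B s n t x 0 0 * e t - B s n t x 0 1 * es t - timeSum s t x * e t) t ∧
      HasDerivAt es (B s n t x 1 1 * es t - B s n t x 1 0 * e t - timeSum s t x * es t) t := by
  have hwt := h.hasDerivAt_weight_time hx
  have he := hasDerivAt_div_iff (e := e)
    (d := B s n t x 0 0 * e t - B s n t x 0 1 * es t) hwt hw
  have hes := hasDerivAt_div_iff (e := es)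
    (d := B s n t x 1 1 * es t - B s n t x 1 0 * e t) hwt hw
  rw [← he, ← hes]
  have e2 : HasDerivAt (fun τ => es τ / (s τ).w x)
      ((B s n t x 1 1 * es t - B s n t x 1 0 * e t) / (s t).w x) t ↔
      HasDerivAt (fun τ => -es τ / (s τ).w x)
      (-((B s n t x 1 1 * es t - B s n t x 1 0 * e t) / (s t).w x)) t := by
    simp only [neg_div]
    exact ⟨fun h => h.fun_neg, fun h => by simpa only [neg_neg] using h.fun_neg⟩
  rw [e2]
  simp only [MatrixDeformationEquation, HasEntryDerivAt, Fin.forall_fin_two, Matrix.mul_apply,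
    Fin.sum_univ_two, pairMatrix, Matrix.of_apply, Matrix.cons_val', Matrix.cons_val_zero,
    Matrix.cons_val_one, Matrix.cons_val_fin_one]
  have f1 : B s n t x 0 0 * (e t / (s t).w x) + B s n t x 0 1 * (-es t / (s t).w x) =
      (B s n t x 0 0 * e t - B s n t x 0 1 * es t) / (s t).w x := by ring
  have f2 : B s n t x 1 0 * (e t / (s t).w x) + B s n t x 1 1 * (-es t / (s t).w x) =
      -((B s n t x 1 1 * es t - B s n t x 1 0 * e t) / (s t).w x) := by ring
  rw [f1, f2]
  tauto

/-- The polynomials and associated functions satisfy the deformation system. -/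
theorem deformationSystem (h : IsAdmissibleDeformation s S D n) (ht : t ∈ S) {x : ℂ}
    (hx : ‖x‖ ≠ 1) (hz : ∀ j, x ≠ (s t).z j) :
    DeformationSystem s n t x (fun τ => ((s τ).phi n).eval x)
      (fun τ => ((s τ).phiStar n).eval x) (fun τ => (s τ).eps n x)
      (fun τ => (s τ).epsStar n x) := by
  rw [h.deformationSystem_iff ht hz]
  have hp := fun a => (h.hasPolyDerivAt_pVec ht a).eval x
  have hq := fun a => h.hasDerivAt_qVec_time ht a hx
  have he := fun a => h.time_eq ht a hx hz
  refine ⟨(hp 0).congr_deriv (he 0).1, (hp 1).congr_deriv (he 1).1, (hq 0).congr_deriv ?_, ?_⟩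
  · rw [(he 0).2]
    simp only [System.qVec, Matrix.cons_val_zero, Matrix.cons_val_one]; ring
  · have h1 := (hq 1).fun_neg
    simp only [System.qVec, Matrix.cons_val_one, Matrix.cons_val_fin_one, neg_neg] at h1
    refine h1.congr_deriv ?_
    rw [(he 1).2]
    simp only [System.qVec, Matrix.cons_val_zero, Matrix.cons_val_one, Matrix.cons_val_fin_one]
    ring

end IsAdmissibleDeformation

end BOPUC

end

noncomputable section

open Polynomial Filter Set MeasureTheory
open scoped Topology Interval

namespace BOPUC

namespace System

variable {m : ℕ} {ρ : Fin (m + 1) → ℂ} {s : System m ρ}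

theorem infinite_regular_points : {x : ℂ | ‖x‖ ≠ 1 ∧ ∀ j, x ≠ s.z j}.Infinite := by
  have h1 : ((Set.range s.z)ᶜ ∩ {x : ℂ | ‖x‖ ≠ 1}).Infinite := by
    rw [Set.inter_comm, ← Set.sdiff_eq]
    exact infinite_norm_ne_one.sdiff (Set.finite_range s.z)
  refine h1.mono fun x hx => ⟨hx.2, fun j hj => hx.1 ⟨j, hj.symm⟩⟩

/-- Uniqueness of partial fractions. -/
theorem eq_zero_of_sum_div_eq_zero (hinj : Function.Injective s.z) {c : Fin (m + 1) → ℂ}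
    (h : ∀ x : ℂ, ‖x‖ ≠ 1 → (∀ j, x ≠ s.z j) → ∑ j, c j / (x - s.z j) = 0) (j : Fin (m + 1)) :
    c j = 0 := by
  have h1 : s.residueSum c = 0 := by
    refine Polynomial.eq_of_infinite_eval_eq _ _ (s.infinite_regular_points.mono fun x hx => ?_)
    rw [Set.mem_ofPred_eq, eval_residueSum _ hx.2, h x hx.1 hx.2, mul_zero, eval_zero]
  have h2 := s.eval_residueSum_z c j
  rw [h1, eval_zero] at h2
  exact (mul_eq_zero.1 h2.symm).resolve_right (eval_derivative_W_ne_zero hinj j)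

end System

/-- The partial fraction expansion of a product with an antisymmetric coefficient. -/
theorem sum_antisymm {ι : Type*} [Fintype ι] [DecidableEq ι] {z z' : ι → ℂ} {x : ℂ} {c : ι → ι → ℂ}
    (hinj : Function.Injective z) (hx : ∀ j, x ≠ z j) (hc : ∀ j k, c j k = -c k j) :
    ∑ j, ∑ k, z' k * c j k / ((x - z j) * (x - z k)) =
      -∑ j, (∑ k ∈ Finset.univ.erase j, (z' j - z' k) / (z j - z k) * c j k) / (x - z j) := by
  have hcc : ∀ j, c j j = 0 := fun j => by
    have := hc j j
    linear_combination (1 / 2 : ℂ) * this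
  have h1 : ∀ j, ∑ k ∈ Finset.univ.erase j, (z' j - z' k) / (z j - z k) * c j k =
      ∑ k, (z' j - z' k) / (z j - z k) * c j k := fun j => by
    rw [← Finset.add_sum_erase _ _ (Finset.mem_univ j), hcc, mul_zero, zero_add]
  have h2 : ∑ j, ∑ k, z' k * c j k / ((x - z j) * (x - z k)) =
      ∑ j, ∑ k, -(z' j * c j k / ((x - z j) * (x - z k))) := by
    rw [Finset.sum_comm]
    refine Finset.sum_congr rfl fun j _ => Finset.sum_congr rfl fun k _ => ?_
    rw [hc k j]; ring
  have h3 : ∑ j, ∑ k, (z' j - z' k) / (z j - z k) * c j k / (x - z j) =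
      ∑ j, ∑ k, -((z' j - z' k) / (z j - z k) * c j k / (x - z k)) := by
    rw [Finset.sum_comm]
    refine Finset.sum_congr rfl fun j _ => Finset.sum_congr rfl fun k _ => ?_
    rw [hc k j, ← neg_sub (z' j), ← neg_sub (z j), neg_div_neg_eq]; ring
  simp only [h1, Finset.sum_div]
  have h4 : ∑ j, ∑ k, (z' k * c j k / ((x - z j) * (x - z k)) +
      -(z' j * c j k / ((x - z j) * (x - z k)))) =
      -∑ j, ∑ k, ((z' j - z' k) / (z j - z k) * c j k / (x - z j) +
        -((z' j - z' k) / (z j - z k) * c j k / (x - z k))) := by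
    rw [← Finset.sum_neg_distrib]
    refine Finset.sum_congr rfl fun j _ => ?_
    rw [← Finset.sum_neg_distrib]
    refine Finset.sum_congr rfl fun k _ => ?_
    by_cases hjk : j = k
    · subst hjk; rw [hcc]; simp
    · have e1 := sub_ne_zero.2 (hinj.ne hjk)
      have e2 := sub_ne_zero.2 (hx j)
      have e3 := sub_ne_zero.2 (hx k)
      field_simp
      ring
  simp only [Finset.sum_add_distrib] at h4
  rw [← h2, ← h3] at h4
  linear_combination (1 / 2 : ℂ) * h4

namespace IsAdmissibleDeformation

variable {m : ℕ} {ρ : Fin (m + 1) → ℂ} {s : ℝ → System m ρ} {S : Set ℝ} {D : Set (ℝ × ℂ)} {n : ℕ}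
  {t : ℝ}

theorem hasDerivAt_z (h : IsAdmissibleDeformation s S D n) (ht : t ∈ S) (j : Fin (m + 1)) :
    HasDerivAt (fun τ => (s τ).z j) (dotz s j t) t := h.deformation.hasDerivAt_z ht j

theorem differentiableAt_eval_W (h : IsAdmissibleDeformation s S D n) (ht : t ∈ S) (x : ℂ) :
    DifferentiableAt ℝ (fun τ => (s τ).W.eval x) t := by
  simp only [System.eval_W]
  exact DifferentiableAt.fun_finsetProd fun j _ =>
    ((h.hasDerivAt_z ht j).differentiableAt).const_sub x

theorem differentiableAt_eval_V (h : IsAdmissibleDeformation s S D n) (ht : t ∈ S) (x : ℂ) :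
    DifferentiableAt ℝ (fun τ => 2 * (s τ).V.eval x) t := by
  simp only [System.two_mul_eval_V_eq_residueSum, System.residueSum, eval_finsetSum, eval_mul,
    eval_C, eval_prod, eval_sub, eval_X]
  refine DifferentiableAt.fun_sum fun j _ => DifferentiableAt.const_mul ?_ _
  exact DifferentiableAt.fun_finsetProd fun k _ =>
    ((h.hasDerivAt_z ht k).differentiableAt).const_sub x

theorem exists_hasPolyDerivAt_numPoly (h : IsAdmissibleDeformation s S D n) (ht : t ∈ S)
    (a b : Fin 2) : ∃ N', HasPolyDerivAt m (fun τ => (s τ).numPoly n a b) N' t := by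
  refine exists_hasPolyDerivAt (s t).infinite_regular_points ?_ fun x hx => ?_
  · filter_upwards [h.eventually_mem ht] with τ hτ
    exact (h.isAdmissible hτ).natDegree_numPoly_le a b
  · have hx0 : x ≠ 0 := by rw [← (h.isAdmissible ht).regular.origin]; exact hx.2 0
    have key : ∀ c, DifferentiableAt ℝ (fun τ => ((s τ).specPoly n a c).eval x) t := by
      intro c
      have dp := fun a => ((h.hasPolyDerivAt_pVec ht a).eval x).differentiableAt
      have dq := fun a => (h.hasDerivAt_qVec_time ht a hx.1).differentiableAt
      have h1 := (((h.differentiableAt_eval_W ht x).fun_mul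
        ((h.hasPolyDerivAt_pVec ht a).derivative.eval x).differentiableAt).fun_mul (dq c)).fun_sub
        ((dp c).fun_mul (((h.differentiableAt_eval_W ht x).fun_mul
          (h.hasDerivAt_qDeriv_time ht a hx.1).differentiableAt).fun_sub
          ((h.differentiableAt_eval_V ht x).fun_mul (dq a))))
      refine h1.congr_of_eventuallyEq ?_
      filter_upwards [h.eventually_mem ht] with τ hτ
      have ha := h.isAdmissible hτ
      exact ha.biorthonormal.eval_specPoly ha.regular n.le_succ hx.1 a c
    have hxn : 2 * x ^ n ≠ 0 := mul_ne_zero two_ne_zero (pow_ne_zero _ hx0)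
    fin_cases b
    · refine ((key 1).fun_neg.const_mul (2 * x ^ n)⁻¹).congr_of_eventuallyEq ?_
      filter_upwards [h.eventually_mem ht] with τ hτ
      rw [← (h.isAdmissible hτ).mul_eval_numPoly_zero, inv_mul_cancel_left₀ hxn]
      rfl
    · refine ((key 0).const_mul (2 * x ^ n)⁻¹).congr_of_eventuallyEq ?_
      filter_upwards [h.eventually_mem ht] with τ hτ
      rw [← (h.isAdmissible hτ).mul_eval_numPoly_one, inv_mul_cancel_left₀ hxn]
      rfl

theorem differentiableAt_residue (h : IsAdmissibleDeformation s S D n) (ht : t ∈ S)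
    (j : Fin (m + 1)) (a b : Fin 2) :
    DifferentiableAt ℝ (fun τ => (s τ).residue n j a b) t := by
  obtain ⟨N', hN⟩ := h.exists_hasPolyDerivAt_numPoly ht a b
  have h1 := (hN.eval_comp (h.hasDerivAt_z ht j)).differentiableAt
  have h2 : DifferentiableAt ℝ (fun τ => (s τ).W.derivative.eval ((s τ).z j)) t := by
    simp only [System.eval_derivative_W]
    exact DifferentiableAt.fun_finsetProd fun k _ =>
      (h.hasDerivAt_z ht j).differentiableAt.fun_sub (h.hasDerivAt_z ht k).differentiableAt
  refine (h1.fun_div h2 ((h.isAdmissible ht).eval_derivative_W_ne_zero j)).congr_of_eventuallyEq ?_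
  filter_upwards [h.eventually_mem ht] with τ hτ
  exact (h.isAdmissible hτ).residue_apply j a b

theorem eventually_ne_z (h : IsAdmissibleDeformation s S D n) (ht : t ∈ S) {x : ℂ}
    (hz : ∀ j, x ≠ (s t).z j) : ∀ᶠ τ in 𝓝 t, ∀ j, x ≠ (s τ).z j := by
  rw [eventually_all]
  exact fun j => ((h.hasDerivAt_z ht j).continuousAt.eventually_ne (hz j).symm).mono
    fun τ hτ => hτ.symm

theorem eventually_ne_z_space {x : ℂ} (hz : ∀ j, x ≠ (s t).z j) :
    ∀ᶠ y in 𝓝 x, ∀ j, y ≠ (s t).z j := by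
  rw [eventually_all]
  exact fun j => isOpen_ne.mem_nhds (hz j)

/-- The time derivative of a sum of simple fractions. -/
theorem hasDerivAt_sum_div (h : IsAdmissibleDeformation s S D n) (ht : t ∈ S) {x : ℂ}
    (hz : ∀ j, x ≠ (s t).z j) {r : Fin (m + 1) → ℝ → ℂ} {r' : Fin (m + 1) → ℂ}
    (hr : ∀ j, HasDerivAt (r j) (r' j) t) :
    HasDerivAt (fun τ => ∑ j, r j τ / (x - (s τ).z j))
      (∑ j, r' j / (x - (s t).z j) + ∑ j, dotz s j t * r j t / (x - (s t).z j) ^ 2) t := by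
  rw [← Finset.sum_add_distrib]
  refine HasDerivAt.fun_sum fun j _ => ?_
  have h1 := sub_ne_zero.2 (hz j)
  refine ((hr j).fun_div ((h.hasDerivAt_z ht j).const_sub x) h1).congr_deriv ?_
  field_simp
  ring

theorem hasDerivAt_sum_div_space {x : ℂ} (hz : ∀ j, x ≠ (s t).z j) (c : Fin (m + 1) → ℂ) :
    HasDerivAt (fun y => ∑ j, c j / (y - (s t).z j)) (-∑ j, c j / (x - (s t).z j) ^ 2) x := by
  rw [← Finset.sum_neg_distrib]
  refine HasDerivAt.fun_sum fun j _ => ?_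
  have h1 := sub_ne_zero.2 (hz j)
  refine ((hasDerivAt_const x (c j)).fun_div ((hasDerivAt_id x).sub_const _) h1).congr_deriv ?_
  simp only [id]; field_simp; ring

theorem two_V_div_W {x : ℂ} (hz : ∀ j, x ≠ (s t).z j) :
    2 * (s t).V.eval x / (s t).W.eval x = ∑ j, ρ j / (x - (s t).z j) := by
  rw [System.two_mul_eval_V_eq_residueSum, System.eval_residueSum _ hz,
    mul_div_cancel_left₀ _ (System.eval_W_ne_zero hz)]

/-- Compatibility of the spectral and the deformation equations. -/
theorem zero_curvature (h : IsAdmissibleDeformation s S D n) (ht : t ∈ S) {x : ℂ}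
    (hx : ‖x‖ ≠ 1) (hz : ∀ j, x ≠ (s t).z j) (a b : Fin 2) :
    ∑ j, deriv (fun τ => (s τ).residue n j a b) t / (x - (s t).z j) +
      ((s t).A n x * B s n t x - B s n t x * (s t).A n x) a b = 0 := by
  have ha := h.isAdmissible ht
  have hx0 : x ≠ 0 := by rw [← ha.regular.origin]; exact hz 0
  set A := (s t).A n x
  set B := BOPUC.B s n t x with hB
  set Q : Fin 2 → Fin 2 → ℂ := fun a b => ∑ j, dotz s j t * (s t).residue n j a b /
    (x - (s t).z j) ^ 2
  set R : Fin 2 → Fin 2 → ℂ := fun a b =>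
    ∑ j, deriv (fun τ => (s τ).residue n j a b) t / (x - (s t).z j)
  set K := ∑ j, dotz s j t * ρ j / (x - (s t).z j) ^ 2
  have hA : ∀ a b, HasDerivAt (fun τ => (s τ).A n x a b) (R a b + Q a b) t := fun a b => by
    refine (h.hasDerivAt_sum_div ht hz
      fun j => (h.differentiableAt_residue ht j a b).hasDerivAt).congr_of_eventuallyEq ?_
    filter_upwards [h.eventually_mem ht, h.eventually_ne_z ht hz] with τ hτ hzτ
    exact (h.isAdmissible hτ).A_apply hzτ a b
  have hB' : ∀ a b, HasDerivAt (fun y => BOPUC.B s n t y a b) (Q a b) x := fun a b => by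
    simp only [B_apply]
    have := (hasDerivAt_sum_div_space hz fun j => dotz s j t * (s t).residue n j a b).const_sub
      (Binf s n t a b)
    rwa [neg_neg] at this
  have hv : HasDerivAt (fun τ => 2 * (s τ).V.eval x / (s τ).W.eval x) K t := by
    have h1 := h.hasDerivAt_sum_div ht hz (r := fun j _ => ρ j) fun j => hasDerivAt_const t (ρ j)
    simp only [zero_div, Finset.sum_const_zero, zero_add] at h1
    refine h1.congr_of_eventuallyEq ?_
    filter_upwards [h.eventually_ne_z ht hz] with τ hzτ
    exact two_V_div_W hzτ
  have hσ : HasDerivAt (fun y => -timeSum s t y) K x := by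
    have := (hasDerivAt_sum_div_space hz fun j => ρ j * dotz s j t).fun_neg
    rw [neg_neg] at this
    simpa only [timeSum, K, mul_comm (ρ _)] using this
  have hp := fun a => h.hasPolyDerivAt_pVec ht a
  have hpt := fun a => (hp a).eval x
  have hqt := fun a => h.hasDerivAt_qVec_time ht a hx
  have hpx := fun a => ((s t).pVec n a).hasDerivAt x
  have hqx := fun a => ha.biorthonormal.hasDerivAt_qVec ha.regular n.le_succ hx a
  have hspec := fun a => ha.spectral_eq hx hz a
  have htime := fun a => h.time_eq ht a hx hz
  have E1 : ∀ a, (pDot s n t a).derivative.eval x =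
      ((R a 0 + Q a 0) * ((s t).pVec n 0).eval x + A a 0 * (pDot s n t 0).eval x) +
      ((R a 1 + Q a 1) * ((s t).pVec n 1).eval x + A a 1 * (pDot s n t 1).eval x) := fun a => by
    refine ((hp a).derivative.eval x).unique ((((hA a 0).mul (hpt 0)).add
      ((hA a 1).mul (hpt 1))).congr_of_eventuallyEq ?_)
    filter_upwards [h.eventually_mem ht, h.eventually_ne_z ht hz] with τ hτ hzτ
    exact ((h.isAdmissible hτ).spectral_eq hx hzτ a).1
  have E2 : ∀ a, (pDot s n t a).derivative.eval x =
      (Q a 0 * ((s t).pVec n 0).eval x + B a 0 * ((s t).pVec n 0).derivative.eval x) +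
      (Q a 1 * ((s t).pVec n 1).eval x + B a 1 * ((s t).pVec n 1).derivative.eval x) := fun a => by
    refine ((pDot s n t a).hasDerivAt x).unique ((((hB' a 0).mul (hpx 0)).add
      ((hB' a 1).mul (hpx 1))).congr_of_eventuallyEq ?_)
    filter_upwards [isOpen_norm_ne_one.mem_nhds hx, eventually_ne_z_space hz] with y hy hzy
    exact (h.time_eq ht a hy hzy).1
  have E3 : ∀ a, qDerivDot s n t a x =
      (K * (s t).qVec n a x + 2 * (s t).V.eval x / (s t).W.eval x * qDot s n t a x) +
      (((R a 0 + Q a 0) * (s t).qVec n 0 x + A a 0 * qDot s n t 0 x) +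
      ((R a 1 + Q a 1) * (s t).qVec n 1 x + A a 1 * qDot s n t 1 x)) := fun a => by
    refine (h.hasDerivAt_qDeriv_time ht a hx).unique (((hv.mul (hqt a)).add
      (((hA a 0).mul (hqt 0)).add ((hA a 1).mul (hqt 1)))).congr_of_eventuallyEq ?_)
    filter_upwards [h.eventually_mem ht, h.eventually_ne_z ht hz] with τ hτ hzτ
    exact ((h.isAdmissible hτ).spectral_eq hx hzτ a).2
  have E4 : ∀ a, qDerivDot s n t a x =
      (K * (s t).qVec n a x + -timeSum s t x * (s t).qDeriv n a x) +
      ((Q a 0 * (s t).qVec n 0 x + B a 0 * (s t).qDeriv n 0 x) +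
      (Q a 1 * (s t).qVec n 1 x + B a 1 * (s t).qDeriv n 1 x)) := fun a => by
    refine (h.hasDerivAt_qDot ht a hx).unique (((hσ.mul (hqx a)).add
      (((hB' a 0).mul (hqx 0)).add ((hB' a 1).mul (hqx 1)))).congr_of_eventuallyEq ?_)
    filter_upwards [isOpen_norm_ne_one.mem_nhds hx, eventually_ne_z_space hz] with y hy hzy
    exact (h.time_eq ht a hy hzy).2
  set Z : Fin 2 → Fin 2 → ℂ := fun a b => R a b + (A a 0 * B 0 b + A a 1 * B 1 b -
    (B a 0 * A 0 b + B a 1 * A 1 b)) with hZ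
  have F1 : Z a 0 * ((s t).pVec n 0).eval x + Z a 1 * ((s t).pVec n 1).eval x = 0 := by
    have e1 := E1 a
    have e2 := E2 a
    rw [(htime 0).1, (htime 1).1] at e1
    rw [(hspec 0).1, (hspec 1).1] at e2
    simp only [hZ]
    linear_combination e2 - e1
  have F2 : Z a 0 * (s t).qVec n 0 x + Z a 1 * (s t).qVec n 1 x = 0 := by
    have e1 := E3 a
    have e2 := E4 a
    rw [(htime 0).2, (htime 1).2, (htime a).2] at e1
    rw [(hspec 0).2, (hspec 1).2, (hspec a).2] at e2
    simp only [hZ]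
    linear_combination e2 - e1
  have h3 := ha.biorthonormal.casoratian ha.regular n.le_succ (Or.inl hx)
  have hx0' : 2 * x ^ n ≠ 0 := mul_ne_zero two_ne_zero (pow_ne_zero _ hx0)
  have Z0 : Z a b = 0 := by
    refine (mul_eq_zero.1 (?_ : 2 * x ^ n * Z a b = 0)).resolve_left hx0'
    fin_cases b
    · simp only [Fin.zero_eta]
      linear_combination -Z a 0 * h3 + ((s t).pVec n 1).eval x * F2 - (s t).qVec n 1 x * F1
    · simp only [Fin.mk_one]
      linear_combination -Z a 1 * h3 - ((s t).pVec n 0).eval x * F2 + (s t).qVec n 0 x * F1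
  rw [Matrix.sub_apply, Matrix.mul_apply, Matrix.mul_apply, Fin.sum_univ_two, Fin.sum_univ_two]
  exact Z0

theorem commutator_apply (h : IsAdmissibleDeformation s S D n) (ht : t ∈ S) {x : ℂ}
    (hz : ∀ j, x ≠ (s t).z j) (a b : Fin 2) :
    ((s t).A n x * B s n t x - B s n t x * (s t).A n x) a b =
      ∑ j, (((s t).residue n j * Binf s n t - Binf s n t * (s t).residue n j) a b +
        ∑ k ∈ Finset.univ.erase j, (dotz s j t - dotz s k t) / ((s t).z j - (s t).z k) *
          ((s t).residue n j * (s t).residue n k - (s t).residue n k * (s t).residue n j) a b) /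
        (x - (s t).z j) := by
  have ha := h.isAdmissible ht
  have e1 : (s t).A n x * B s n t x - B s n t x * (s t).A n x =
      ∑ j, (x - (s t).z j)⁻¹ • ((s t).residue n j * Binf s n t - Binf s n t * (s t).residue n j) -
      ∑ j, ∑ k, (dotz s k t / ((x - (s t).z j) * (x - (s t).z k))) •
        ((s t).residue n j * (s t).residue n k - (s t).residue n k * (s t).residue n j) := by
    have e3 : (∑ k, (dotz s k t / (x - (s t).z k)) • (s t).residue n k) *
        (∑ j, (x - (s t).z j)⁻¹ • (s t).residue n j) =
        ∑ j, ∑ k, (dotz s k t / ((x - (s t).z j) * (x - (s t).z k))) •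
          ((s t).residue n k * (s t).residue n j) := by
      rw [Finset.sum_mul_sum, Finset.sum_comm]
      refine Finset.sum_congr rfl fun j _ => Finset.sum_congr rfl fun k _ => ?_
      rw [smul_mul_smul_comm]
      congr 1; rw [div_eq_mul_inv, div_eq_mul_inv, mul_inv]; ring
    have e4 : (∑ j, (x - (s t).z j)⁻¹ • (s t).residue n j) *
        (∑ k, (dotz s k t / (x - (s t).z k)) • (s t).residue n k) =
        ∑ j, ∑ k, (dotz s k t / ((x - (s t).z j) * (x - (s t).z k))) •
          ((s t).residue n j * (s t).residue n k) := by
      rw [Finset.sum_mul_sum]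
      refine Finset.sum_congr rfl fun j _ => Finset.sum_congr rfl fun k _ => ?_
      rw [smul_mul_smul_comm]
      congr 1; rw [div_eq_mul_inv, div_eq_mul_inv, mul_inv]; ring
    rw [ha.A_eq hz, B, mul_sub, sub_mul, e3, e4, Finset.sum_mul, Finset.mul_sum, sub_sub_sub_comm]
    simp only [← Finset.sum_sub_distrib, smul_sub, smul_mul_assoc, mul_smul_comm]
  rw [e1, Matrix.sub_apply, Matrix.sum_apply, Matrix.sum_apply]
  simp only [Matrix.sum_apply, Matrix.smul_apply, smul_eq_mul]
  have e2 := sum_antisymm (z' := fun k => dotz s k t) (x := x) (c := fun j k =>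
    ((s t).residue n j * (s t).residue n k - (s t).residue n k * (s t).residue n j) a b)
    ha.regular.injective hz fun j k => by
      rw [← Matrix.neg_apply, neg_sub]
  simp only [add_div, Finset.sum_add_distrib]
  simp only [mul_div_right_comm _ _ ((x - _) * _)] at e2
  rw [e2, sub_neg_eq_add]
  congr 1
  exact Finset.sum_congr rfl fun j _ => by ring

/-- The Schlesinger equations. -/
theorem schlesinger (h : IsAdmissibleDeformation s S D n) (ht : t ∈ S) (j : Fin (m + 1)) :
    HasEntryDerivAt (fun τ => (s τ).residue n j)
      ((Binf s n t * (s t).residue n j - (s t).residue n j * Binf s n t)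
        + ∑ k ∈ Finset.univ.erase j,
          ((dotz s j t - dotz s k t) / ((s t).z j - (s t).z k)) •
            ((s t).residue n k * (s t).residue n j - (s t).residue n j * (s t).residue n k)) t := by
  intro a b
  refine (h.differentiableAt_residue ht j a b).hasDerivAt.congr_deriv ?_
  have h1 := System.eq_zero_of_sum_div_eq_zero (s := s t) (h.isAdmissible ht).regular.injective
    (c := fun j => deriv (fun τ => (s τ).residue n j a b) t +
      (((s t).residue n j * Binf s n t - Binf s n t * (s t).residue n j) a b +
        ∑ k ∈ Finset.univ.erase j, (dotz s j t - dotz s k t) / ((s t).z j - (s t).z k) *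
          ((s t).residue n j * (s t).residue n k - (s t).residue n k * (s t).residue n j) a b))
    (fun x hx hz => by
      have h2 := h.zero_curvature ht hx hz a b
      rw [h.commutator_apply ht hz, ← Finset.sum_add_distrib] at h2
      simpa only [add_div] using h2) j
  rw [eq_neg_of_add_eq_zero_left h1, Matrix.add_apply, Matrix.sum_apply, neg_add,
    ← Matrix.neg_apply, neg_sub, ← Finset.sum_neg_distrib]
  congr 1
  refine Finset.sum_congr rfl fun k _ => ?_
  rw [Matrix.smul_apply, smul_eq_mul, ← mul_neg, ← Matrix.neg_apply, neg_sub]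

theorem schlesinger_inf (h : IsAdmissibleDeformation s S D n) (ht : t ∈ S) :
    HasEntryDerivAt (fun τ => (s τ).residueInf n)
      (Binf s n t * (s t).residueInf n - (s t).residueInf n * Binf s n t) t := by
  intro a b
  have h1 := (HasDerivAt.fun_sum (u := Finset.univ) fun j _ => h.schlesinger ht j a b).fun_neg
  set c : Fin (m + 1) → Fin (m + 1) → ℂ := fun j k =>
    ((dotz s j t - dotz s k t) / ((s t).z j - (s t).z k)) *
      ((s t).residue n k * (s t).residue n j - (s t).residue n j * (s t).residue n k) a b with hc
  have hanti : ∀ j k, c j k = -c k j := fun j k => by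
    simp only [hc, Matrix.sub_apply]
    rw [← neg_sub (dotz s k t), ← neg_sub ((s t).z k), neg_div_neg_eq]; ring
  have h2 : ∑ j, ∑ k ∈ Finset.univ.erase j, c j k = 0 := by
    have h3 : ∀ j, ∑ k ∈ Finset.univ.erase j, c j k = ∑ k, c j k := fun j => by
      rw [← Finset.add_sum_erase _ _ (Finset.mem_univ j)]
      simp [hc]
    simp only [h3]
    have h4 : ∑ j, ∑ k, c j k = -∑ j, ∑ k, c j k := by
      conv_lhs => rw [Finset.sum_comm]
      simp only [← Finset.sum_neg_distrib]
      exact Finset.sum_congr rfl fun j _ => Finset.sum_congr rfl fun k _ => hanti k j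
    linear_combination (1 / 2 : ℂ) * h4
  simp only [System.residueInf, Matrix.neg_apply, Matrix.sum_apply]
  refine h1.congr_deriv ?_
  simp only [Matrix.add_apply, Matrix.sum_apply, Matrix.smul_apply, smul_eq_mul]
  rw [Finset.sum_add_distrib, h2, add_zero, mul_neg, neg_mul, neg_sub_neg, ← neg_sub,
    Matrix.neg_apply, Finset.mul_sum, Finset.sum_mul, ← Finset.sum_sub_distrib, Matrix.sum_apply]

end IsAdmissibleDeformation

end BOPUC

end

noncomputable section

open Polynomial Filter Set MeasureTheory
open scoped Topology Interval

namespace BOPUC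

namespace System

variable {m : ℕ} {ρ : Fin (m + 1) → ℂ} (s : System m ρ) (n : ℕ) (j : Fin (m + 1))

theorem residue_zero_zero : s.residue n j 0 0 = -(ρ j / (2 * s.V.eval (s.z j)) *
    ((s.Omega n).eval (s.z j) + s.V.eval (s.z j)
      - s.kappa (n + 1) / s.kappa n * s.z j * (s.Theta n).eval (s.z j))) := by
  simp only [residue, numerator, Matrix.smul_apply, smul_eq_mul, Matrix.of_apply, Matrix.cons_val',
    Matrix.cons_val_zero, Matrix.cons_val_fin_one]
  ring

theorem residue_zero_one : s.residue n j 0 1 = ρ j / (2 * s.V.eval (s.z j)) *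
    (s.phi0 (n + 1) / s.kappa n) * (s.Theta n).eval (s.z j) := by
  simp only [residue, numerator, Matrix.smul_apply, smul_eq_mul, Matrix.of_apply, Matrix.cons_val',
    Matrix.cons_val_zero, Matrix.cons_val_one, Matrix.cons_val_fin_one]
  ring

theorem residue_one_zero : s.residue n j 1 0 = -(ρ j / (2 * s.V.eval (s.z j)) *
    (s.phiBar0 (n + 1) / s.kappa n) * s.z j * (s.ThetaStar n).eval (s.z j)) := by
  simp only [residue, numerator, Matrix.smul_apply, smul_eq_mul, Matrix.of_apply, Matrix.cons_val',
    Matrix.cons_val_zero, Matrix.cons_val_one, Matrix.cons_val_fin_one]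
  ring

variable {s n} in
theorem IsAdmissible.residue_sub (h : s.IsAdmissible n) :
    s.residue n j 0 0 - s.residue n j 1 1 =
      -(2 * (ρ j / (2 * s.V.eval (s.z j)) * s.omegaBracket n j)) := by
  have h1 := (h.brackets j).1
  rw [eval_numPoly, eval_numPoly] at h1
  simp only [residue, Matrix.smul_apply, smul_eq_mul]
  linear_combination ρ j / (2 * s.V.eval (s.z j)) * h1

end System

namespace IsAdmissibleDeformation

variable {m : ℕ} {ρ : Fin (m + 1) → ℂ} {s : ℝ → System m ρ} {S : Set ℝ} {D : Set (ℝ × ℂ)} {n : ℕ}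
  {t : ℝ}

theorem schlesinger_apply (h : IsAdmissibleDeformation s S D n) (ht : t ∈ S) (j : Fin (m + 1))
    (a b : Fin 2) : HasDerivAt (fun τ => (s τ).residue n j a b)
      ((Binf s n t a 0 * (s t).residue n j 0 b + Binf s n t a 1 * (s t).residue n j 1 b -
        ((s t).residue n j a 0 * Binf s n t 0 b + (s t).residue n j a 1 * Binf s n t 1 b)) +
      ∑ k ∈ Finset.univ.erase j, (dotz s j t - dotz s k t) / ((s t).z j - (s t).z k) *
        (((s t).residue n k a 0 * (s t).residue n j 0 b +
          (s t).residue n k a 1 * (s t).residue n j 1 b) -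
        ((s t).residue n j a 0 * (s t).residue n k 0 b +
          (s t).residue n j a 1 * (s t).residue n k 1 b))) t := by
  refine (h.schlesinger ht j a b).congr_deriv ?_
  simp only [Matrix.add_apply, Matrix.sub_apply, Matrix.mul_apply, Matrix.sum_apply,
    Matrix.smul_apply, smul_eq_mul, Fin.sum_univ_two]

theorem deriv_kappa_mul_phiBar0 (h : IsAdmissibleDeformation s S D n) (ht : t ∈ S) :
    deriv (fun τ => (s τ).kappa n * (s τ).phiBar0 n) t = (s t).kappa n ^ 2 * Binf s n t 1 0 := by
  have hκ := (h.isAdmissible ht).kappa_ne_zero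
  rw [((h.hasDerivAt_kappa ht).fun_mul (h.hasDerivAt_phiBar0 ht)).deriv]
  simp only [Binf, Matrix.of_apply, Matrix.cons_val', Matrix.cons_val_zero, Matrix.cons_val_one,
    Matrix.cons_val_fin_one]
  field_simp
  ring

theorem component_zero_zero (h : IsAdmissibleDeformation s S D n) (ht : t ∈ S)
    (j : Fin (m + 1)) :
    HasDerivAt
      (fun τ => ρ j / (2 * (s τ).V.eval ((s τ).z j)) *
        (((s τ).Omega n).eval ((s τ).z j) + (s τ).V.eval ((s τ).z j)
          - (s τ).kappa (n + 1) / (s τ).kappa n * (s τ).z j * ((s τ).Theta n).eval ((s τ).z j)))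
      (ρ j / (2 * (s t).V.eval ((s t).z j)) * ((s t).phi0 (n + 1) / (s t).kappa n ^ 3)
          * deriv (fun τ => (s τ).kappa n * (s τ).phiBar0 n) t
          * ((s t).Theta n).eval ((s t).z j)
        - ρ j / (2 * (s t).V.eval ((s t).z j))
          * ((s t).phi0 (n + 1) * (s t).phiBar0 (n + 1) / (s t).kappa n ^ 2)
          * ∑ k ∈ Finset.univ.erase j,
            ρ k / (2 * (s t).V.eval ((s t).z k))
              * ((dotz s j t - dotz s k t) / ((s t).z j - (s t).z k))
              * ((s t).z k * ((s t).ThetaStar n).eval ((s t).z k)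
                    * ((s t).Theta n).eval ((s t).z j)
                  - (s t).z j * ((s t).Theta n).eval ((s t).z k)
                    * ((s t).ThetaStar n).eval ((s t).z j))) t := by
  have hκ := (h.isAdmissible ht).kappa_ne_zero
  have h1 := (h.schlesinger_apply ht j 0 0).fun_neg
  simp only [System.residue_zero_zero, neg_neg] at h1
  refine h1.congr_deriv ?_
  have i01 : Binf s n t 0 1 = 0 := rfl
  rw [h.deriv_kappa_mul_phiBar0 ht]
  refine (neg_add _ _).trans ((congrArg₂ (· + ·) ?_ ?_).trans (sub_eq_add_neg _ _).symm)
  · rw [System.residue_zero_one, i01]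
    field_simp
    ring
  · rw [Finset.mul_sum, neg_inj]
    refine Finset.sum_congr rfl fun k _ => ?_
    simp only [System.residue_zero_one, System.residue_one_zero]
    ring

theorem component_zero_one (h : IsAdmissibleDeformation s S D n) (ht : t ∈ S)
    (j : Fin (m + 1)) :
    HasDerivAt
      (fun τ => ρ j / (2 * (s τ).V.eval ((s τ).z j)) * ((s τ).phi0 (n + 1) / (s τ).kappa n)
        * ((s τ).Theta n).eval ((s τ).z j))
      (ρ j / (s t).V.eval ((s t).z j) * ((s t).phi0 (n + 1) / (s t).kappa n) *
        (dotkappa s n t / (s t).kappa n * ((s t).Theta n).eval ((s t).z j)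
          + ∑ k ∈ Finset.univ.erase j,
            ρ k / (2 * (s t).V.eval ((s t).z k))
              * ((dotz s j t - dotz s k t) / ((s t).z j - (s t).z k))
              * (((s t).Theta n).eval ((s t).z k) * (s t).omegaBracket n j
                  - ((s t).Theta n).eval ((s t).z j) * (s t).omegaBracket n k))) t := by
  have ha := h.isAdmissible ht
  have h1 := h.schlesinger_apply ht j 0 1
  have e : ∀ j, (s t).residue n j 0 0 = (s t).residue n j 1 1 +
      -(2 * (ρ j / (2 * (s t).V.eval ((s t).z j)) * (s t).omegaBracket n j)) := fun j => by
    rw [← ha.residue_sub]; ring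
  have i00 : Binf s n t 0 0 = dotkappa s n t / (s t).kappa n := rfl
  have i01 : Binf s n t 0 1 = 0 := rfl
  have i11 : Binf s n t 1 1 = -(dotkappa s n t / (s t).kappa n) := rfl
  simp only [e, System.residue_zero_one, i00, i01, i11] at h1
  refine h1.congr_deriv ?_
  rw [mul_add, Finset.mul_sum]
  congr 1
  · ring
  · exact Finset.sum_congr rfl fun k _ => by ring

theorem component_one_zero (h : IsAdmissibleDeformation s S D n) (ht : t ∈ S)
    (j : Fin (m + 1)) :
    HasDerivAt
      (fun τ => ρ j / (2 * (s τ).V.eval ((s τ).z j)) * ((s τ).phiBar0 (n + 1) / (s τ).kappa n)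
        * (s τ).z j * ((s τ).ThetaStar n).eval ((s τ).z j))
      (ρ j / (s t).V.eval ((s t).z j) * ((s t).phiBar0 (n + 1) / (s t).kappa n) *
        (-(dotkappa s n t / (s t).kappa n * (s t).z j
            * ((s t).ThetaStar n).eval ((s t).z j))
          + 1 / ((s t).kappa n * (s t).phiBar0 (n + 1))
            * deriv (fun τ => (s τ).kappa n * (s τ).phiBar0 n) t
            * (s t).omegaStarBracket n j
          - ∑ k ∈ Finset.univ.erase j,
            ρ k / (2 * (s t).V.eval ((s t).z k))
              * ((dotz s j t - dotz s k t) / ((s t).z j - (s t).z k))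
              * ((s t).z k * ((s t).ThetaStar n).eval ((s t).z k)
                    * (s t).omegaStarBracket n j
                  - (s t).z j * ((s t).ThetaStar n).eval ((s t).z j)
                    * (s t).omegaStarBracket n k))) t := by
  have ha := h.isAdmissible ht
  have hκ := ha.kappa_ne_zero
  have hφ := ha.phiBar0_ne_zero
  have h1 := (h.schlesinger_apply ht j 1 0).fun_neg
  have e : ∀ j, (s t).residue n j 0 0 = (s t).residue n j 1 1 +
      -(2 * (ρ j / (2 * (s t).V.eval ((s t).z j)) * (s t).omegaBracket n j)) := fun j => by
    rw [← ha.residue_sub]; ring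
  have i00 : Binf s n t 0 0 = dotkappa s n t / (s t).kappa n := rfl
  have i11 : Binf s n t 1 1 = -(dotkappa s n t / (s t).kappa n) := rfl
  simp only [e, System.residue_one_zero, i00, i11, neg_neg] at h1
  refine h1.congr_deriv ?_
  simp only [(ha.brackets _).2]
  have e1 : 1 / ((s t).kappa n * (s t).phiBar0 (n + 1)) *
      deriv (fun τ => (s τ).kappa n * (s τ).phiBar0 n) t =
      (s t).kappa n / (s t).phiBar0 (n + 1) * Binf s n t 1 0 := by
    rw [h.deriv_kappa_mul_phiBar0 ht]; field_simp
  have e2 : (s t).phiBar0 (n + 1) / (s t).kappa n *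
      ((s t).kappa n / (s t).phiBar0 (n + 1)) = 1 := by field_simp
  rw [e1, mul_sub]
  refine (neg_add _ _).trans ((congrArg₂ (· + ·) ?_ ?_).trans (sub_eq_add_neg _ _).symm)
  · linear_combination -(ρ j / (s t).V.eval ((s t).z j)) * Binf s n t 1 0 *
      (s t).omegaBracket n j * e2
  · rw [Finset.mul_sum, neg_inj]
    exact Finset.sum_congr rfl fun k _ => by ring

end IsAdmissibleDeformation

end BOPUC

end

theorem mainTheorem10 {m : ℕ} {ρ : Fin (m + 1) → ℂ} (s : ℝ → BOPUC.System m ρ)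
    (S : Set ℝ) (D : Set (ℝ × ℂ)) (hs : BOPUC.IsDeformation s S D) (n : ℕ)
    (hsys : ∀ t ∈ S, (s t).IsBiorthonormal (n + 1))
    (hkappa : ∀ k ≤ n + 1, ContinuousOn (fun t => (s t).kappa k) S)
    (hphi : ∀ t ∈ S, (s t).phi0 (n + 1) ≠ 0)
    (hphiBar : ∀ t ∈ S, (s t).phiBar0 (n + 1) ≠ 0)
    (t : ℝ) (ht : t ∈ S) :
    -- the time derivatives in `B_∞` exist
    DifferentiableAt ℝ (fun τ => (s τ).kappa n) t ∧
    DifferentiableAt ℝ (fun τ => (s τ).phiBar0 n) t ∧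
    -- the coefficient functions are polynomials
    (s t).IsTheta n ((s t).Theta n) ∧
    (s t).IsThetaStar n ((s t).ThetaStar n) ∧
    (s t).IsOmega n ((s t).Omega n) ∧
    (s t).IsOmegaStar n ((s t).OmegaStar n) ∧
    -- the `A_{nj}` are the residue matrices of `A_n`; the residue matrix at the origin
    (∀ x : ℂ, (∀ j, x ≠ (s t).z j) →
      (s t).A n x = ∑ j, (x - (s t).z j)⁻¹ • (s t).residue n j) ∧
    (s t).residue n 0 = (ρ 0 / (2 * (s t).V.eval 0)) •
      !![(n : ℂ) * (s t).W.derivative.eval 0 - 2 * (s t).V.eval 0,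
          (2 * (s t).V.eval 0 - (n : ℂ) * (s t).W.derivative.eval 0)
            * ((s t).phi0 n / (s t).kappa n);
        0, 0] ∧
    -- the spectral equation, the deformation system and its matrix form
    (∀ x : ℂ, (t, x) ∈ D → ‖x‖ ≠ 1 → (s t).w x ≠ 0 →
      BOPUC.HasEntryDerivAt (fun y => (s t).Y n y) ((s t).A n x * (s t).Y n x) x ∧
      (∀ f fs e es : ℝ → ℂ,
        BOPUC.DeformationSystem s n t x f fs e es ↔
          BOPUC.MatrixDeformationEquation s n t x f fs e es) ∧
      BOPUC.DeformationSystem s n t x (fun τ => ((s τ).phi n).eval x)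
        (fun τ => ((s τ).phiStar n).eval x) (fun τ => (s τ).eps n x)
        (fun τ => (s τ).epsStar n x) ∧
      BOPUC.HasEntryDerivAt (fun τ => (s τ).Y n x) (BOPUC.B s n t x * (s t).Y n x) t) ∧
    -- the Schlesinger equations in matrix form
    (∀ j, BOPUC.HasEntryDerivAt (fun τ => (s τ).residue n j)
      ((BOPUC.Binf s n t * (s t).residue n j - (s t).residue n j * BOPUC.Binf s n t)
        + ∑ k ∈ Finset.univ.erase j,
          ((BOPUC.dotz s j t - BOPUC.dotz s k t) / ((s t).z j - (s t).z k)) •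
            ((s t).residue n k * (s t).residue n j - (s t).residue n j * (s t).residue n k)) t) ∧
    BOPUC.HasEntryDerivAt (fun τ => (s τ).residueInf n)
      (BOPUC.Binf s n t * (s t).residueInf n - (s t).residueInf n * BOPUC.Binf s n t) t ∧
    -- the Schlesinger equations in components
    (∀ j,
      HasDerivAt
        (fun τ => ρ j / (2 * (s τ).V.eval ((s τ).z j)) *
          (((s τ).Omega n).eval ((s τ).z j) + (s τ).V.eval ((s τ).z j)
            - (s τ).kappa (n + 1) / (s τ).kappa n * (s τ).z j
              * ((s τ).Theta n).eval ((s τ).z j)))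
        (ρ j / (2 * (s t).V.eval ((s t).z j)) * ((s t).phi0 (n + 1) / (s t).kappa n ^ 3)
            * deriv (fun τ => (s τ).kappa n * (s τ).phiBar0 n) t
            * ((s t).Theta n).eval ((s t).z j)
          - ρ j / (2 * (s t).V.eval ((s t).z j))
            * ((s t).phi0 (n + 1) * (s t).phiBar0 (n + 1) / (s t).kappa n ^ 2)
            * ∑ k ∈ Finset.univ.erase j,
              ρ k / (2 * (s t).V.eval ((s t).z k))
                * ((BOPUC.dotz s j t - BOPUC.dotz s k t) / ((s t).z j - (s t).z k))
                * ((s t).z k * ((s t).ThetaStar n).eval ((s t).z k)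
                      * ((s t).Theta n).eval ((s t).z j)
                    - (s t).z j * ((s t).Theta n).eval ((s t).z k)
                      * ((s t).ThetaStar n).eval ((s t).z j))) t ∧
      HasDerivAt
        (fun τ => ρ j / (2 * (s τ).V.eval ((s τ).z j)) * ((s τ).phi0 (n + 1) / (s τ).kappa n)
          * ((s τ).Theta n).eval ((s τ).z j))
        (ρ j / (s t).V.eval ((s t).z j) * ((s t).phi0 (n + 1) / (s t).kappa n) *
          (BOPUC.dotkappa s n t / (s t).kappa n * ((s t).Theta n).eval ((s t).z j)
            + ∑ k ∈ Finset.univ.erase j,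
              ρ k / (2 * (s t).V.eval ((s t).z k))
                * ((BOPUC.dotz s j t - BOPUC.dotz s k t) / ((s t).z j - (s t).z k))
                * (((s t).Theta n).eval ((s t).z k) * (s t).omegaBracket n j
                    - ((s t).Theta n).eval ((s t).z j) * (s t).omegaBracket n k))) t ∧
      HasDerivAt
        (fun τ => ρ j / (2 * (s τ).V.eval ((s τ).z j)) * ((s τ).phiBar0 (n + 1) / (s τ).kappa n)
          * (s τ).z j * ((s τ).ThetaStar n).eval ((s τ).z j))
        (ρ j / (s t).V.eval ((s t).z j) * ((s t).phiBar0 (n + 1) / (s t).kappa n) *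
          (-(BOPUC.dotkappa s n t / (s t).kappa n * (s t).z j
              * ((s t).ThetaStar n).eval ((s t).z j))
            + 1 / ((s t).kappa n * (s t).phiBar0 (n + 1))
              * deriv (fun τ => (s τ).kappa n * (s τ).phiBar0 n) t
              * (s t).omegaStarBracket n j
            - ∑ k ∈ Finset.univ.erase j,
              ρ k / (2 * (s t).V.eval ((s t).z k))
                * ((BOPUC.dotz s j t - BOPUC.dotz s k t) / ((s t).z j - (s t).z k))
                * ((s t).z k * ((s t).ThetaStar n).eval ((s t).z k)
                      * (s t).omegaStarBracket n j
                    - (s t).z j * ((s t).ThetaStar n).eval ((s t).z j)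
                      * (s t).omegaStarBracket n k))) t) := by
  have h : BOPUC.IsAdmissibleDeformation s S D n :=
    ⟨hs, hsys, hkappa n n.le_succ, hphi, hphiBar⟩
  have ha := h.isAdmissible ht
  obtain ⟨⟨h1, h2, h3, h4⟩, -⟩ := ha.spectral
  refine ⟨h.differentiableAt_kappa ht, h.differentiableAt_phiBar0 ht, h1, h2, h3, h4,
    fun x hx => ha.A_eq hx, ha.residue_zero, fun x hxD hx hw => ?_, h.schlesinger ht,
    h.schlesinger_inf ht, fun j => ⟨h.component_zero_zero ht j, h.component_zero_one ht j,
      h.component_one_zero ht j⟩⟩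
  have hz := (hs.domain_sub t x hxD).2
  have hiff : ∀ f fs e es : ℝ → ℂ, BOPUC.DeformationSystem s n t x f fs e es ↔
      BOPUC.MatrixDeformationEquation s n t x f fs e es := fun f fs e es =>
    (h.deformationSystem_iff ht hz f fs e es).trans
      (h.matrixDeformationEquation_iff hxD hw f fs e es).symm
  have hsol := h.deformationSystem ht hx hz
  refine ⟨ha.hasEntryDerivAt_Y hx hz ?_ hw, hiff, hsol, (hiff _ _ _ _).1 hsol⟩
  have hW := BOPUC.System.eval_W_ne_zero hz
  refine (hs.differentiable_weight t x hxD).hasDerivAt.congr_deriv ?_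
  rw [div_mul_eq_mul_div, eq_div_iff hW, ← hs.log_derivative t x hxD, mul_comm]
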